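/- Let $R$ be a commutative ring in which $2$ and $3$ are invertible, $A$ a commutative $R$-algebra, $L'$ and $L''$ two $A$-modules. An *almost twilled Lie-Rinehart algebra* $(A,L',L'')$ consists of Lie-Rinehart algebra structures on $(A,L')$ and $(A,L'')$, with brackets $[\cdot,\cdot]'$, $[\cdot,\cdot]''$, together with a left $(A,L')$-module structure $x\otimes\xi\mapsto x\cdot\xi$ on $L''$ and a left $(A,L'')$-module structure $\xi\otimes x\mapsto\xi\cdot x$ on $L'$ (i.e. flat connections). It is *twilled* when $L'\oplus L''$, with the sum of the two actions on $A$ and the bracket $$[(x,\xi),(y,\eta)]=\bigl([x,y]'+\xi\cdot y-\eta\cdot x,\ [\xi,\eta]''+x\cdot\eta-y\cdot\xi\bigr),$$ is a Lie-Rinehart algebra. If the module structures are only required to be connections (not necessarily flat), the brackets are only required to be alternating (no Jacobi identity), and the $A$-linear maps $L',L''\to\mathrm{Der}_R(A)$, for which the brackets satisfy the usual Leibniz rule, are not required to preserve brackets, one speaks of an *almost twilled pre-Lie-Rinehart algebra*. An $A$-module $M$ has *property P* if $x=0$ whenever $x\in M$ and $\varphi(x)=0$ for all $\varphi\in\mathrm{Hom}_A(M,A)$;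 for example, projective modules have property P. Consider the bigraded module $\mathrm{Alt}_A(L'',\Lambda_AL')$, with $\mathrm{Alt}^p_A(L'',\Lambda^q_AL')$ in bidegree $(p,q)$ and total degree $|\alpha|=p+q$; its product is the shuffle product of forms with values multiplied in $\Lambda_AL'$, with the sign $(-1)^{(p+q)p'}$ on bidegrees $(p,q)$, $(p',q')$. Let $d''$ be the Lie-Rinehart operator for $L''$ with values in $\Lambda_AL'$, on which $L''$ acts by derivations extending its actions on $A$ and $L'$: for $f$ of form degree $n-1$, $$(d''f)(\xi_1,\dots,\xi_n)=(-1)^n\Bigl(\sum_i(-1)^{i-1}\xi_i\cdot f(\dots\widehat{\xi_i}\dots)+\sum_{j<k}(-1)^{j+k}f([\xi_j,\xi_k]'',\dots\widehat{\xi_j}\dots\widehat{\xi_k}\dots)\Bigr).$$ A *crossed-product bracket* on $\mathrm{Alt}_A(L'',\Lambda_AL')$ is an $R$-bilinear bracket of bidegree $(0,-1)$ that satisfies $$[\alpha,\beta]=-(-1)^{(|\alpha|-1)(|\beta|-1)}[\beta,\alpha],\qquad[\alpha\beta,\gamma]=\alpha[\beta,\gamma]+(-1)^{|\alpha||\beta|}\beta[\alpha,\gamma]$$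 for homogeneous $\alpha,\beta$ and all $\gamma$, restricts to $[\cdot,\cdot]'$ on $L'$, and satisfies, for $x\in L'$ and $\alpha\in\mathrm{Alt}^p_A(L'',A)$, $$[x,\alpha](\xi_1,\dots,\xi_p)=x\bigl(\alpha(\xi_1,\dots,\xi_p)\bigr)-\sum_k\alpha(\xi_1,\dots,x\cdot\xi_k,\dots,\xi_p).$$ A *bigraded Gerstenhaber algebra* is a bigraded, graded commutative (for the total degree), associative, unital algebra with a bracket of bidegree $(0,-1)$ that is skew as above and satisfies the graded Jacobi identity $[\alpha,[\beta,\gamma]]=[[\alpha,\beta],\gamma]+(-1)^{(|\alpha|-1)(|\beta|-1)}[\beta,[\alpha,\gamma]]$ and the Leibniz rule $[\alpha,\beta\gamma]=[\alpha,\beta]\gamma+(-1)^{(|\alpha|-1)|\beta|}\beta[\alpha,\gamma]$. It is *differential*, with respect to an operator $d$ of bidegree $(1,0)$, if $d^2=0$, $d(\alpha\beta)=(d\alpha)\beta+(-1)^{|\alpha|}\alpha\, d\beta$ and $d[\alpha,\beta]=[d\alpha,\beta]-(-1)^{|\alpha|}[\alpha,d\beta]$. **Theorem 4.4.** (a) Let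 $(A,L',L'')$ be an almost twilled Lie-Rinehart algebra with $L'$ finitely generated and projective as an $A$-module. Then there is exactly one crossed-product bracket $[\cdot,\cdot]'$ on $\mathrm{Alt}_A(L'',\Lambda_AL')$, and with it $\mathrm{Alt}_A(L'',\Lambda_AL')$ is a bigraded Gerstenhaber algebra. If $(A,L',L'')$ is twilled, then $(\mathrm{Alt}_A(L'',\Lambda_AL'),[\cdot,\cdot]',d'')$ is a differential bigraded Gerstenhaber algebra; conversely, if $L''$ has property P and $(\mathrm{Alt}_A(L'',\Lambda_AL'),[\cdot,\cdot]',d'')$ is a differential bigraded Gerstenhaber algebra, then $(A,L',L'')$ is twilled. (b) Let $M$ be a smooth (Hausdorff, $\sigma$-compact, finite-dimensional) manifold with an almost complex structure $J$, let $A=C^\infty(M,\mathbb C)$, let $L$ be the module of complexified smooth vector fields (the derivations of $A$ over $\mathbb C$), let $L=L'\oplus L''$ be its decomposition into the eigenspaces of $J$ for the eigenvalues $i$ and $-i$, and let $(A,L',L'')$ be the almost twilled pre-Lie-Rinehart algebra (over $R=\mathbb C$) whose brackets and pairings are the components of the bracket of $L$. Then $J$ is integrable, i.e. $[JX,JY]-J[JX,Y]-J[X,JY]-[X,Y]=0$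 for all vector fields $X,Y$, if and only if there is a crossed-product bracket on $\mathrm{Alt}_A(L'',\Lambda_AL')$ which, together with $d''$, makes it a differential bigraded Gerstenhaber algebra. -/

import Mathlib

open scoped DirectSum TensorProduct Manifold ContDiff

set_option linter.unusedSectionVars false
set_option linter.unusedSimpArgs false

universe u₁ u₂ u₃ u₄ u₅ u₆

noncomputable section

/-- An `A`-module has property P when its `A`-linear forms separate its elements from zero. -/
def PropertyP (A M : Type*) [CommRing A] [AddCommGroup M] [Module A M] : Prop :=
  ∀ x : M, (∀ φ : M →ₗ[A] A, φ x = 0) → x = 0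

section LieRinehart

variable (R A L N : Type*) [CommRing R] [CommRing A] [Algebra R A]
  [AddCommGroup L] [Module R L] [Module A L] [IsScalarTower R A L]
  [AddCommGroup N] [Module R N] [Module A N] [IsScalarTower R A N]

/-- An `A`-module `L` with an alternating `R`-bilinear bracket (not necessarily a Lie bracket) and
an `A`-linear pairing with `A` by derivations, related as in a Lie-Rinehart algebra. -/
structure PreLieRinehart where
  bracket : L →ₗ[R] L →ₗ[R] L
  bracket_self : ∀ x, bracket x x = 0
  anchor : L →ₗ[A] Derivation R A A
  bracket_smul : ∀ (x : L) (a : A) (y : L),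
    bracket x (a • y) = anchor x a • y + a • bracket x y

variable {R A L}

/-- `(A, L)` is a Lie-Rinehart algebra: the bracket satisfies the Jacobi identity and the map
`L → Der(A)` is a morphism of Lie algebras. -/
structure PreLieRinehart.IsLieRinehart (P : PreLieRinehart R A L) : Prop where
  jacobi : ∀ x y z, P.bracket x (P.bracket y z) =
    P.bracket (P.bracket x y) z + P.bracket y (P.bracket x z)
  anchor_bracket : ∀ x y, P.anchor (P.bracket x y) = ⁅P.anchor x, P.anchor y⁆

/-- A (left) `(A, L)`-connection on an `A`-module `N`. -/
structure PreLieRinehart.Connection (P : PreLieRinehart R A L) where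
  act : L →ₗ[A] N →ₗ[R] N
  act_smul : ∀ (x : L) (a : A) (n : N), act x (a • n) = P.anchor x a • n + a • act x n

variable {N}

/-- A flat connection is the same as a left `(A, L)`-module structure. -/
def PreLieRinehart.Connection.IsFlat {P : PreLieRinehart R A L} (C : P.Connection N) : Prop :=
  ∀ (x y : L) (n : N), C.act (P.bracket x y) n = C.act x (C.act y n) - C.act y (C.act x n)

end LieRinehart

section Forms

variable {R A M N : Type*} [CommRing R] [CommRing A] [Algebra R A]
  [AddCommGroup M] [Module R M] [Module A M] [IsScalarTower R A M]
  [AddCommGroup N] [Module R N] [Module A N] [IsScalarTower R A N]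

theorem formDerivation_aux (D : M →ₗ[R] M) {p : ℕ} (f : M [⋀^Fin p]→ₗ[A] N)
    (v : Fin p → M) (i : Fin p) (z : M) :
    ∑ k, f (Function.update (Function.update v i z) k (D (Function.update v i z k))) =
      f (Function.update v i (D z)) +
        ∑ k ∈ Finset.univ.erase i, f (Function.update (Function.update v k (D (v k))) i z) := by
  rw [← Finset.add_sum_erase _ _ (Finset.mem_univ i)]
  congr 1
  · simp
  · refine Finset.sum_congr rfl fun k hk => ?_
    rw [Function.update_of_ne (Finset.ne_of_mem_erase hk),
      Function.update_comm (Finset.ne_of_mem_erase hk)]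

/-- The derivation of `N`-valued alternating forms on `M` that is induced by operators `D` on `M`
and `E` on `N`, both derivations over the same derivation `δ` of `A`:
`(f ↦ E (f (v₁, …, vₚ)) - ∑ₖ f (v₁, …, D vₖ, …, vₚ))`. -/
def formDerivation (δ : Derivation R A A) (D : M →ₗ[R] M) (E : N →ₗ[R] N)
    (hD : ∀ (a : A) (m : M), D (a • m) = δ a • m + a • D m)
    (hE : ∀ (a : A) (n : N), E (a • n) = δ a • n + a • E n) {p : ℕ}
    (f : M [⋀^Fin p]→ₗ[A] N) : M [⋀^Fin p]→ₗ[A] N where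
  toFun v := E (f v) - ∑ k, f (Function.update v k (D (v k)))
  map_update_add' := by
    intro inst v i x y
    obtain rfl : inst = instDecidableEqFin p := Subsingleton.elim _ _
    simp only [formDerivation_aux, f.map_update_add, map_add, Finset.sum_add_distrib]
    abel
  map_update_smul' := by
    intro inst v i a x
    obtain rfl : inst = instDecidableEqFin p := Subsingleton.elim _ _
    simp only [formDerivation_aux, f.map_update_add, f.map_update_smul, hE, hD, ← Finset.smul_sum,
      smul_sub, smul_add]
    abel
  map_eq_zero_of_eq' := by
    intro v i j hij hne
    rw [f.map_eq_zero_of_eq v hij hne, map_zero, zero_sub, neg_eq_zero]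
    have : ∀ k, k ≠ i ∧ k ≠ j → f (Function.update v k (D (v k))) = 0 := by
      intro k hk
      apply f.map_eq_zero_of_eq _ _ hne
      rw [Function.update_of_ne hk.1.symm, Function.update_of_ne hk.2.symm, hij]
    rw [Fintype.sum_eq_add i j hne this, hij]
    have h2 : Function.update v j (D (v j)) =
        Function.update v i (D (v j)) ∘ Equiv.swap i j := by
      funext k
      by_cases hki : k = i
      · subst hki; simp [Function.update_of_ne hne, Function.update_of_ne hne.symm, hij]
      · by_cases hkj : k = j
        · subst hkj; simp
        · simp [Equiv.swap_apply_of_ne_of_ne hki hkj, Function.update_of_ne hki,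
            Function.update_of_ne hkj]
    rw [h2, f.map_swap _ hne]
    abel

@[simp] theorem formDerivation_apply (δ : Derivation R A A) (D : M →ₗ[R] M) (E : N →ₗ[R] N)
    (hD : ∀ (a : A) (m : M), D (a • m) = δ a • m + a • D m)
    (hE : ∀ (a : A) (n : N), E (a • n) = δ a • n + a • E n) {p : ℕ}
    (f : M [⋀^Fin p]→ₗ[A] N) (v : Fin p → M) :
    formDerivation δ D E hD hE f v = E (f v) - ∑ k, f (Function.update v k (D (v k))) := rfl

/-- Assembling an alternating form from its contractions. -/
theorem exists_alternating_of_curry {p : ℕ} (G : M →ₗ[A] M [⋀^Fin p]→ₗ[A] N)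
    (h : ∀ (x : M) (v : Fin p → M) (i : Fin p), (i : ℕ) = 0 → v i = x → G x v = 0) :
    ∃ g : M [⋀^Fin (p + 1)]→ₗ[A] N, ∀ x v, g (Matrix.vecCons x v) = G x v := by
  have h' : ∀ (x : M) (v : Fin p → M) (i : Fin p), v i = x → G x v = 0 := by
    intro x v i hi
    have hp : 0 < p := i.pos
    by_cases h0 : i = ⟨0, hp⟩
    · exact h x v i (by rw [h0]) hi
    · have := (G x).map_swap v h0
      rw [h x _ ⟨0, hp⟩ rfl (by simp [hi])] at this
      exact neg_eq_zero.mp this.symm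
  refine ⟨{ toMultilinearMap := LinearMap.uncurryLeft
              ((AlternatingMap.toMultilinearMapLM (S := A)).comp G),
            map_eq_zero_of_eq' := ?_ }, ?_⟩
  · intro v i j hij hne
    simp only [MultilinearMap.toFun_eq_coe, LinearMap.uncurryLeft_apply]
    change G (v 0) (Fin.tail v) = 0
    induction i using Fin.cases with
    | zero =>
      induction j using Fin.cases with
      | zero => exact absurd rfl hne
      | succ j => exact h' _ _ j hij.symm
    | succ i =>
      induction j using Fin.cases with
      | zero => exact h' _ _ i hij
      | succ j =>
        exact (G (v 0)).map_eq_zero_of_eq _ (i := i) (j := j) hij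
          (fun e => hne (by rw [e]))
  · intro x v
    change G (Matrix.vecCons x v 0) (Fin.tail (Matrix.vecCons x v)) = _
    rfl

end Forms

section Differential

variable {R A L N : Type*} [CommRing R] [CommRing A] [Algebra R A]
  [AddCommGroup L] [Module R L] [Module A L] [IsScalarTower R A L]
  [AddCommGroup N] [Module R N] [Module A N] [IsScalarTower R A N]
  {P : PreLieRinehart R A L}

/-- The second sum of the Cartan-Chevalley-Eilenberg formula,
`∑_{j < k} (-1)^(j+k) f ([v j, v k], …, without v j and v k, …)`. -/
def bracketSum (P : PreLieRinehart R A L) :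
    ∀ {p : ℕ}, (L [⋀^Fin p]→ₗ[A] N) → (Fin (p + 1) → L) → N
  | 0, _, _ => 0
  | n + 1, f, v => ∑ k : Fin (n + 2), ∑ j : Fin (n + 1),
      if j.castSucc < k then
        (-1 : ℤ) ^ ((j : ℕ) + (k : ℕ)) • f (Matrix.vecCons (P.bracket (v j.castSucc) (v k))
          (j.removeNth (k.removeNth v)))
      else 0

/-- The Cartan-Chevalley-Eilenberg expression, without the overall sign. -/
def ceSum (C : P.Connection N) {p : ℕ} (f : L [⋀^Fin p]→ₗ[A] N) (v : Fin (p + 1) → L) : N :=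
  ∑ i : Fin (p + 1), (-1 : ℤ) ^ (i : ℕ) • C.act (v i) (f (i.removeNth v)) + bracketSum P f v

theorem bracketSum_add {p : ℕ} (f g : L [⋀^Fin p]→ₗ[A] N) (v : Fin (p + 1) → L) :
    bracketSum P (f + g) v = bracketSum P f v + bracketSum P g v := by
  cases p with
  | zero => simp [bracketSum]
  | succ n =>
    simp only [bracketSum, AlternatingMap.add_apply, smul_add, ← Finset.sum_add_distrib]
    refine Finset.sum_congr rfl fun k _ => Finset.sum_congr rfl fun j _ => ?_
    split_ifs <;> simp

theorem bracketSum_smul {p : ℕ} (a : A) (f : L [⋀^Fin p]→ₗ[A] N) (v : Fin (p + 1) → L) :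
    bracketSum P (a • f) v = a • bracketSum P f v := by
  cases p with
  | zero => simp [bracketSum]
  | succ n =>
    simp only [bracketSum, AlternatingMap.smul_apply, Finset.smul_sum]
    refine Finset.sum_congr rfl fun k _ => Finset.sum_congr rfl fun j _ => ?_
    split_ifs
    · rw [smul_comm]
    · simp

theorem bracketSum_cons {p : ℕ} (f : L [⋀^Fin (p + 1)]→ₗ[A] N) (x : L) (w : Fin (p + 1) → L) :
    bracketSum P f (Matrix.vecCons x w) =
      - ∑ k, f (Function.update w k (P.bracket x (w k))) - bracketSum P (f.curryLeft x) w := by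
  have h0 : ∀ k : Fin (p + 1), f (Function.update w k (P.bracket x (w k))) =
      (-1 : ℤ) ^ (k : ℕ) • f (Matrix.vecCons (P.bracket x (w k)) (k.removeNth w)) := by
    intro k
    rw [← Fin.insertNth_removeNth, AlternatingMap.map_insertNth]
  have h1 : ∀ k : Fin (p + 1), (k.succ.removeNth (Matrix.vecCons x w) : Fin (p + 1) → L) =
      Matrix.vecCons x (k.removeNth w : Fin p → L) := by
    intro k
    funext i
    induction i using Fin.cases with
    | zero => simp [Fin.removeNth]
    | succ i => simp [Fin.removeNth, Fin.succ_succAbove_succ]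
  have h2 : ∀ k : Fin (p + 1), ((0 : Fin (p + 1)).removeNth
      (k.succ.removeNth (Matrix.vecCons x w) : Fin (p + 1) → L) : Fin p → L) =
      k.removeNth w := by
    intro k
    rw [h1]; rfl
  simp only [bracketSum]
  rw [Fin.sum_univ_succ]
  simp only [Fin.not_lt_zero, if_false, Finset.sum_const_zero, zero_add]
  simp_rw [h0]
  rw [← Finset.sum_neg_distrib]
  cases p with
  | zero =>
    simp [bracketSum, h2, pow_succ]
  | succ n =>
    simp only [bracketSum]
    rw [← Finset.sum_sub_distrib]
    refine Finset.sum_congr rfl fun k _ => ?_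
    rw [Fin.sum_univ_succ, sub_eq_add_neg, ← Finset.sum_neg_distrib]
    congr 1
    · rw [h2]
      simp [pow_succ]
    · refine Finset.sum_congr rfl fun j _ => ?_
      simp only [h1, ← Fin.succ_castSucc, Fin.succ_lt_succ_iff]
      split_ifs with hlt
      · have h3 : (j.succ.removeNth (Matrix.vecCons x (k.removeNth w)) : Fin (n + 1) → L) =
            Matrix.vecCons x (j.removeNth (k.removeNth w)) := by
          funext i
          induction i using Fin.cases with
          | zero => simp [Fin.removeNth]
          | succ i => simp [Fin.removeNth, Fin.succ_succAbove_succ]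
        rw [h3]
        have h4 : ∀ (y : L) (u : Fin n → L), f (Matrix.vecCons y (Matrix.vecCons x u)) =
            - f (Matrix.vecCons x (Matrix.vecCons y u)) := by
          intro y u
          have := f.map_swap (Matrix.vecCons x (Matrix.vecCons y u))
            (i := 0) (j := 1) (by simp)
          rw [← this]
          congr 1
          funext i
          induction i using Fin.cases with
          | zero => simp
          | succ i =>
            induction i using Fin.cases with
            | zero => simp
            | succ i =>
              have : (Equiv.swap (0 : Fin (n + 2)) 1) i.succ.succ = i.succ.succ :=
                Equiv.swap_apply_of_ne_of_ne (by simp) (by simp [Fin.ext_iff])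
              simp [this]
        rw [h4]
        simp only [Matrix.cons_val_succ, AlternatingMap.curryLeft_apply_apply, Fin.val_succ,
          smul_neg, neg_inj]
        congr 1
        ring
      · simp

theorem ceSum_zero (C : P.Connection N) (f : L [⋀^Fin 0]→ₗ[A] N) (v : Fin 1 → L) :
    ceSum C f v = C.act (v 0) (f ![]) := by
  simp only [ceSum, bracketSum, Finset.univ_unique, Fin.default_eq_zero, Finset.sum_singleton,
    add_zero]
  simp
  congr 2
  exact Subsingleton.elim _ _

theorem ceSum_cons (C : P.Connection N) {p : ℕ} (f : L [⋀^Fin (p + 1)]→ₗ[A] N) (x : L)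
    (w : Fin (p + 1) → L) :
    ceSum C f (Matrix.vecCons x w) = formDerivation (P.anchor x) (P.bracket x) (C.act x)
      (P.bracket_smul x) (C.act_smul x) f w - ceSum C (f.curryLeft x) w := by
  have h1 : ∀ k : Fin (p + 1), (k.succ.removeNth (Matrix.vecCons x w) : Fin (p + 1) → L) =
      Matrix.vecCons x (k.removeNth w : Fin p → L) := by
    intro k
    funext i
    induction i using Fin.cases with
    | zero => simp [Fin.removeNth]
    | succ i => simp [Fin.removeNth, Fin.succ_succAbove_succ]
  have h2 : ((0 : Fin (p + 2)).removeNth (Matrix.vecCons x w) : Fin (p + 1) → L) = w := rfl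
  simp only [ceSum, formDerivation_apply, bracketSum_cons]
  rw [Fin.sum_univ_succ, h2]
  simp only [h1, Matrix.cons_val_zero, Matrix.cons_val_succ, Fin.val_zero, pow_zero, one_smul,
    Fin.val_succ, pow_succ, mul_neg, mul_one, neg_smul, Finset.sum_neg_distrib,
    AlternatingMap.curryLeft_apply_apply]
  abel

theorem ceSum_add (C : P.Connection N) {p : ℕ} (f g : L [⋀^Fin p]→ₗ[A] N)
    (v : Fin (p + 1) → L) : ceSum C (f + g) v = ceSum C f v + ceSum C g v := by
  simp only [ceSum, bracketSum_add, AlternatingMap.add_apply, map_add, smul_add,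
    Finset.sum_add_distrib]
  abel

theorem ceSum_smul (C : P.Connection N) {p : ℕ} (a : A) (f : L [⋀^Fin p]→ₗ[A] N)
    (v : Fin (p + 1) → L) : ceSum C (a • f) v = a • ceSum C f v +
      ∑ i : Fin (p + 1), (-1 : ℤ) ^ (i : ℕ) • P.anchor (v i) a • f (i.removeNth v) := by
  simp only [ceSum, bracketSum_smul, AlternatingMap.smul_apply, C.act_smul, smul_add,
    Finset.sum_add_distrib, Finset.smul_sum]
  simp_rw [smul_comm a ((-1 : ℤ) ^ _)]
  abel

theorem exists_ceSum (C : P.Connection N) {p : ℕ} (f : L [⋀^Fin p]→ₗ[A] N) :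
    ∃ g : L [⋀^Fin (p + 1)]→ₗ[A] N, ∀ v, g v = ceSum C f v := by
  induction p with
  | zero =>
    let G : L →ₗ[A] L [⋀^Fin 0]→ₗ[A] N :=
      { toFun := fun x => AlternatingMap.constOfIsEmpty A L (Fin 0) (C.act x (f ![]))
        map_add' := by intro x y; ext v; simp
        map_smul' := by intro a x; ext v; simp }
    obtain ⟨g, hg⟩ := exists_alternating_of_curry G (fun x v i _ => i.elim0)
    refine ⟨g, fun v => ?_⟩
    rw [ceSum_zero, ← Matrix.cons_head_tail v, hg]
    rfl
  | succ p ih =>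
    choose d hd using fun f => ih (f := f)
    let G : L →ₗ[A] L [⋀^Fin (p + 1)]→ₗ[A] N :=
      { toFun := fun x => formDerivation (P.anchor x) (P.bracket x) (C.act x)
          (P.bracket_smul x) (C.act_smul x) f - d (f.curryLeft x)
        map_add' := by
          intro x y
          ext v
          simp only [AlternatingMap.sub_apply, AlternatingMap.add_apply, hd, map_add, ceSum_add,
            formDerivation_apply, LinearMap.add_apply, f.map_update_add, Finset.sum_add_distrib]
          abel
        map_smul' := by
          intro a x
          ext v
          have hbr : ∀ y, P.bracket (a • x) y = a • P.bracket x y - P.anchor y a • x := by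
            intro y
            have h1 := P.bracket_self (a • x + y)
            have h2 := P.bracket_self (x + y)
            simp only [map_add, LinearMap.add_apply, P.bracket_self, zero_add, add_zero] at h1 h2
            rw [eq_neg_of_add_eq_zero_right h1, P.bracket_smul,
              eq_neg_of_add_eq_zero_left h2]
            simp only [smul_neg]; abel
          have hup : ∀ k : Fin (p + 1), f (Function.update v k x) =
              (-1 : ℤ) ^ (k : ℕ) • f (Matrix.vecCons x (k.removeNth v)) := by
            intro k
            rw [← Fin.insertNth_removeNth, AlternatingMap.map_insertNth]
          simp only [AlternatingMap.sub_apply, AlternatingMap.smul_apply, hd, map_smul,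
            ceSum_smul, formDerivation_apply, LinearMap.smul_apply, hbr, RingHom.id_apply,
            AlternatingMap.map_update_sub, AlternatingMap.map_update_smul, hup,
            Finset.sum_sub_distrib, AlternatingMap.curryLeft_apply_apply, smul_sub,
            Finset.smul_sum]
          simp_rw [smul_comm (P.anchor _ a) ((-1 : ℤ) ^ _)]
          abel }
    have hG : ∀ x v, G x v = ceSum C f (Matrix.vecCons x v) := by
      intro x v
      rw [ceSum_cons, ← hd]
      rfl
    have hvan : ∀ (x : L) (v : Fin (p + 1) → L) (i : Fin (p + 1)), (i : ℕ) = 0 → v i = x →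
        G x v = 0 := by
      intro x v i hi hv
      obtain rfl : i = 0 := Fin.ext hi
      obtain ⟨u, rfl⟩ : ∃ u, v = Matrix.vecCons x u :=
        ⟨Matrix.vecTail v, by rw [← hv]; exact (Matrix.cons_head_tail v).symm⟩
      rw [hG, ceSum_cons]
      cases p with
      | zero =>
        simp [ceSum_zero, P.bracket_self, Finset.univ_unique, f.map_update_zero]
        rw [sub_eq_zero]
        congr 3
        exact Subsingleton.elim _ _
      | succ m =>
        rw [ceSum_cons]
        have hcc : (f.curryLeft x).curryLeft x = 0 := AlternatingMap.curryLeft_same f x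
        have hz : ceSum C ((f.curryLeft x).curryLeft x) u = 0 := by
          rw [hcc]
          have := ceSum_add C (0 : L [⋀^Fin m]→ₗ[A] N) 0 u
          simpa using this
        rw [hz, sub_zero]
        simp only [formDerivation_apply, AlternatingMap.curryLeft_apply_apply]
        rw [Fin.sum_univ_succ]
        have hup : ∀ (k : Fin (m + 1)) (y : L), Function.update (Matrix.vecCons x u) k.succ y =
            Matrix.vecCons x (Function.update u k y) := by
          intro k y
          funext i
          induction i using Fin.cases with
          | zero => simp [Function.update_of_ne (Fin.succ_ne_zero k).symm]
          | succ i =>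
            by_cases hik : i = k
            · subst hik; simp
            · simp [Function.update_of_ne, hik]
        simp [hup, P.bracket_self, f.map_update_zero]
    obtain ⟨g, hg⟩ := exists_alternating_of_curry G hvan
    refine ⟨g, fun v => ?_⟩
    have hv := Matrix.cons_head_tail v
    rw [← hv, hg, hG]

/-- The Lie-Rinehart operator on alternating forms, with the Eilenberg-Koszul sign: for
`v = (v₁, …, vₙ)`, `n = p + 1`,
`(d f) v = (-1)ⁿ (∑ᵢ (-1)^(i-1) vᵢ (f (…v̂ᵢ…)) + ∑_{j<k} (-1)^(j+k) f ([vⱼ, vₖ], …v̂ⱼ…v̂ₖ…))`. -/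
def lieRinehartDifferential (C : P.Connection N) (p : ℕ) :
    (L [⋀^Fin p]→ₗ[A] N) →ₗ[R] L [⋀^Fin (p + 1)]→ₗ[A] N where
  toFun f :=
    { toFun := fun v => (-1 : ℤ) ^ (p + 1) • ceSum C f v
      map_update_add' := by
        intro inst v i x y
        obtain ⟨g, hg⟩ := exists_ceSum C f
        simp only [← hg, g.map_update_add, smul_add]
      map_update_smul' := by
        intro inst v i a x
        obtain ⟨g, hg⟩ := exists_ceSum C f
        simp only [← hg, g.map_update_smul, smul_comm a]
      map_eq_zero_of_eq' := by
        intro v i j hij hne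
        obtain ⟨g, hg⟩ := exists_ceSum C f
        simp only [← hg, g.map_eq_zero_of_eq v hij hne, smul_zero] }
  map_add' f g := by
    ext v
    change (-1 : ℤ) ^ (p + 1) • ceSum C (f + g) v =
      (-1 : ℤ) ^ (p + 1) • ceSum C f v + (-1 : ℤ) ^ (p + 1) • ceSum C g v
    rw [ceSum_add, smul_add]
  map_smul' r f := by
    ext v
    change (-1 : ℤ) ^ (p + 1) • ceSum C (r • f) v = r • (-1 : ℤ) ^ (p + 1) • ceSum C f v
    have : r • f = (algebraMap R A r) • f := by ext v; simp
    rw [this, ceSum_smul]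
    simp [smul_comm r]

end Differential

section ExteriorConnection

variable {R A L N : Type*} [CommRing R] [CommRing A] [Algebra R A]
  [AddCommGroup L] [Module R L] [Module A L] [IsScalarTower R A L]
  [AddCommGroup N] [Module R N] [Module A N] [IsScalarTower R A N]
  {P : PreLieRinehart R A L}

/-- The dual numbers `Λ[ε]` over the exterior algebra `Λ` of `N`, regarded as an `A`-algebra through
`a ↦ a + δ(a) ε`. It serves to extend derivations from `N` to `Λ`. -/
def TwistedDual (N : Type*) [AddCommGroup N] [Module A N] (_δ : Derivation R A A) : Type _ :=
  TrivSqZeroExt (ExteriorAlgebra A N) (ExteriorAlgebra A N)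

instance (δ : Derivation R A A) : Ring (TwistedDual N δ) :=
  inferInstanceAs (Ring (TrivSqZeroExt (ExteriorAlgebra A N) (ExteriorAlgebra A N)))

namespace TwistedDual

variable {δ : Derivation R A A}

def fst (u : TwistedDual N δ) : ExteriorAlgebra A N := TrivSqZeroExt.fst u

def snd (u : TwistedDual N δ) : ExteriorAlgebra A N := TrivSqZeroExt.snd u

def mk (u v : ExteriorAlgebra A N) : TwistedDual N δ := (u, v)

theorem ext {u v : TwistedDual N δ} (h1 : u.fst = v.fst) (h2 : u.snd = v.snd) : u = v :=
  TrivSqZeroExt.ext h1 h2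

@[simp] theorem fst_mk (u v : ExteriorAlgebra A N) : (mk u v : TwistedDual N δ).fst = u := rfl
@[simp] theorem snd_mk (u v : ExteriorAlgebra A N) : (mk u v : TwistedDual N δ).snd = v := rfl
@[simp] theorem fst_add (u v : TwistedDual N δ) : (u + v).fst = u.fst + v.fst := rfl
@[simp] theorem snd_add (u v : TwistedDual N δ) : (u + v).snd = u.snd + v.snd := rfl
@[simp] theorem fst_zero : (0 : TwistedDual N δ).fst = 0 := rfl
@[simp] theorem snd_zero : (0 : TwistedDual N δ).snd = 0 := rfl
@[simp] theorem fst_one : (1 : TwistedDual N δ).fst = 1 := rfl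
@[simp] theorem snd_one : (1 : TwistedDual N δ).snd = 0 := rfl
@[simp] theorem fst_mul (u v : TwistedDual N δ) : (u * v).fst = u.fst * v.fst := rfl
@[simp] theorem snd_mul (u v : TwistedDual N δ) :
    (u * v).snd = u.fst * v.snd + u.snd * v.fst := rfl

instance : Algebra A (TwistedDual N δ) :=
  RingHom.toAlgebra'
    { toFun := fun a => mk (algebraMap A _ a) (algebraMap A _ (δ a))
      map_one' := by apply ext <;> simp
      map_mul' := by
        intro a b
        apply ext
        · simp
        · simp only [snd_mk, snd_mul, fst_mk, Derivation.leibniz, smul_eq_mul, map_add, map_mul]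
          rw [Algebra.commutes b]
      map_zero' := by apply ext <;> simp
      map_add' := by intro a b; apply ext <;> simp }
    (by
      intro a x
      apply ext
      · exact Algebra.commutes _ _
      · change algebraMap A (ExteriorAlgebra A N) a * x.snd +
            algebraMap A (ExteriorAlgebra A N) (δ a) * x.fst =
          x.fst * algebraMap A (ExteriorAlgebra A N) (δ a) +
            x.snd * algebraMap A (ExteriorAlgebra A N) a
        rw [Algebra.commutes a, Algebra.commutes (δ a), add_comm])

theorem fst_algebraMap (a : A) : (algebraMap A (TwistedDual N δ) a).fst = algebraMap A _ a := rfl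
theorem snd_algebraMap (a : A) :
    (algebraMap A (TwistedDual N δ) a).snd = algebraMap A _ (δ a) := rfl

end TwistedDual

/-- The lift of a derivation `E` of `N` over `δ` to `Λ_A N`, written `u ↦ u + (E u) ε`. -/
def exteriorLift (δ : Derivation R A A) (E : N →ₗ[R] N)
    (hE : ∀ (a : A) (n : N), E (a • n) = δ a • n + a • E n) :
    ExteriorAlgebra A N →ₐ[A] TwistedDual N δ :=
  ExteriorAlgebra.lift A ⟨
    { toFun := fun n => TwistedDual.mk (ExteriorAlgebra.ι A n) (ExteriorAlgebra.ι A (E n))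
      map_add' := by intro m n; apply TwistedDual.ext <;> simp
      map_smul' := by
        intro a n
        rw [RingHom.id_apply, Algebra.smul_def]
        apply TwistedDual.ext
        · simp [TwistedDual.fst_algebraMap, Algebra.smul_def]
        · simp [TwistedDual.fst_algebraMap, TwistedDual.snd_algebraMap, Algebra.smul_def, hE,
            add_comm] },
    by
      intro n
      apply TwistedDual.ext
      · simp
      · simp⟩

theorem fst_exteriorLift (δ : Derivation R A A) (E : N →ₗ[R] N)
    (hE : ∀ (a : A) (n : N), E (a • n) = δ a • n + a • E n) (u : ExteriorAlgebra A N) :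
    (exteriorLift δ E hE u).fst = u := by
  induction u using ExteriorAlgebra.induction with
  | algebraMap a => rw [AlgHom.commutes, TwistedDual.fst_algebraMap]
  | ι n => simp [exteriorLift]
  | mul u v hu hv => rw [map_mul, TwistedDual.fst_mul, hu, hv]
  | add u v hu hv => rw [map_add, TwistedDual.fst_add, hu, hv]

/-- The derivation of the exterior algebra `Λ_A N` extending `δ` on `A` and `E` on `N`. -/
def exteriorDerivation (δ : Derivation R A A) (E : N →ₗ[R] N)
    (hE : ∀ (a : A) (n : N), E (a • n) = δ a • n + a • E n) (u : ExteriorAlgebra A N) :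
    ExteriorAlgebra A N :=
  (exteriorLift δ E hE u).snd

section

variable (δ : Derivation R A A) (E : N →ₗ[R] N)
  (hE : ∀ (a : A) (n : N), E (a • n) = δ a • n + a • E n)

theorem exteriorDerivation_algebraMap (a : A) :
    exteriorDerivation δ E hE (algebraMap A _ a) = algebraMap A _ (δ a) := by
  rw [exteriorDerivation, AlgHom.commutes, TwistedDual.snd_algebraMap]

theorem exteriorDerivation_ι (n : N) :
    exteriorDerivation δ E hE (ExteriorAlgebra.ι A n) = ExteriorAlgebra.ι A (E n) := by
  simp [exteriorDerivation, exteriorLift]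

theorem exteriorDerivation_add (u v : ExteriorAlgebra A N) :
    exteriorDerivation δ E hE (u + v) =
      exteriorDerivation δ E hE u + exteriorDerivation δ E hE v := by
  simp [exteriorDerivation]

theorem exteriorDerivation_mul (u v : ExteriorAlgebra A N) :
    exteriorDerivation δ E hE (u * v) =
      u * exteriorDerivation δ E hE v + exteriorDerivation δ E hE u * v := by
  simp [exteriorDerivation, fst_exteriorLift]

theorem exteriorDerivation_smul (a : A) (u : ExteriorAlgebra A N) :
    exteriorDerivation δ E hE (a • u) = δ a • u + a • exteriorDerivation δ E hE u := by
  rw [Algebra.smul_def, exteriorDerivation_mul, exteriorDerivation_algebraMap, Algebra.smul_def,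
    Algebra.smul_def, add_comm]

theorem exteriorDerivation_mem {q : ℕ} {u : ExteriorAlgebra A N} (hu : u ∈ ⋀[A]^q N) :
    exteriorDerivation δ E hE u ∈ ⋀[A]^q N := by
  induction hu using Submodule.pow_induction_on_left' with
  | algebraMap a =>
    rw [exteriorDerivation_algebraMap, ExteriorAlgebra.exteriorPower, pow_zero]
    exact Submodule.algebraMap_mem _
  | add u v i hu hv h1 h2 =>
    rw [exteriorDerivation_add]
    exact add_mem h1 h2
  | mem_mul m hm i u hu h =>
    obtain ⟨n, rfl⟩ := hm
    rw [exteriorDerivation_mul, exteriorDerivation_ι, ExteriorAlgebra.exteriorPower,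
      Nat.succ_eq_add_one, pow_succ']
    exact add_mem (Submodule.mul_mem_mul ⟨n, rfl⟩ h) (Submodule.mul_mem_mul ⟨E n, rfl⟩ hu)

end

/-- The connection induced on the exterior power `Λ^q_A N` by a connection on `N`:
`x · (n₁ ∧ ⋯ ∧ n_q) = ∑ⱼ n₁ ∧ ⋯ ∧ (x · nⱼ) ∧ ⋯ ∧ n_q`. -/
def PreLieRinehart.Connection.exteriorPower (C : P.Connection N) (q : ℕ) :
    P.Connection (⋀[A]^q N) where
  act :=
    { toFun := fun x =>
        { toFun := fun u => ⟨exteriorDerivation (P.anchor x) (C.act x) (C.act_smul x) u,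
            exteriorDerivation_mem _ _ _ u.2⟩
          map_add' := fun u v => Subtype.ext (exteriorDerivation_add _ _ _ _ _)
          map_smul' := fun r u => Subtype.ext <| by
            change exteriorDerivation _ _ _ (r • (u : ExteriorAlgebra A N)) =
              r • exteriorDerivation _ _ _ _
            rw [← algebraMap_smul A r, exteriorDerivation_smul]
            simp }
      map_add' := by
        intro x y
        ext u
        change exteriorDerivation _ _ _ (u : ExteriorAlgebra A N) =
          exteriorDerivation _ _ _ _ + exteriorDerivation _ _ _ _
        generalize (u : ExteriorAlgebra A N) = u
        induction u using ExteriorAlgebra.induction with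
        | algebraMap a => simp [exteriorDerivation_algebraMap]
        | ι n => simp [exteriorDerivation_ι]
        | mul u v hu hv => simp only [exteriorDerivation_mul, hu, hv, mul_add, add_mul]; abel
        | add u v hu hv => simp only [exteriorDerivation_add, hu, hv]; abel
      map_smul' := by
        intro a x
        ext u
        change exteriorDerivation _ _ _ (u : ExteriorAlgebra A N) =
          a • exteriorDerivation _ _ _ _
        generalize (u : ExteriorAlgebra A N) = u
        induction u using ExteriorAlgebra.induction with
        | algebraMap b => simp [exteriorDerivation_algebraMap, Algebra.smul_def]
        | ι n => simp [exteriorDerivation_ι]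
        | mul u v hu hv => simp only [exteriorDerivation_mul, hu, hv, smul_add,
            mul_smul_comm, smul_mul_assoc]
        | add u v hu hv => simp only [exteriorDerivation_add, hu, hv, smul_add] }
  act_smul := fun x a u => Subtype.ext (exteriorDerivation_smul _ _ _ _ _)

end ExteriorConnection

section Bigraded

variable (R : Type*) [CommRing R] (V : ℕ × ℕ → Type*) [∀ i, AddCommGroup (V i)]
  [∀ i, Module R (V i)]

/-- The homogeneous elements of bidegree `(p, q)` of an (externally) bigraded module. -/
def homogeneous (p q : ℕ) : Submodule R (⨁ i, V i) :=
  LinearMap.range (DirectSum.lof R (ℕ × ℕ) V (p, q))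

variable {R}

/-- A bigraded commutative (associative, unital) `R`-algebra; commutativity is understood with
respect to the total degree. -/
structure IsBigradedCommAlgebra (mul : (⨁ i, V i) →ₗ[R] (⨁ i, V i) →ₗ[R] ⨁ i, V i)
    (one : ⨁ i, V i) : Prop where
  one_mem : one ∈ homogeneous R V 0 0
  mul_mem : ∀ {p q p' q' : ℕ} {x y : ⨁ i, V i}, x ∈ homogeneous R V p q →
    y ∈ homogeneous R V p' q' → mul x y ∈ homogeneous R V (p + p') (q + q')
  one_mul : ∀ x, mul one x = x
  mul_assoc : ∀ x y z, mul (mul x y) z = mul x (mul y z)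
  mul_comm : ∀ {p q p' q' : ℕ} {x y : ⨁ i, V i}, x ∈ homogeneous R V p q →
    y ∈ homogeneous R V p' q' → mul x y = (-1 : ℤ) ^ ((p + q) * (p' + q')) • mul y x

/-- A bracket of bidegree `(0, -1)`; components of negative degree are zero. -/
structure HasBidegreeZeroNegOne (br : (⨁ i, V i) →ₗ[R] (⨁ i, V i) →ₗ[R] ⨁ i, V i) : Prop where
  mem : ∀ {p q p' q' r : ℕ} {x y : ⨁ i, V i}, x ∈ homogeneous R V p q →
    y ∈ homogeneous R V p' q' → q + q' = r + 1 → br x y ∈ homogeneous R V (p + p') r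
  eq_zero : ∀ {p p' : ℕ} {x y : ⨁ i, V i}, x ∈ homogeneous R V p 0 →
    y ∈ homogeneous R V p' 0 → br x y = 0

/-- Graded skew-symmetry when the second degree is lowered by one. -/
def IsShiftedSkew (br : (⨁ i, V i) →ₗ[R] (⨁ i, V i) →ₗ[R] ⨁ i, V i) : Prop :=
  ∀ {p q p' q' : ℕ} {x y : ⨁ i, V i}, x ∈ homogeneous R V p q → y ∈ homogeneous R V p' q' →
    br x y = -((((p : ℤ) + q - 1) * ((p' : ℤ) + q' - 1)).negOnePow • br y x)

/-- A bigraded Gerstenhaber algebra: a bigraded commutative algebra with a bracket of bidegree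
`(0, -1)` that is a bigraded Lie bracket once the second degree is lowered by one, and such that
bracketing with an element of bidegree `(p, q)` is a derivation of bidegree `(p, q - 1)`. -/
structure IsBigradedGerstenhaber (mul : (⨁ i, V i) →ₗ[R] (⨁ i, V i) →ₗ[R] ⨁ i, V i)
    (one : ⨁ i, V i) (br : (⨁ i, V i) →ₗ[R] (⨁ i, V i) →ₗ[R] ⨁ i, V i) : Prop
    extends IsBigradedCommAlgebra V mul one where
  bidegree : HasBidegreeZeroNegOne V br
  skew : IsShiftedSkew V br
  jacobi : ∀ {p q p' q' : ℕ} {x y : ⨁ i, V i} (z : ⨁ i, V i), x ∈ homogeneous R V p q →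
    y ∈ homogeneous R V p' q' → br x (br y z) = br (br x y) z +
      (((p : ℤ) + q - 1) * ((p' : ℤ) + q' - 1)).negOnePow • br y (br x z)
  bracket_mul : ∀ {p q p' q' : ℕ} {x y : ⨁ i, V i} (z : ⨁ i, V i), x ∈ homogeneous R V p q →
    y ∈ homogeneous R V p' q' → br x (mul y z) = mul (br x y) z +
      (((p : ℤ) + q - 1) * ((p' : ℤ) + q')).negOnePow • mul y (br x z)

/-- A differential bigraded Gerstenhaber algebra: the differential has bidegree `(1, 0)` and is a
derivation of both the product and the bracket. -/
structure IsDifferentialBigradedGerstenhaber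
    (mul : (⨁ i, V i) →ₗ[R] (⨁ i, V i) →ₗ[R] ⨁ i, V i) (one : ⨁ i, V i)
    (br : (⨁ i, V i) →ₗ[R] (⨁ i, V i) →ₗ[R] ⨁ i, V i) (d : (⨁ i, V i) →ₗ[R] ⨁ i, V i) : Prop
    extends IsBigradedGerstenhaber V mul one br where
  d_mem : ∀ {p q : ℕ} {x : ⨁ i, V i}, x ∈ homogeneous R V p q → d x ∈ homogeneous R V (p + 1) q
  d_d : ∀ x, d (d x) = 0
  d_mul : ∀ {p q : ℕ} {x : ⨁ i, V i} (y : ⨁ i, V i), x ∈ homogeneous R V p q →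
    d (mul x y) = mul (d x) y + (-1 : ℤ) ^ (p + q) • mul x (d y)
  d_bracket : ∀ {p q : ℕ} {x : ⨁ i, V i} (y : ⨁ i, V i), x ∈ homogeneous R V p q →
    d (br x y) = br (d x) y - (-1 : ℤ) ^ (p + q) • br x (d y)

end Bigraded

section Polyvectors

variable (R A L' L'' : Type*) [CommRing R] [CommRing A] [Algebra R A]
  [AddCommGroup L'] [Module R L'] [Module A L'] [IsScalarTower R A L']
  [AddCommGroup L''] [Module R L''] [Module A L''] [IsScalarTower R A L'']

/-- The component `Alt^p_A(L'', Λ^q_A L')` of bidegree `(p, q)`. -/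
abbrev PolyForm (i : ℕ × ℕ) : Type _ := L'' [⋀^Fin i.1]→ₗ[A] ⋀[A]^i.2 L'

/-- The bigraded module `Alt_A(L'', Λ_A L')`. -/
abbrev PolyForms : Type _ := ⨁ i : ℕ × ℕ, PolyForm A L' L'' i

/-- The wedge product `Λ^q L' ⊗ Λ^r L' → Λ^(q+r) L'`. -/
def wedge (q r : ℕ) : (⋀[A]^q L') ⊗[A] (⋀[A]^r L') →ₗ[A] ⋀[A]^(q + r) L' :=
  TensorProduct.lift (LinearMap.mk₂ A
    (fun u v => ⟨(u : ExteriorAlgebra A L') * v, SetLike.mul_mem_graded u.2 v.2⟩)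
    (fun _ _ _ => Subtype.ext (add_mul _ _ _))
    (fun _ _ _ => Subtype.ext (smul_mul_assoc _ _ _))
    (fun _ _ _ => Subtype.ext (mul_add _ _ _))
    (fun _ _ _ => Subtype.ext (mul_smul_comm _ _ _)))

/-- The unsigned shuffle product of forms, the coefficients being multiplied by the wedge product:
`(f ∪ g)(ξ₁, …, ξ_{p+p'}) = ∑_σ sign(σ) f(ξ_σ(1), …, ξ_σ(p)) ∧ g(ξ_σ(p+1), …, ξ_σ(p+p'))`, the sum
being over the `(p, p')`-shuffles. -/
def shuffle (i j : ℕ × ℕ) :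
    PolyForm A L' L'' i ⊗[A] PolyForm A L' L'' j →ₗ[A] PolyForm A L' L'' (i + j) :=
  (AlternatingMap.domDomCongrₗ A finSumFinEquiv).toLinearMap ∘ₗ
    (wedge A L' i.2 j.2).compAlternatingMapₗ A ∘ₗ AlternatingMap.domCoprod'


variable {A L' L''}

instance (i : ℕ × ℕ) : IsScalarTower R A (PolyForm A L' L'' i) :=
  ⟨fun r a f => by ext v; simp⟩

/-- The product of two homogeneous forms. The sign is the Eilenberg-Koszul sign of interchanging
the first factor, of total degree `p + q`, with the `p'` arguments of the second one. -/
def homogeneousMul (i j : ℕ × ℕ) :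
    PolyForm A L' L'' i →ₗ[R] PolyForm A L' L'' j →ₗ[R] PolyForms A L' L'' :=
  LinearMap.mk₂ R
    (fun f g => (-1 : ℤ) ^ ((i.1 + i.2) * j.1) •
      DirectSum.lof R (ℕ × ℕ) (PolyForm A L' L'') (i + j) (shuffle A L' L'' i j (f ⊗ₜ g)))
    (fun f f' g => by rw [TensorProduct.add_tmul, map_add, map_add, smul_add])
    (fun r f g => by
      rw [← algebraMap_smul A r f, ← TensorProduct.smul_tmul', map_smul, algebraMap_smul,
        map_smul, smul_comm])
    (fun f g g' => by rw [TensorProduct.tmul_add, map_add, map_add, smul_add])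
    (fun r f g => by
      rw [← algebraMap_smul A r g, TensorProduct.tmul_smul, map_smul, algebraMap_smul,
        map_smul, smul_comm])

variable (A L' L'')

/-- The product of the bigraded algebra `Alt_A(L'', Λ_A L')`. -/
def polyMul : PolyForms A L' L'' →ₗ[R] PolyForms A L' L'' →ₗ[R] PolyForms A L' L'' :=
  DirectSum.toModule R (ℕ × ℕ) _ fun i =>
    (DirectSum.toModule R (ℕ × ℕ) _ fun j => (homogeneousMul R i j).flip).flip

variable {L'} in
/-- An element of `L'`, in bidegree `(0, 1)`. -/
def polyVector (x : L') : PolyForms A L' L'' :=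
  DirectSum.lof R (ℕ × ℕ) (PolyForm A L' L'') (0, 1)
    (AlternatingMap.constOfIsEmpty A L'' (Fin 0) ((exteriorPower.oneEquiv A L').symm x))

variable {A L''} in
/-- An element of `Alt^p_A(L'', A)`, in bidegree `(p, 0)`. -/
def polyScalarForm {p : ℕ} (α : L'' [⋀^Fin p]→ₗ[A] A) : PolyForms A L' L'' :=
  DirectSum.lof R (ℕ × ℕ) (PolyForm A L' L'') (p, 0)
    ((exteriorPower.zeroEquiv A L').symm.toLinearMap.compAlternatingMap α)

/-- The unit of `Alt_A(L'', Λ_A L')`. -/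
def polyOne : PolyForms A L' L'' :=
  polyScalarForm R L' (AlternatingMap.constOfIsEmpty A L'' (Fin 0) (1 : A))

end Polyvectors

section Twilled

variable (R A L' L'' : Type*) [CommRing R] [CommRing A] [Algebra R A]
  [AddCommGroup L'] [Module R L'] [Module A L'] [IsScalarTower R A L']
  [AddCommGroup L''] [Module R L''] [Module A L''] [IsScalarTower R A L'']

/-- An almost twilled pre-Lie-Rinehart algebra `(A, L', L'')`. The connections `conn'` and `conn''`
are the pairings `x ⊗ ξ ↦ x · ξ` and `ξ ⊗ x ↦ ξ · x`. -/
structure AlmostTwilledPre where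
  pre' : PreLieRinehart R A L'
  pre'' : PreLieRinehart R A L''
  conn' : pre'.Connection L''
  conn'' : pre''.Connection L'

variable {R A L' L''}

namespace AlmostTwilledPre

variable (S : AlmostTwilledPre R A L' L'')

/-- `(A, L', L'')` is an almost twilled Lie-Rinehart algebra: `(A, L')` and `(A, L'')` are
Lie-Rinehart algebras, `L''` is an `(A, L')`-module, and `L'` is an `(A, L'')`-module. -/
structure IsAlmostTwilled : Prop where
  isLieRinehart' : S.pre'.IsLieRinehart
  isLieRinehart'' : S.pre''.IsLieRinehart
  isFlat' : S.conn'.IsFlat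
  isFlat'' : S.conn''.IsFlat

/-- The sum `L' ⊕ L''` with the bracket
`[(x, ξ), (y, η)] = ([x, y]' + ξ · y - η · x, [ξ, η]'' + x · η - y · ξ)` and the sum of the two
pairings with `A`. -/
def sum : PreLieRinehart R A (L' × L'') where
  bracket := LinearMap.mk₂ R
    (fun u v => (S.pre'.bracket u.1 v.1 + S.conn''.act u.2 v.1 - S.conn''.act v.2 u.1,
      S.pre''.bracket u.2 v.2 + S.conn'.act u.1 v.2 - S.conn'.act v.1 u.2))
    (fun u u' v => by
      ext <;> simp only [Prod.fst_add, Prod.snd_add, map_add, LinearMap.add_apply] <;> abel)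
    (fun r u v => by
      have h' : ∀ (x : L') (ξ : L''), S.conn'.act (r • x) ξ = r • S.conn'.act x ξ := by
        intro x ξ
        rw [← algebraMap_smul A r x, map_smul, LinearMap.smul_apply, algebraMap_smul]
      have h'' : ∀ (x : L') (ξ : L''), S.conn''.act (r • ξ) x = r • S.conn''.act ξ x := by
        intro x ξ
        rw [← algebraMap_smul A r ξ, map_smul, LinearMap.smul_apply, algebraMap_smul]
      ext <;> simp only [Prod.smul_fst, Prod.smul_snd, map_smul, LinearMap.smul_apply, h', h'',
        smul_add, smul_sub])
    (fun u v v' => by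
      ext <;> simp only [Prod.fst_add, Prod.snd_add, map_add, LinearMap.add_apply] <;> abel)
    (fun r u v => by
      have h' : ∀ (x : L') (ξ : L''), S.conn'.act (r • x) ξ = r • S.conn'.act x ξ := by
        intro x ξ
        rw [← algebraMap_smul A r x, map_smul, LinearMap.smul_apply, algebraMap_smul]
      have h'' : ∀ (x : L') (ξ : L''), S.conn''.act (r • ξ) x = r • S.conn''.act ξ x := by
        intro x ξ
        rw [← algebraMap_smul A r ξ, map_smul, LinearMap.smul_apply, algebraMap_smul]
      ext <;> simp only [Prod.smul_fst, Prod.smul_snd, map_smul, h', h'', smul_add, smul_sub])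
  bracket_self u := by
    ext <;> simp [S.pre'.bracket_self, S.pre''.bracket_self]
  anchor := S.pre'.anchor.coprod S.pre''.anchor
  bracket_smul u a v := by
    ext <;> simp only [LinearMap.mk₂_apply, Prod.smul_fst, Prod.smul_snd, Prod.fst_add,
      Prod.snd_add, S.pre'.bracket_smul, S.pre''.bracket_smul, S.conn'.act_smul,
      S.conn''.act_smul, map_smul, LinearMap.smul_apply, LinearMap.coprod_apply,
      Derivation.add_apply, add_smul, smul_add, smul_sub] <;> abel

/-- `(A, L', L'')` is a twilled Lie-Rinehart algebra. -/
structure IsTwilled : Prop extends S.IsAlmostTwilled where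
  isLieRinehart_sum : S.sum.IsLieRinehart

/-- The action of `x ∈ L'` on `Alt^p_A(L'', A)` that is induced by the pairing `L' ⊗ L'' → L''`:
`(x · α)(ξ₁, …, ξₚ) = x (α (ξ₁, …, ξₚ)) - ∑ₖ α (ξ₁, …, x · ξₖ, …, ξₚ)`. -/
def formAct (x : L') {p : ℕ} (α : L'' [⋀^Fin p]→ₗ[A] A) : L'' [⋀^Fin p]→ₗ[A] A :=
  formDerivation (S.pre'.anchor x) (S.conn'.act x) (S.pre'.anchor x : A →ₗ[R] A)
    (S.conn'.act_smul x) (fun a b => by simp [mul_comm, add_comm]) α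

/-- The operator `d''` on `Alt_A(L'', Λ_A L')`: the Lie-Rinehart operator for `L''` with values in
the exterior powers of `L'`. -/
def dBar : PolyForms A L' L'' →ₗ[R] PolyForms A L' L'' :=
  DirectSum.toModule R (ℕ × ℕ) _ fun i =>
    DirectSum.lof R (ℕ × ℕ) (PolyForm A L' L'') (i.1 + 1, i.2) ∘ₗ
      lieRinehartDifferential (S.conn''.exteriorPower i.2) i.1

/-- The crossed product bracket extension on `Alt_A(L'', Λ_A L')`: the bracket of bidegree
`(0, -1)` that is given by the bracket of `L'` and by the action of `L'` on `Alt_A(L'', A)`, and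
that is extended by skew-symmetry and the derivation rule. -/
structure IsCrossedProductBracket
    (br : PolyForms A L' L'' →ₗ[R] PolyForms A L' L'' →ₗ[R] PolyForms A L' L'') : Prop where
  bidegree : HasBidegreeZeroNegOne (PolyForm A L' L'') br
  bracket_vector : ∀ x y : L', br (polyVector R A L'' x) (polyVector R A L'' y) =
    polyVector R A L'' (S.pre'.bracket x y)
  bracket_scalarForm : ∀ (x : L') {p : ℕ} (α : L'' [⋀^Fin p]→ₗ[A] A),
    br (polyVector R A L'' x) (polyScalarForm R L' α) = polyScalarForm R L' (S.formAct x α)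
  mul_bracket : ∀ {p q p' q' : ℕ} {α β : PolyForms A L' L''} (γ : PolyForms A L' L''),
    α ∈ homogeneous R (PolyForm A L' L'') p q → β ∈ homogeneous R (PolyForm A L' L'') p' q' →
    br (polyMul R A L' L'' α β) γ = polyMul R A L' L'' α (br β γ) +
      (-1 : ℤ) ^ ((p + q) * (p' + q')) • polyMul R A L' L'' β (br α γ)
  skew : IsShiftedSkew (PolyForm A L' L'') br

/-- `Alt_A(L'', Λ_A L')` with the bracket `br` is a bigraded Gerstenhaber algebra. -/
def IsGerstenhaber (_ : AlmostTwilledPre R A L' L'')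
    (br : PolyForms A L' L'' →ₗ[R] PolyForms A L' L'' →ₗ[R] PolyForms A L' L'') : Prop :=
  IsBigradedGerstenhaber (PolyForm A L' L'') (polyMul R A L' L'') (polyOne R A L' L'') br

/-- `Alt_A(L'', Λ_A L')` with the bracket `br` and the operator `d''` is a differential bigraded
Gerstenhaber algebra. -/
def IsDifferentialGerstenhaber
    (br : PolyForms A L' L'' →ₗ[R] PolyForms A L' L'' →ₗ[R] PolyForms A L' L'') : Prop :=
  IsDifferentialBigradedGerstenhaber (PolyForm A L' L'') (polyMul R A L' L'')
    (polyOne R A L' L'') br S.dBar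

end AlmostTwilledPre

end Twilled

section Decomposition

variable {R A L : Type*} [CommRing R] [CommRing A] [Algebra R A] [LieRing L] [LieAlgebra R L]
  [Module A L] [LieRingModule L A] [LieRinehartRing A L] [LieRinehartAlgebra R A L]

/-- The restriction to a submodule of the pairing of a Lie-Rinehart algebra with `A`. -/
def restrictedAnchor (K : Submodule A L) : K →ₗ[A] Derivation R A A where
  toFun x := LieRinehartAlgebra.anchor R A L x
  map_add' x y := by ext a; simp
  map_smul' a x := by ext b; simp

/-- The component in `K` of the bracket on `K`, for a direct sum decomposition `L = K ⊕ K'`. -/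
def projectedPre (K K' : Submodule A L) (h : IsCompl K K') : PreLieRinehart R A K where
  bracket := LinearMap.mk₂ R (fun x y => K.projectionOnto K' h ⁅(x : L), (y : L)⁆)
    (fun x y z => by simp)
    (fun r x y => by
      rw [← algebraMap_smul A r (K.projectionOnto K' h _), ← map_smul, algebraMap_smul]; simp)
    (fun x y z => by simp)
    (fun r x y => by
      rw [← algebraMap_smul A r (K.projectionOnto K' h _), ← map_smul, algebraMap_smul]; simp)
  bracket_self x := by simp
  anchor := restrictedAnchor K
  bracket_smul x a y := by
    simp [restrictedAnchor, add_comm]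

/-- The pairing `K ⊗ K' → K'` given by the component in `K'` of the bracket, for a direct sum
decomposition `L = K ⊕ K'`. -/
def projectedConnection (K K' : Submodule A L) (h : IsCompl K K') :
    (projectedPre (R := R) K K' h).Connection K' where
  act :=
    { toFun := fun x =>
        { toFun := fun y => K'.projectionOnto K h.symm ⁅(x : L), (y : L)⁆
          map_add' := fun y z => by simp
          map_smul' := fun r y => by
            rw [RingHom.id_apply, ← algebraMap_smul A r (K'.projectionOnto K h.symm _),
              ← map_smul, algebraMap_smul]; simp }
      map_add' := fun x y => by ext z; simp
      map_smul' := fun a x => by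
        ext y
        have : ⁅a • (x : L), (y : L)⁆ = a • ⁅(x : L), (y : L)⁆ - ⁅(y : L), a⁆ • (x : L) := by
          rw [← lie_skew, LieRinehartRing.leibniz_smul_right, ← lie_skew (x : L)]
          simp only [smul_neg]; abel
        simp [this] }
  act_smul x a y := by
    simp [projectedPre, restrictedAnchor, add_comm]

/-- The almost twilled pre-Lie-Rinehart algebra of a direct sum decomposition `L = L' ⊕ L''` of a
Lie-Rinehart algebra: brackets and pairings are the components of the bracket of `L`. -/
def AlmostTwilledPre.ofDecomposition (L' L'' : Submodule A L) (h : IsCompl L' L'') :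
    AlmostTwilledPre R A L' L'' where
  pre' := projectedPre L' L'' h
  pre'' := projectedPre L'' L' h.symm
  conn' := projectedConnection L' L'' h
  conn'' := projectedConnection L'' L' h.symm

end Decomposition

section AlmostComplex

variable (E M : Type*) [NormedAddCommGroup E] [NormedSpace ℝ E]
  [TopologicalSpace M] [ChartedSpace E M]

/-- The algebra of smooth real functions on `M`. -/
abbrev RealFunctions : Type _ := C^∞⟮𝓘(ℝ, E), M; 𝓘(ℝ, ℝ), ℝ⟯

/-- The algebra of smooth complex functions on `M`. -/
abbrev ComplexFunctions : Type _ := C^∞⟮𝓘(ℝ, E), M; 𝓘(ℝ, ℂ), ℂ⟯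

instance : ContMDiffRing 𝓘(ℝ, ℂ) ∞ ℂ where
  contMDiff_mul := by
    rw [contMDiff_iff]
    refine ⟨continuous_mul, fun x y => ?_⟩
    simp only [mfld_simps, chartAt_self_eq]
    rw [contDiffOn_univ]
    exact contDiff_mul

/-- The complex algebra structure is the one given by the constant functions. -/
instance : Algebra ℂ (ComplexFunctions E M) :=
  RingHom.toAlgebra
    { toFun := fun c => ⟨fun _ => c, contMDiff_const⟩
      map_one' := rfl
      map_mul' := fun _ _ => rfl
      map_zero' := rfl
      map_add' := fun _ _ => rfl }

/-- The module of smooth (real) vector fields on `M`, as derivations of the smooth functions. -/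
abbrev VectorFields : Type _ := Derivation ℝ (RealFunctions E M) (RealFunctions E M)

/-- The Lie-Rinehart algebra of smooth complexified vector fields on `M`, as derivations of the
smooth complex functions. -/
abbrev ComplexVectorFields : Type _ := Derivation ℂ (ComplexFunctions E M) (ComplexFunctions E M)

variable {E M}

theorem ComplexFunctions.smul_apply (c : ℂ) (f : ComplexFunctions E M) (m : M) :
    (c • f) m = c * f m := by
  rw [Algebra.smul_def]; rfl

/-- A smooth real function, as a smooth complex function. -/
def ofRealFunction (f : RealFunctions E M) : ComplexFunctions E M :=
  ⟨fun m => (f m : ℂ), Complex.ofRealCLM.contDiff.contMDiff.comp f.contMDiff⟩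

/-- The real part of a smooth complex function. -/
def reFunction (f : ComplexFunctions E M) : RealFunctions E M :=
  ⟨fun m => (f m).re, Complex.reCLM.contDiff.contMDiff.comp f.contMDiff⟩

/-- The imaginary part of a smooth complex function. -/
def imFunction (f : ComplexFunctions E M) : RealFunctions E M :=
  ⟨fun m => (f m).im, Complex.imCLM.contDiff.contMDiff.comp f.contMDiff⟩

@[simp] theorem ofRealFunction_apply (f : RealFunctions E M) (m : M) :
    ofRealFunction f m = (f m : ℂ) := rfl

@[simp] theorem reFunction_apply (f : ComplexFunctions E M) (m : M) :
    reFunction f m = (f m).re := rfl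

@[simp] theorem imFunction_apply (f : ComplexFunctions E M) (m : M) :
    imFunction f m = (f m).im := rfl

theorem ofRealFunction_add (f g : RealFunctions E M) :
    ofRealFunction (f + g) = ofRealFunction f + ofRealFunction g := by
  ext m; simp

theorem ofRealFunction_mul (f g : RealFunctions E M) :
    ofRealFunction (f * g) = ofRealFunction f * ofRealFunction g := by
  ext m; simp

theorem ofRealFunction_smul (r : ℝ) (f : RealFunctions E M) :
    ofRealFunction (r • f) = (r : ℂ) • ofRealFunction f := by
  ext m; simp [ComplexFunctions.smul_apply]

theorem eq_ofRealFunction_add (f : ComplexFunctions E M) :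
    f = ofRealFunction (reFunction f) + Complex.I • ofRealFunction (imFunction f) := by
  ext m
  simp [ComplexFunctions.smul_apply, mul_comm Complex.I, Complex.re_add_im]

/-- The real part of a complexified vector field. -/
def reField (D : ComplexVectorFields E M) : VectorFields E M :=
  Derivation.mk'
    { toFun := fun f => reFunction (D (ofRealFunction f))
      map_add' := fun f g => by ext m; simp [ofRealFunction_add]
      map_smul' := fun r f => by
        ext m; simp [ofRealFunction_smul, ComplexFunctions.smul_apply] }
    (fun f g => by ext m; simp [ofRealFunction_mul])

/-- The imaginary part of a complexified vector field. -/
def imField (D : ComplexVectorFields E M) : VectorFields E M :=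
  Derivation.mk'
    { toFun := fun f => imFunction (D (ofRealFunction f))
      map_add' := fun f g => by ext m; simp [ofRealFunction_add]
      map_smul' := fun r f => by
        ext m; simp [ofRealFunction_smul, ComplexFunctions.smul_apply] }
    (fun f g => by ext m; simp [ofRealFunction_mul])

theorem reField_apply (D : ComplexVectorFields E M) (f : RealFunctions E M) (m : M) :
    reField D f m = (D (ofRealFunction f) m).re := rfl

theorem imField_apply (D : ComplexVectorFields E M) (f : RealFunctions E M) (m : M) :
    imField D f m = (D (ofRealFunction f) m).im := rfl

theorem reFunction_mul (f g : ComplexFunctions E M) :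
    reFunction (f * g) = reFunction f * reFunction g - imFunction f * imFunction g := by
  ext m; simp

theorem imFunction_mul (f g : ComplexFunctions E M) :
    imFunction (f * g) = reFunction f * imFunction g + imFunction f * reFunction g := by
  ext m; simp

/-- The complexified vector field `X + i Y`. -/
def complexField (X Y : VectorFields E M) : ComplexVectorFields E M :=
  Derivation.mk'
    { toFun := fun f => ofRealFunction (X (reFunction f) - Y (imFunction f)) +
        Complex.I • ofRealFunction (X (imFunction f) + Y (reFunction f))
      map_add' := fun f g => by
        have h1 : reFunction (f + g) = reFunction f + reFunction g := by ext m; simp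
        have h2 : imFunction (f + g) = imFunction f + imFunction g := by ext m; simp
        ext m
        simp [h1, h2, ComplexFunctions.smul_apply]
        ring
      map_smul' := fun c f => by
        have h1 : reFunction (c • f) = c.re • reFunction f - c.im • imFunction f := by
          ext m; simp [ComplexFunctions.smul_apply]
        have h2 : imFunction (c • f) = c.re • imFunction f + c.im • reFunction f := by
          ext m; simp [ComplexFunctions.smul_apply]
        ext m
        simp only [h1, h2, map_add, map_sub, Derivation.map_smul]
        apply Complex.ext <;> simp [ComplexFunctions.smul_apply] <;> ring }
    (fun f g => by
      ext m
      apply Complex.ext <;>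
        simp [reFunction_mul, imFunction_mul, ComplexFunctions.smul_apply] <;> ring)

theorem complexField_apply (X Y : VectorFields E M) (f : ComplexFunctions E M) :
    complexField X Y f = ofRealFunction (X (reFunction f) - Y (imFunction f)) +
        Complex.I • ofRealFunction (X (imFunction f) + Y (reFunction f)) := rfl

theorem reFunction_ofRealFunction (f : RealFunctions E M) :
    reFunction (ofRealFunction f) = f := by ext m; simp

theorem imFunction_ofRealFunction (f : RealFunctions E M) :
    imFunction (ofRealFunction f) = 0 := by ext m; simp

@[simp] theorem reField_complexField (X Y : VectorFields E M) :
    reField (complexField X Y) = X := by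
  ext f m
  simp [reField_apply, complexField_apply, reFunction_ofRealFunction, imFunction_ofRealFunction,
    ComplexFunctions.smul_apply]

@[simp] theorem imField_complexField (X Y : VectorFields E M) :
    imField (complexField X Y) = Y := by
  ext f m
  simp [imField_apply, complexField_apply, reFunction_ofRealFunction, imFunction_ofRealFunction,
    ComplexFunctions.smul_apply]

@[simp] theorem complexField_reField_imField (D : ComplexVectorFields E M) :
    complexField (reField D) (imField D) = D := by
  ext f m
  conv_rhs => rw [eq_ofRealFunction_add f, map_add, Derivation.map_smul]
  apply Complex.ext <;>
    simp [reField_apply, imField_apply, complexField_apply, ComplexFunctions.smul_apply] <;> ring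

theorem reField_add (D D' : ComplexVectorFields E M) :
    reField (D + D') = reField D + reField D' := by ext f m; simp [reField_apply]

theorem imField_add (D D' : ComplexVectorFields E M) :
    imField (D + D') = imField D + imField D' := by ext f m; simp [imField_apply]

theorem reField_smul (g : ComplexFunctions E M) (D : ComplexVectorFields E M) :
    reField (g • D) = reFunction g • reField D - imFunction g • imField D := by
  ext f m; simp [reField_apply, imField_apply]

theorem imField_smul (g : ComplexFunctions E M) (D : ComplexVectorFields E M) :
    imField (g • D) = reFunction g • imField D + imFunction g • reField D := by
  ext f m; simp [reField_apply, imField_apply]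

theorem complexVectorFields_ext {D D' : ComplexVectorFields E M} (h : reField D = reField D')
    (h' : imField D = imField D') : D = D' := by
  rw [← complexField_reField_imField D, h, h', complexField_reField_imField]

variable (E M) in
/-- An almost complex structure on `M`: a smooth endomorphism of the tangent bundle, i.e. an
endomorphism of the module of vector fields over the smooth functions, of square `-1`. -/
structure AlmostComplexStructure where
  J : VectorFields E M →ₗ[RealFunctions E M] VectorFields E M
  J_J : ∀ X, J (J X) = -X

theorem isCompl_eigenspaces {A L : Type*} [CommRing A] [AddCommGroup L] [Module A L]
    (h2 : IsUnit (2 : A)) (T : Module.End A L) (hT : ∀ x, T (T x) = -x) (i : A)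
    (hi : i * i = -1) : IsCompl (T.eigenspace i) (T.eigenspace (-i)) := by
  obtain ⟨u, hu⟩ := h2
  have hu' : (↑u⁻¹ : A) * 2 = 1 := by rw [← hu, Units.inv_mul]
  constructor
  · rw [Submodule.disjoint_def]
    intro x hx hx'
    rw [Module.End.mem_eigenspace_iff] at hx hx'
    have h : (2 * i) • x = 0 := by
      rw [two_mul, add_smul]; nth_rewrite 1 [← hx]; rw [hx', neg_smul, neg_add_cancel]
    have : (-(↑u⁻¹ : A) * i) • (2 * i) • x = 0 := by rw [h, smul_zero]
    rw [smul_smul, show -(↑u⁻¹ : A) * i * (2 * i) = -((↑u⁻¹ : A) * 2) * (i * i) by ring, hu', hi]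
      at this
    simpa using this
  · rw [codisjoint_iff, eq_top_iff]
    intro x _
    have hx : x = (↑u⁻¹ : A) • (x - i • T x) + (↑u⁻¹ : A) • (x + i • T x) := by
      rw [← smul_add, sub_add_add_cancel, ← two_smul A x, smul_smul, hu', one_smul]
    rw [hx]
    refine Submodule.add_mem_sup (Submodule.smul_mem _ _ ?_) (Submodule.smul_mem _ _ ?_)
    · rw [Module.End.mem_eigenspace_iff, map_sub, map_smul, hT, smul_sub, smul_smul, hi]
      simp [add_comm]
    · rw [Module.End.mem_eigenspace_iff, map_add, map_smul, hT, smul_add, smul_smul, neg_mul, hi]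
      simp [add_comm]

namespace AlmostComplexStructure

variable (S : AlmostComplexStructure E M)

/-- The complex linear extension of the almost complex structure. -/
def complexJ : ComplexVectorFields E M →ₗ[ComplexFunctions E M] ComplexVectorFields E M where
  toFun D := complexField (S.J (reField D)) (S.J (imField D))
  map_add' D D' := by
    apply complexVectorFields_ext <;> simp [reField_add, imField_add]
  map_smul' g D := by
    apply complexVectorFields_ext <;> simp [reField_smul, imField_smul]

theorem complexJ_complexJ (D : ComplexVectorFields E M) :
    S.complexJ (S.complexJ D) = -D := by
  have h1 : reField (-D) = -reField D := by ext f m; simp [reField_apply]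
  have h2 : imField (-D) = -imField D := by ext f m; simp [imField_apply]
  apply complexVectorFields_ext <;> simp [complexJ, S.J_J, h1, h2]

/-- The almost holomorphic vector fields: the eigenspace for the eigenvalue `i`. -/
def holomorphic : Submodule (ComplexFunctions E M) (ComplexVectorFields E M) :=
  Module.End.eigenspace S.complexJ (algebraMap ℂ (ComplexFunctions E M) Complex.I)

/-- The almost antiholomorphic vector fields: the eigenspace for the eigenvalue `-i`. -/
def antiholomorphic : Submodule (ComplexFunctions E M) (ComplexVectorFields E M) :=
  Module.End.eigenspace S.complexJ (-algebraMap ℂ (ComplexFunctions E M) Complex.I)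

theorem isCompl : IsCompl S.holomorphic S.antiholomorphic := by
  apply isCompl_eigenspaces
  · have := (IsUnit.mk0 (2 : ℂ) two_ne_zero).map (algebraMap ℂ (ComplexFunctions E M))
    rwa [map_ofNat] at this
  · exact S.complexJ_complexJ
  · rw [← map_mul, Complex.I_mul_I, map_neg, map_one]

/-- The almost twilled pre-Lie-Rinehart algebra that is determined by an almost complex
structure. -/
def almostTwilledPre :
    AlmostTwilledPre ℂ (ComplexFunctions E M) S.holomorphic S.antiholomorphic :=
  AlmostTwilledPre.ofDecomposition S.holomorphic S.antiholomorphic S.isCompl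

/-- The integrability condition: the vanishing of the Nijenhuis tensor. -/
def IsIntegrable : Prop :=
  ∀ X Y : VectorFields E M, ⁅S.J X, S.J Y⁆ - S.J ⁅S.J X, Y⁆ - S.J ⁅X, S.J Y⁆ - ⁅X, Y⁆ = 0

end AlmostComplexStructure

end AlmostComplex

end

/-! Part (a). A form is determined by its value on no arguments and by its contractions `i_ξ`. The
forms are therefore embedded, by `toList`, into functions on finite lists in `L''` with values in
the exterior algebra of `L'`. On such functions the product, the Lie derivatives and the operator
`d` are defined by recursion on the list so that Cartan's relations hold by definition: `i_ξ` is an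
odd derivation of the product, `[L_ξ, i_η] = i_[ξ, η]` and `i_ξ d + d i_ξ = L_ξ`. Associativity,
graded commutativity, `d² = 0` and the derivation rules follow by induction on the list. The sum
over shuffles is used only to prove that the given product satisfies the same recursion
(`domCoprod_listArgs`, `homToList_shuffle`); `homToList_lieRinehartDifferential` does the same for
`d''`.

Let `(eᵢ, θᵢ)` be a finite dual basis of `L'`. Then the algebra is generated by the scalar forms and
by `L'`, so that a bracket satisfying the derivation rule and skew-symmetry is determined by its
values on these. It exists because the formula `∑ ± (i_θᵢ x) (L_eᵢ y) - (∇_eᵢ x) (i_θᵢ y)` is a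
derivation in each argument and has the right values on generators; here `∇` is the connection on
`L'` that the dual basis provides. An expression that is a derivation in each argument vanishes if
it vanishes on generators. This is applied to skew-symmetry, to the Jacobiator and to the failure of
`d''` to be a derivation of the bracket (`compatibilityDefect`). On generators the Jacobiator
vanishes by the Jacobi identity of `L'` and the flatness of the action on `L''`. On generators the
compatibility defect consists of three compatibility conditions between the two actions, and for an
almost twilled algebra these say precisely that `L' ⊕ L''` is a Lie-Rinehart algebra. One of them is
an identity in `L''` which is visible only after applying linear forms, whence property P.

Part (b). The eigenspaces consist of the fields `X ∓ i J X`, and the Nijenhuis tensor vanishes if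
and only if the fields `X + i J X` are closed under the bracket; the fields `X - i J X` are then
closed as well. In that case the algebra is twilled and (a) applies. Conversely, `d'' d'' a = 0` for
all functions `a` says that the `L''`-component of `[ξ, η]` acts on functions like `[ξ, η]` itself;
since vector fields are derivations, the two coincide.

To apply (a), `L'` has to be finitely generated and projective. It is a direct summand of the
complexified vector fields, so a finite dual basis of the real vector fields is enough. If functions
`Fᵢ` have a jointly injective differential on a closed set, then there are fields `Dᵢ` with `X f = ∑
X(Fᵢ) Dᵢ f` on that set. On a compact set finitely many `Fᵢ` exist, and projecting along generic
directions reduces their number to twice the dimension, whatever the compact set. The shells of a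
compact exhaustion that have indices of equal parity are disjoint, so two families of this size, for
even and odd shells, suffice on the whole manifold. -/

noncomputable section

/-! ### Functions on lists: product, Lie derivative and Chevalley-Eilenberg operator by recursion -/

/-- Functions on lists of elements of `M` with values in a ring `Λ` with an endomorphism `σ`. With
the product below, alternating forms on `M` form a subring of the functions on lists. -/
@[ext] structure ListForm (M : Type*) {Λ : Type*} [Ring Λ] (σ : Λ →+* Λ) where
  eval : List M → Λ

namespace ListForm

section Ring

variable {M Λ : Type*} [Ring Λ] {σ : Λ →+* Λ}

instance : Zero (ListForm M σ) := ⟨⟨fun _ => 0⟩⟩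
instance : Add (ListForm M σ) := ⟨fun F G => ⟨fun l => F.eval l + G.eval l⟩⟩
instance : Neg (ListForm M σ) := ⟨fun F => ⟨fun l => -F.eval l⟩⟩
instance : Sub (ListForm M σ) := ⟨fun F G => ⟨fun l => F.eval l - G.eval l⟩⟩
instance {R : Type*} [SMul R Λ] : SMul R (ListForm M σ) := ⟨fun r F => ⟨fun l => r • F.eval l⟩⟩

theorem eval_injective : Function.Injective (eval : ListForm M σ → List M → Λ) := fun _ _ h =>
  ListForm.ext h

instance : AddCommGroup (ListForm M σ) :=
  eval_injective.addCommGroup _ rfl (fun _ _ => rfl) (fun _ => rfl) (fun _ _ => rfl)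
    (fun _ _ => rfl) (fun _ _ => rfl)

/-- Evaluation as an additive map. -/
def evalHom : ListForm M σ →+ (List M → Λ) where
  toFun := eval
  map_zero' := rfl
  map_add' _ _ := rfl

instance {R : Type*} [Semiring R] [Module R Λ] : Module R (ListForm M σ) :=
  eval_injective.module R evalHom fun _ _ => rfl

theorem ext_eval {F G : ListForm M σ} (h : ∀ l, F.eval l = G.eval l) : F = G :=
  ListForm.ext (funext h)

@[simp] theorem zero_eval (l : List M) : (0 : ListForm M σ).eval l = 0 := rfl
@[simp] theorem add_eval (F G : ListForm M σ) (l : List M) :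
    (F + G).eval l = F.eval l + G.eval l := rfl
@[simp] theorem neg_eval (F : ListForm M σ) (l : List M) : (-F).eval l = -F.eval l := rfl
@[simp] theorem sub_eval (F G : ListForm M σ) (l : List M) :
    (F - G).eval l = F.eval l - G.eval l := rfl
@[simp] theorem smul_eval {R : Type*} [Semiring R] [Module R Λ] (r : R) (F : ListForm M σ)
    (l : List M) : (r • F).eval l = r • F.eval l := rfl
theorem zsmul_eval (n : ℤ) (F : ListForm M σ) (l : List M) : (n • F).eval l = n • F.eval l := rfl

theorem sum_eval {ι : Type*} (s : Finset ι) (F : ι → ListForm M σ) (l : List M) :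
    (∑ i ∈ s, F i).eval l = ∑ i ∈ s, (F i).eval l := by
  change evalHom (∑ i ∈ s, F i) l = _
  rw [map_sum, Finset.sum_apply]
  rfl

/-- The contraction with an element of `M`. -/
def contr (ξ : M) : ListForm M σ →+ ListForm M σ where
  toFun F := ⟨fun l => F.eval (ξ :: l)⟩
  map_zero' := rfl
  map_add' _ _ := rfl

/-- The parity involution. -/
def parity : ListForm M σ →+ ListForm M σ where
  toFun F := ⟨fun l => (-1 : ℤ) ^ l.length • σ (F.eval l)⟩
  map_zero' := ext_eval fun l => by simp
  map_add' F G := ext_eval fun l => by simp only [add_eval, map_add, smul_add]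

theorem eval_cons (ξ : M) (F : ListForm M σ) (l : List M) :
    F.eval (ξ :: l) = (contr ξ F).eval l := rfl

theorem contr_smul {R : Type*} [Semiring R] [Module R Λ] (ξ : M) (r : R) (F : ListForm M σ) :
    contr ξ (r • F) = r • contr ξ F := rfl

theorem parity_eval (F : ListForm M σ) (l : List M) :
    (parity F).eval l = (-1 : ℤ) ^ l.length • σ (F.eval l) := rfl

/-- The parity counts the arguments, and a contraction uses up one of them. -/
theorem contr_parity (ξ : M) (F : ListForm M σ) :
    contr ξ (parity F) = -parity (contr ξ F) := by
  apply ext_eval; intro l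
  rw [← eval_cons, neg_eval, parity_eval, parity_eval, eval_cons, List.length_cons, pow_succ,
    mul_neg_one, neg_smul]

theorem ext_contr {F G : ListForm M σ} (h0 : F.eval [] = G.eval [])
    (h : ∀ ξ, contr ξ F = contr ξ G) : F = G := by
  apply ext_eval
  intro l
  cases l with
  | nil => exact h0
  | cons ξ l => rw [eval_cons, h, eval_cons]

/-- The product, evaluated on a list. -/
def mulAux : List M → ListForm M σ → ListForm M σ → Λ
  | [], F, G => F.eval [] * G.eval []
  -- The shuffle product, expanded according to the factor that receives `ξ`. It makes the
  -- contraction an odd derivation by definition.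
  | ξ :: l, F, G => mulAux l (contr ξ F) G + mulAux l (parity F) (contr ξ G)

instance : Mul (ListForm M σ) := ⟨fun F G => ⟨fun l => mulAux l F G⟩⟩

instance : One (ListForm M σ) := ⟨⟨fun l => match l with | [] => 1 | _ :: _ => 0⟩⟩

theorem one_nil : (1 : ListForm M σ).eval [] = 1 := rfl

theorem contr_one (ξ : M) : contr ξ (1 : ListForm M σ) = 0 := rfl

theorem mul_nil (F G : ListForm M σ) : (F * G).eval [] = F.eval [] * G.eval [] := rfl

theorem contr_mul (ξ : M) (F G : ListForm M σ) :
    contr ξ (F * G) = contr ξ F * G + parity F * contr ξ G := rfl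

theorem parity_one : parity (1 : ListForm M σ) = 1 := by
  apply ext_contr
  · simp [parity_eval, one_nil]
  · intro ξ; simp [contr_parity, contr_one]

/-- The list is fixed before the functions, so that the induction hypothesis is available for their
contractions and parities. The same device serves for the other ring axioms. -/
protected theorem add_mul_aux (l : List M) : ∀ F G H : ListForm M σ,
    ((F + G) * H).eval l = (F * H + G * H).eval l := by
  induction l with
  | nil => intro F G H; simp [mul_nil, add_mul]
  | cons ξ l ih =>
    intro F G H; simp only [eval_cons, contr_mul, map_add, ih, add_eval]; abel

protected theorem mul_add_aux (l : List M) : ∀ F G H : ListForm M σ,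
    (F * (G + H)).eval l = (F * G + F * H).eval l := by
  induction l with
  | nil => intro F G H; simp [mul_nil, mul_add]
  | cons ξ l ih =>
    intro F G H; simp only [eval_cons, contr_mul, map_add, ih, add_eval]; abel

protected theorem zero_mul_aux (F : ListForm M σ) : 0 * F = 0 := by
  have : (0 + 0) * F = 0 * F + 0 * F := ext_eval fun l => ListForm.add_mul_aux l 0 0 F
  rw [add_zero] at this
  exact left_eq_add.mp this

protected theorem mul_zero_aux (F : ListForm M σ) : F * 0 = 0 := by
  have : F * (0 + 0) = F * 0 + F * 0 := ext_eval fun l => ListForm.mul_add_aux l F 0 0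
  rw [add_zero] at this
  exact left_eq_add.mp this

instance : NonUnitalNonAssocRing (ListForm M σ) where
  left_distrib F G H := ext_eval fun l => ListForm.mul_add_aux l F G H
  right_distrib F G H := ext_eval fun l => ListForm.add_mul_aux l F G H
  zero_mul := ListForm.zero_mul_aux
  mul_zero := ListForm.mul_zero_aux

theorem parity_mul (F G : ListForm M σ) : parity (F * G) = parity F * parity G := by
  apply ext_eval
  intro l
  induction l generalizing F G with
  | nil => simp [parity_eval, mul_nil]
  | cons ξ l ih =>
    simp only [eval_cons, contr_parity, contr_mul, map_add, neg_eval, add_eval, ih, neg_add,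
      neg_mul, mul_neg]

/-- Since `parity` is multiplicative, contracting either triple product gives the same three terms
up to bracketing. -/
protected theorem mul_assoc_aux (l : List M) : ∀ F G H : ListForm M σ,
    (F * G * H).eval l = (F * (G * H)).eval l := by
  induction l with
  | nil => intro F G H; simp [mul_nil, mul_assoc]
  | cons ξ l ih =>
    intro F G H
    simp only [eval_cons, contr_mul, parity_mul, mul_add, add_mul, add_eval, ih]
    abel

protected theorem one_mul_aux (l : List M) : ∀ F : ListForm M σ, (1 * F).eval l = F.eval l := by
  induction l with
  | nil => intro F; simp [mul_nil, one_nil]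
  | cons ξ l ih => intro F; simp [eval_cons, contr_mul, contr_one, parity_one, ih]

protected theorem mul_one_aux (l : List M) : ∀ F : ListForm M σ, (F * 1).eval l = F.eval l := by
  induction l with
  | nil => intro F; simp [mul_nil, one_nil]
  | cons ξ l ih => intro F; simp [eval_cons, contr_mul, contr_one, ih]

instance : Ring (ListForm M σ) :=
  { (inferInstance : NonUnitalNonAssocRing (ListForm M σ)) with
    mul_assoc := fun F G H => ext_eval fun l => ListForm.mul_assoc_aux l F G H
    one_mul := fun F => ext_eval fun l => ListForm.one_mul_aux l F
    mul_one := fun F => ext_eval fun l => ListForm.mul_one_aux l F }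

theorem parity_smul {R : Type*} [CommRing R] [Algebra R Λ]
    (hσ : ∀ (r : R) (u : Λ), σ (r • u) = r • σ u) (r : R) (F : ListForm M σ) :
    parity (r • F) = r • parity F :=
  ext_eval fun l => by simp only [parity_eval, smul_eval, hσ, smul_comm r]

theorem smul_mul_of_map_smul {R : Type*} [CommRing R] [Algebra R Λ]
    (hσ : ∀ (r : R) (u : Λ), σ (r • u) = r • σ u) (r : R) (F G : ListForm M σ) :
    r • F * G = r • (F * G) := by
  apply ext_eval; intro l
  induction l generalizing F G with
  | nil => simp [mul_nil]
  | cons ξ l ih =>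
    simp only [eval_cons, contr_mul, contr_smul, parity_smul hσ, add_eval, ih, smul_eval, smul_add]

/-- The Lie derivative, evaluated on a list. -/
def lieAux (E : Λ →+ Λ) (D : M → M) : List M → ListForm M σ → Λ
  | [], F => E (F.eval [])
  | ξ :: l, F => lieAux E D l (contr ξ F) - F.eval (D ξ :: l)

/-- The operator on functions on lists that is induced by operators on `Λ` and `M`. -/
def lie (E : Λ →+ Λ) (D : M → M) : ListForm M σ →+ ListForm M σ where
  toFun F := ⟨fun l => lieAux E D l F⟩
  map_zero' := by
    apply ext_eval; intro l
    induction l with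
    | nil => simp [lieAux]
    | cons ξ l ih => simpa [lieAux] using ih
  map_add' F G := by
    apply ext_eval; intro l
    induction l generalizing F G with
    | nil => simp [lieAux]
    | cons ξ l ih =>
      have := ih (contr ξ F) (contr ξ G)
      simp only [add_eval] at this ⊢
      simp only [lieAux, map_add, this, add_eval]
      abel

theorem lie_nil (E : Λ →+ Λ) (D : M → M) (F : ListForm M σ) :
    (lie E D F).eval [] = E (F.eval []) := rfl

/-- Cartan's relation `[L_D, i_ξ] = i_(D ξ)`, built into the recursion. -/
theorem contr_lie (E : Λ →+ Λ) (D : M → M) (ξ : M) (F : ListForm M σ) :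
    contr ξ (lie E D F) = lie E D (contr ξ F) - contr (D ξ) F := rfl

theorem parity_lie {E : Λ →+ Λ} (hE : ∀ u, σ (E u) = E (σ u)) (D : M → M) (F : ListForm M σ) :
    parity (lie E D F) = lie E D (parity F) := by
  apply ext_eval; intro l
  induction l generalizing F with
  | nil => simp [parity_eval, lie_nil, hE]
  | cons ξ l ih =>
    simp only [eval_cons, contr_parity, contr_lie, neg_eval, map_sub, sub_eval, ih, map_neg]
    abel

theorem lie_mul {E : Λ →+ Λ} (hE : ∀ u, σ (E u) = E (σ u))
    (hE' : ∀ u v, E (u * v) = E u * v + u * E v) (D : M → M) (F G : ListForm M σ) :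
    lie E D (F * G) = lie E D F * G + F * lie E D G := by
  apply ext_eval; intro l
  induction l generalizing F G with
  | nil => simp [mul_nil, lie_nil, hE']
  | cons ξ l ih =>
    simp only [eval_cons, contr_lie, contr_mul, map_add, sub_eval, add_eval, ih,
      parity_lie hE, sub_mul, mul_sub]
    abel

/-- An odd operator on `Λ`, extended to functions on lists. -/
def odd (c : Λ →+ Λ) : ListForm M σ →+ ListForm M σ where
  toFun F := ⟨fun l => (-1 : ℤ) ^ l.length • c (F.eval l)⟩
  map_zero' := ext_eval fun l => by simp
  map_add' F G := ext_eval fun l => by simp only [add_eval, map_add, smul_add]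

theorem odd_eval (c : Λ →+ Λ) (F : ListForm M σ) (l : List M) :
    (odd c F).eval l = (-1 : ℤ) ^ l.length • c (F.eval l) := rfl

theorem contr_odd (c : Λ →+ Λ) (ξ : M) (F : ListForm M σ) :
    contr ξ (odd c F) = -odd c (contr ξ F) := by
  apply ext_eval; intro l
  rw [← eval_cons, neg_eval, odd_eval, odd_eval, eval_cons, List.length_cons, pow_succ,
    mul_neg_one, neg_smul]

theorem parity_odd {c : Λ →+ Λ} (hc : ∀ u, σ (c u) = -c (σ u)) (F : ListForm M σ) :
    parity (odd c F) = -odd c (parity F) := by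
  apply ext_eval; intro l
  simp only [parity_eval, odd_eval, hc, map_zsmul, neg_eval, smul_neg]

/-- The sign in `odd` makes the operator anticommute with contractions, so that an odd derivation of
the values is an odd derivation of the functions on lists. -/
theorem odd_mul {c : Λ →+ Λ} (hc : ∀ u, σ (c u) = -c (σ u))
    (hc' : ∀ u v, c (u * v) = c u * v + σ u * c v) (F G : ListForm M σ) :
    odd c (F * G) = odd c F * G + parity F * odd c G := by
  apply ext_eval; intro l
  induction l generalizing F G with
  | nil => simp [mul_nil, odd_eval, parity_eval, hc']
  | cons ξ l ih =>
    simp only [eval_cons, contr_odd, contr_mul, map_add, neg_eval, add_eval, ih,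
      contr_parity, parity_odd hc, neg_mul, mul_neg]
    abel

/-- The Cartan-Chevalley-Eilenberg operator, evaluated on a list. -/
def ceAux (E : M → Λ →+ Λ) (B : M → M → M) : List M → ListForm M σ → Λ
  | [], _ => 0
  | ξ :: l, F => (lie (E ξ) (B ξ) F).eval l - ceAux E B l (contr ξ F)

/-- The Cartan-Chevalley-Eilenberg operator for a bracket `B` on `M` acting on `Λ` through `E`. -/
def ce (E : M → Λ →+ Λ) (B : M → M → M) : ListForm M σ →+ ListForm M σ where
  toFun F := ⟨fun l => ceAux E B l F⟩
  map_zero' := by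
    apply ext_eval; intro l
    induction l with
    | nil => simp [ceAux]
    | cons ξ l ih => simpa [ceAux] using ih
  map_add' F G := by
    apply ext_eval; intro l
    induction l generalizing F G with
    | nil => simp [ceAux]
    | cons ξ l ih =>
      have := ih (contr ξ F) (contr ξ G)
      simp only [add_eval] at this ⊢
      simp only [ceAux, map_add, this, add_eval]
      abel

variable {E : M → Λ →+ Λ} {B : M → M → M}

theorem ce_nil (F : ListForm M σ) : (ce E B F).eval [] = 0 := rfl

/-- Cartan's formula `i_ξ d + d i_ξ = L_ξ`. Together with `ce_nil` it characterises the operator. -/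
theorem contr_ce (ξ : M) (F : ListForm M σ) :
    contr ξ (ce E B F) = lie (E ξ) (B ξ) F - ce E B (contr ξ F) := rfl

theorem parity_ce (hE : ∀ ξ u, σ (E ξ u) = E ξ (σ u)) (F : ListForm M σ) :
    parity (ce E B F) = -ce E B (parity F) := by
  apply ext_eval; intro l
  induction l generalizing F with
  | nil => simp [parity_eval, ce_nil]
  | cons ξ l ih =>
    simp only [eval_cons, contr_parity, contr_ce, map_sub, map_neg, neg_eval, sub_eval,
      ih, parity_lie (hE ξ)]

theorem parity_parity (hσ : ∀ u, σ (σ u) = u) (F : ListForm M σ) : parity (parity F) = F :=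
  ext_eval fun l => by
    rw [parity_eval, parity_eval, map_zsmul, hσ, smul_smul, ← mul_pow]
    simp

/-- After a contraction the Lie derivative contributes its own derivation rule. The term `F * L_ξ G`
appears on the other side as `parity (parity F) * L_ξ G`, which is why `σ` has to be an involution.
-/
theorem ce_mul (hσ : ∀ u, σ (σ u) = u) (hE : ∀ ξ u, σ (E ξ u) = E ξ (σ u))
    (hE' : ∀ ξ u v, E ξ (u * v) = E ξ u * v + u * E ξ v) (F G : ListForm M σ) :
    ce E B (F * G) = ce E B F * G + parity F * ce E B G := by
  apply ext_eval; intro l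
  induction l generalizing F G with
  | nil => simp [mul_nil, ce_nil]
  | cons ξ l ih =>
    simp only [eval_cons, contr_ce, contr_mul, map_add, sub_eval, add_eval, ih,
      contr_parity, parity_ce hE, lie_mul (hE ξ) (hE' ξ), parity_lie (hE ξ), neg_mul, mul_neg,
      mul_sub, sub_mul, map_neg, neg_eval, parity_parity hσ]
    abel

end Ring

/-! ### Alternating forms among the functions on lists -/

section IsForm

variable {A M Λ : Type*} [CommRing A] [Ring Λ] [Module A Λ] [AddCommGroup M] [Module A M]
  {σ : Λ →+* Λ}

/-- The alternating forms of degree `p` with values in `V`. -/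
def IsForm (V : Submodule A Λ) : ℕ → ListForm M σ → Prop
  | 0, F => F.eval [] ∈ V ∧ ∀ ξ, contr ξ F = 0
  | p + 1, F => F.eval [] = 0 ∧ (∀ ξ, IsForm V p (contr ξ F)) ∧
      (∀ ξ η, contr (ξ + η) F = contr ξ F + contr η F) ∧
      (∀ (a : A) ξ, contr (a • ξ) F = a • contr ξ F) ∧ ∀ ξ, contr ξ (contr ξ F) = 0

namespace IsForm

variable {V W : Submodule A Λ} {p q : ℕ} {F G : ListForm M σ}

theorem contr_add (h : IsForm V p F) (ξ η : M) : contr (ξ + η) F = contr ξ F + contr η F := by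
  cases p with
  | zero => simp [h.2]
  | succ p => exact h.2.2.1 ξ η

theorem contr_smul (h : IsForm V p F) (a : A) (ξ : M) : contr (a • ξ) F = a • contr ξ F := by
  cases p with
  | zero => simp [h.2]
  | succ p => exact h.2.2.2.1 a ξ

theorem contr_contr_self (h : IsForm V p F) (ξ : M) : contr ξ (contr ξ F) = 0 := by
  cases p with
  | zero => simp [h.2]
  | succ p => exact h.2.2.2.2 ξ

theorem contr_zero (h : IsForm V p F) : contr (0 : M) F = 0 := by
  have := h.contr_smul 0 0
  simpa using this

theorem contr_neg (h : IsForm V p F) (ξ : M) : contr (-ξ) F = -contr ξ F := by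
  have := h.contr_smul (-1) ξ
  simpa using this

theorem contr_sub (h : IsForm V p F) (ξ η : M) : contr (ξ - η) F = contr ξ F - contr η F := by
  rw [sub_eq_add_neg, h.contr_add, h.contr_neg, sub_eq_add_neg]

/-- Contractions of forms are forms. -/
theorem exists_contr (h : IsForm V p F) (ξ : M) : ∃ p', IsForm V p' (contr ξ F) := by
  cases p with
  | zero => exact ⟨0, by rw [h.2]; exact ⟨V.zero_mem, fun _ => map_zero _⟩⟩
  | succ p => exact ⟨p, h.2.1 ξ⟩

/-- Polarisation of `contr_contr_self`. -/
theorem contr_contr (h : IsForm V p F) (ξ η : M) :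
    contr ξ (contr η F) = -contr η (contr ξ F) := by
  have h1 := h.contr_contr_self (ξ + η)
  obtain ⟨p₁, h₁⟩ := h.exists_contr ξ
  obtain ⟨p₂, h₂⟩ := h.exists_contr η
  rw [h.contr_add, map_add, h₁.contr_add, h₂.contr_add, h.contr_contr_self,
    h.contr_contr_self, zero_add, add_zero] at h1
  rw [eq_neg_iff_add_eq_zero, add_comm]
  exact h1

theorem parity_eq (h : IsForm V p F) {n : ℕ} (hσ : ∀ u ∈ V, σ u = (-1 : ℤ) ^ n • u) :
    parity F = (-1 : ℤ) ^ (p + n) • F := by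
  apply ext_eval; intro l
  induction l generalizing p F with
  | nil =>
    cases p with
    | zero => simp only [parity_eval, hσ _ h.1, zsmul_eval]; simp
    | succ p => simp only [parity_eval, h.1, zsmul_eval]; simp
  | cons ξ l ih =>
    cases p with
    | zero =>
      simp only [eval_cons, contr_parity, map_zsmul, h.2, map_zero, neg_zero, smul_zero]
    | succ p =>
      simp only [eval_cons, contr_parity, map_zsmul, neg_eval, ih (h.2.1 ξ), zsmul_eval]
      rw [show p + 1 + n = p + n + 1 by ring, pow_succ, mul_neg_one, neg_smul]

theorem mul_comm (h : IsForm V p F) (h' : IsForm W q G) {m n : ℕ}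
    (hV : ∀ u ∈ V, σ u = (-1 : ℤ) ^ m • u) (hW : ∀ u ∈ W, σ u = (-1 : ℤ) ^ n • u)
    (hVW : ∀ u ∈ V, ∀ w ∈ W, u * w = (-1 : ℤ) ^ (m * n) • (w * u)) :
    F * G = (-1 : ℤ) ^ ((p + m) * (q + n)) • (G * F) := by
  apply ext_eval; intro l
  induction l generalizing p q F G with
  | nil =>
    rw [zsmul_eval, mul_nil, mul_nil]
    cases p with
    | succ p => simp [h.1]
    | zero =>
      cases q with
      | succ q => simp [h'.1]
      | zero => rw [hVW _ h.1 _ h'.1]; simp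
  | cons ξ l ih =>
    rw [zsmul_eval, eval_cons, eval_cons, contr_mul, contr_mul, h.parity_eq hV, h'.parity_eq hW]
    simp only [add_eval, smul_mul_assoc, zsmul_eval, smul_add]
    -- The two terms correspond crosswise: contracting the first factor of one product is
    -- contracting the second factor of the other.
    rw [add_comm]
    congr 1
    · cases q with
      | zero => simp [h'.2]
      | succ q =>
        rw [ih h (h'.2.1 ξ), zsmul_eval, smul_smul, ← pow_add]
        congr 2; ring
    · cases p with
      | zero => simp [h.2]
      | succ p =>
        rw [ih (h.2.1 ξ) h', zsmul_eval, smul_smul, ← pow_add]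
        congr 1
        have : (p + 1 + m) * (q + n) + (q + n) = (p + m) * (q + n) + 2 * (q + n) := by ring
        rw [this, pow_add, pow_mul]; simp

/-- The commutator of `D₁` and `D₂` turns up inside a contraction, so additivity in the contracted
argument is needed; arbitrary functions on lists do not have it. -/
theorem lie_lie (h : IsForm V p F) {E₁ E₂ E₃ : Λ →+ Λ} {D₁ D₂ D₃ : M → M}
    (hE : ∀ u, E₁ (E₂ u) - E₂ (E₁ u) = E₃ u) (hD : ∀ ξ, D₁ (D₂ ξ) - D₂ (D₁ ξ) = D₃ ξ) :
    lie E₁ D₁ (lie E₂ D₂ F) - lie E₂ D₂ (lie E₁ D₁ F) = lie E₃ D₃ F := by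
  apply ext_eval; intro l
  induction l generalizing p F with
  | nil => simp [lie_nil, hE]
  | cons ξ l ih =>
    obtain ⟨p', h'⟩ := h.exists_contr ξ
    have := ih h'
    simp only [eval_cons, contr_lie, map_sub, sub_eval, ← hD, h.contr_sub] at this ⊢
    rw [← this]
    abel

/-- Contracting both sides with `η` leaves exactly the commutator rule for the Lie derivatives along
`ξ` and `η`. -/
theorem lie_ce (h : IsForm V p F) {E : M → Λ →+ Λ} {B : M → M → M}
    (hE : ∀ ξ η u, E ξ (E η u) - E η (E ξ u) = E (B ξ η) u)
    (hB : ∀ ξ η ζ, B ξ (B η ζ) - B η (B ξ ζ) = B (B ξ η) ζ) (ξ : M) :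
    lie (E ξ) (B ξ) (ce E B F) = ce E B (lie (E ξ) (B ξ) F) := by
  apply ext_eval; intro l
  induction l generalizing p F with
  | nil => simp [lie_nil, ce_nil]
  | cons η l ih =>
    obtain ⟨p', h'⟩ := h.exists_contr η
    have := ih h'
    have h2 := congrArg (fun G => eval G l) (h.lie_lie (hE ξ η) (hB ξ η))
    simp only [eval_cons, contr_lie, contr_ce, map_sub, sub_eval] at this h2 ⊢
    rw [this, ← h2]
    abel

/-- By Cartan's formula `i_ξ d d = L_ξ d - d L_ξ + d d i_ξ`. The first two terms cancel by `lie_ce`,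
the last one vanishes by induction. -/
theorem ce_ce (h : IsForm V p F) {E : M → Λ →+ Λ} {B : M → M → M}
    (hE : ∀ ξ η u, E ξ (E η u) - E η (E ξ u) = E (B ξ η) u)
    (hB : ∀ ξ η ζ, B ξ (B η ζ) - B η (B ξ ζ) = B (B ξ η) ζ) :
    ce E B (ce E B F) = 0 := by
  apply ext_eval; intro l
  induction l generalizing p F with
  | nil => simp [ce_nil]
  | cons ξ l ih =>
    obtain ⟨p', h'⟩ := h.exists_contr ξ
    have := ih h'
    simp only [eval_cons, contr_ce, map_sub, sub_eval, zero_eval, h.lie_ce hE hB] at this ⊢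
    rw [this]
    abel

end IsForm

end IsForm

end ListForm

/-! ### Classes of shuffles, sorted by the side from which a given index comes -/

section Shuffles

open Equiv

variable {α β α' β' : Type*} [Fintype α] [Fintype β] [Fintype α'] [Fintype β']
  [DecidableEq α] [DecidableEq β] [DecidableEq α'] [DecidableEq β']

theorem mem_range_sumCongrHom_iff (σ : Perm (α ⊕ β)) :
    σ ∈ (Perm.sumCongrHom α β).range ↔ ∀ x, (σ x).isLeft = x.isLeft := by
  constructor
  · rintro ⟨⟨s, t⟩, rfl⟩ (x | x) <;> simp
  · intro h
    apply Perm.mem_sumCongrHom_range_of_perm_mapsTo_inl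
    rintro _ ⟨x, rfl⟩
    have := h (Sum.inl x)
    rw [Sum.isLeft_inl, Sum.isLeft_iff] at this
    obtain ⟨y, hy⟩ := this
    exact ⟨y, hy.symm⟩

/-- Whether a class of permutations moves an index `k` from the left or from the right. -/
def shuffleSide (k : α ⊕ β) (q : Perm.ModSumCongr α β) : Bool :=
  Quotient.liftOn' q (fun σ => (σ⁻¹ k).isLeft) fun σ₁ σ₂ h => by
    rw [QuotientGroup.leftRel_apply, mem_range_sumCongrHom_iff] at h
    have := h (σ₂⁻¹ k)
    simpa using this

theorem shuffleSide_mk (k : α ⊕ β) (σ : Perm (α ⊕ β)) :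
    shuffleSide k (Quotient.mk'' σ) = (σ⁻¹ k).isLeft := rfl

theorem shuffleSide_smul (k : α ⊕ β) (c : Perm (α ⊕ β)) (q : Perm.ModSumCongr α β) :
    shuffleSide k (c • q) = shuffleSide (c⁻¹ k) q := by
  induction q using Quotient.inductionOn' with
  | h σ =>
    rw [shuffleSide_mk]
    change shuffleSide k (Quotient.mk'' (c * σ)) = _
    rw [shuffleSide_mk, mul_inv_rev, Perm.mul_apply]

variable (a : α' ↪ α) (b : β' ↪ β)

/-- Extending a class of permutations by fixing the indices outside the range of an embedding. -/
def shuffleExtend (q : Perm.ModSumCongr α' β') : Perm.ModSumCongr α β :=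
  Quotient.map' (fun τ : Perm (α' ⊕ β') => τ.viaEmbedding (a.sumMap b)) (fun τ₁ τ₂ h => by
    rw [QuotientGroup.leftRel_apply, mem_range_sumCongrHom_iff] at h ⊢
    intro x
    have hh : (τ₁.viaEmbedding (a.sumMap b))⁻¹ * τ₂.viaEmbedding (a.sumMap b) =
        (τ₁⁻¹ * τ₂).viaEmbedding (a.sumMap b) := by
      simp only [← Perm.viaEmbeddingHom_apply, map_mul, map_inv]
    rw [hh]
    by_cases hx : x ∈ Set.range (a.sumMap b)
    · obtain ⟨y, rfl⟩ := hx
      rw [Perm.viaEmbedding_apply]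
      have := h y
      rcases y with y | y <;> rcases h2 : (τ₁⁻¹ * τ₂) _ with z | z <;> simp_all
    · rw [Perm.viaEmbedding_apply_of_notMem _ _ _ hx]) q

theorem shuffleExtend_mk (τ : Perm (α' ⊕ β')) :
    shuffleExtend a b (Quotient.mk'' τ) = Quotient.mk'' (τ.viaEmbedding (a.sumMap b)) := rfl

variable {a b} in
-- A class in which `i₀` comes from its own side has a representative that fixes `i₀`. These classes
-- are therefore those of the permutations of the remaining indices, which form the range of
-- `a.sumMap b`.
theorem sum_filter_shuffleSide {N : Type*} [AddCommMonoid N] {i₀ : α ⊕ β}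
    (hi : ∀ x, x ∈ Set.range (a.sumMap b) ↔ x ≠ i₀) (Ψ : Perm.ModSumCongr α β → N) :
    ∑ q with shuffleSide i₀ q = i₀.isLeft, Ψ q = ∑ q, Ψ (shuffleExtend a b q) := by
  symm
  refine Finset.sum_bij (fun q _ => shuffleExtend a b q) ?_ ?_ ?_ (fun _ _ => rfl)
  · intro q _
    induction q using Quotient.inductionOn' with
    | h τ =>
      rw [Finset.mem_filter, shuffleExtend_mk, shuffleSide_mk]
      refine ⟨Finset.mem_univ _, ?_⟩
      rw [← Perm.viaEmbeddingHom_apply, ← map_inv, Perm.viaEmbeddingHom_apply,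
        Perm.viaEmbedding_apply_of_notMem]
      rw [hi]; simp
  · intro q₁ _ q₂ _ h
    induction q₁ using Quotient.inductionOn' with
    | h τ₁ =>
    induction q₂ using Quotient.inductionOn' with
    | h τ₂ =>
      rw [shuffleExtend_mk, shuffleExtend_mk] at h
      have h := Quotient.exact' h
      apply Quotient.sound'
      rw [QuotientGroup.leftRel_apply, mem_range_sumCongrHom_iff] at h ⊢
      have hh : (τ₁.viaEmbedding (a.sumMap b))⁻¹ * τ₂.viaEmbedding (a.sumMap b) =
          (τ₁⁻¹ * τ₂).viaEmbedding (a.sumMap b) := by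
        simp only [← Perm.viaEmbeddingHom_apply, map_mul, map_inv]
      rw [hh] at h
      intro y
      have := h (a.sumMap b y)
      rw [Perm.viaEmbedding_apply] at this
      rcases y with y | y <;> rcases h2 : (τ₁⁻¹ * τ₂) _ with z | z <;> simp_all
  · intro q hq
    induction q using Quotient.inductionOn' with
    | h σ =>
      rw [Finset.mem_filter, shuffleSide_mk] at hq
      have hq := hq.2
      -- Both `σ⁻¹ i₀` and `i₀` lie on the same side, so the transposition preserves the two sides.
      -- Multiplying by it keeps the class of `σ` and produces a representative that fixes `i₀`.
      have hfix : (σ * swap (σ⁻¹ i₀) i₀) i₀ = i₀ := by simp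
      have hmem : ∀ x, x ∈ Set.range (a.sumMap b) ↔
          (σ * swap (σ⁻¹ i₀) i₀) x ∈ Set.range (a.sumMap b) := by
        intro x
        rw [hi, hi, not_iff_not]
        constructor
        · rintro rfl; exact hfix
        · intro h; exact (σ * swap (σ⁻¹ i₀) i₀).injective (h.trans hfix.symm)
      let e := Equiv.ofInjective _ (a.sumMap b).injective
      let τ : Perm (α' ⊕ β') :=
        e.symm.permCongr ((σ * swap (σ⁻¹ i₀) i₀).subtypePerm fun x => (hmem x).symm)
      refine ⟨Quotient.mk'' τ, Finset.mem_univ _, ?_⟩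
      have hτ : τ.viaEmbedding (a.sumMap b) = σ * swap (σ⁻¹ i₀) i₀ := by
        ext1 x
        by_cases hx : x ∈ Set.range (a.sumMap b)
        · obtain ⟨y, rfl⟩ := hx
          rw [Perm.viaEmbedding_apply]
          have : a.sumMap b (τ y) = ((e (τ y) : Set.range (a.sumMap b)) : α ⊕ β) := rfl
          rw [this]
          simp only [τ, Equiv.permCongr_apply, Equiv.symm_symm, Equiv.apply_symm_apply]
          rfl
        · rw [Perm.viaEmbedding_apply_of_notMem _ _ _ hx]
          rw [hi, not_not] at hx
          rw [hx, hfix]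
      rw [shuffleExtend_mk, hτ]
      apply Quotient.sound'
      rw [QuotientGroup.leftRel_apply, mem_range_sumCongrHom_iff]
      intro x
      have : (σ * swap (σ⁻¹ i₀) i₀)⁻¹ * σ = swap (σ⁻¹ i₀) i₀ := by
        rw [mul_inv_rev, swap_inv]; group
      rw [this]
      rcases eq_or_ne x (σ⁻¹ i₀) with rfl | h1
      · rw [swap_apply_left, hq]
      · rcases eq_or_ne x i₀ with rfl | h2
        · rw [swap_apply_right, hq]
        · rw [swap_apply_of_ne_of_ne h1 h2]

end Shuffles

/-! ### Contraction of a shuffle product with the first argument -/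

section DomCoprod

open Equiv

variable {A M N₁ N₂ : Type*} [CommRing A] [AddCommGroup M] [Module A M]
  [AddCommGroup N₁] [Module A N₁] [AddCommGroup N₂] [Module A N₂]

theorem sign_viaEmbedding {α β : Type*} [Fintype α] [Fintype β] [DecidableEq α] [DecidableEq β]
    (τ : Perm α) (ι : α ↪ β) : Perm.sign (τ.viaEmbedding ι) = Perm.sign τ := by
  rw [Perm.viaEmbedding]
  convert Perm.sign_extendDomain τ (Equiv.ofInjective ι.1 ι.2)

/-- The shuffles that feed the first argument to `f` are the shuffles of the other arguments, with
`f` contracted. Adding a fixed point does not change the sign of a permutation. -/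
theorem sum_shuffleSide_left {p q : ℕ} (f : M [⋀^Fin (p + 1)]→ₗ[A] N₁) (g : M [⋀^Fin q]→ₗ[A] N₂)
    (w : Fin (p + 1) ⊕ Fin q → M) :
    ∑ s with shuffleSide (Sum.inl 0) s = true, AlternatingMap.domCoprod.summand f g s w =
      (f.curryLeft (w (Sum.inl 0))).domCoprod g (w ∘ Sum.map Fin.succ id) := by
  have hr : ∀ x, x ∈ Set.range ((Fin.succEmb p).sumMap (Function.Embedding.refl (Fin q))) ↔
      x ≠ Sum.inl 0 := by
    rintro (x | x)
    · simp only [Set.mem_range, Sum.exists, Function.Embedding.coe_sumMap, Sum.map_inl,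
        Sum.map_inr, Sum.inl.injEq, reduceCtorEq, exists_false, or_false, ne_eq]
      exact Fin.exists_succ_eq
    · simp
  have h := sum_filter_shuffleSide hr (fun s => AlternatingMap.domCoprod.summand f g s w)
  rw [Sum.isLeft_inl] at h
  rw [h, AlternatingMap.domCoprod_apply, sum_apply]
  refine Finset.sum_congr rfl fun s _ => ?_
  induction s using Quotient.inductionOn' with
  | h τ =>
    rw [shuffleExtend_mk, AlternatingMap.domCoprod.summand_mk'',
      AlternatingMap.domCoprod.summand_mk'', sign_viaEmbedding]
    have hv := Perm.viaEmbedding_apply τ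
      ((Fin.succEmb p).sumMap (Function.Embedding.refl (Fin q)))
    simp only [_root_.smul_apply, MultilinearMap.domDomCongr_apply,
      MultilinearMap.domCoprod_apply, AlternatingMap.coe_multilinearMap]
    congr 2
    · rw [AlternatingMap.curryLeft_apply_apply]
      congr 1
      funext i
      induction i using Fin.cases with
      | zero =>
        rw [Perm.viaEmbedding_apply_of_notMem]
        · rfl
        · simp
      | succ i => exact congrArg w (hv (Sum.inl i))
    · exact congrArg g (funext fun i => congrArg w (hv (Sum.inr i)))

/-- The mirror image of `sum_shuffleSide_left`. The contracted argument is still the first one of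
the right block; bringing it to the front of all arguments is the business of `frontCycle`. -/
theorem sum_shuffleSide_right {p q : ℕ} (f : M [⋀^Fin p]→ₗ[A] N₁)
    (g : M [⋀^Fin (q + 1)]→ₗ[A] N₂) (w : Fin p ⊕ Fin (q + 1) → M) :
    ∑ s with shuffleSide (Sum.inr 0) s = false, AlternatingMap.domCoprod.summand f g s w =
      f.domCoprod (g.curryLeft (w (Sum.inr 0))) (w ∘ Sum.map id Fin.succ) := by
  have hr : ∀ x, x ∈ Set.range ((Function.Embedding.refl (Fin p)).sumMap (Fin.succEmb q)) ↔
      x ≠ Sum.inr 0 := by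
    rintro (x | x)
    · simp
    · simp only [Set.mem_range, Sum.exists, Function.Embedding.coe_sumMap, Sum.map_inl,
        Sum.map_inr, Sum.inr.injEq, reduceCtorEq, exists_false, false_or, ne_eq]
      exact Fin.exists_succ_eq
  have h := sum_filter_shuffleSide hr (fun s => AlternatingMap.domCoprod.summand f g s w)
  rw [Sum.isLeft_inr] at h
  rw [h, AlternatingMap.domCoprod_apply, sum_apply]
  refine Finset.sum_congr rfl fun s _ => ?_
  induction s using Quotient.inductionOn' with
  | h τ =>
    rw [shuffleExtend_mk, AlternatingMap.domCoprod.summand_mk'',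
      AlternatingMap.domCoprod.summand_mk'', sign_viaEmbedding]
    have hv := Perm.viaEmbedding_apply τ
      ((Function.Embedding.refl (Fin p)).sumMap (Fin.succEmb q))
    simp only [_root_.smul_apply, MultilinearMap.domDomCongr_apply,
      MultilinearMap.domCoprod_apply, AlternatingMap.coe_multilinearMap]
    congr 2
    · exact congrArg f (funext fun i => congrArg w (hv (Sum.inl i)))
    · rw [AlternatingMap.curryLeft_apply_apply]
      congr 1
      funext i
      induction i using Fin.cases with
      | zero =>
        rw [Perm.viaEmbedding_apply_of_notMem]
        · rfl
        · simp
      | succ i => exact congrArg w (hv (Sum.inr i))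

/-- The first of the indices of the right summand, moved to the front. -/
def frontCycle (p q : ℕ) : Perm (Fin p ⊕ Fin (q + 1)) :=
  finSumFinEquiv.symm.permCongr (Fin.cycleRange ⟨p, by omega⟩ : Perm (Fin (p + (q + 1))))

theorem sign_frontCycle (p q : ℕ) : Perm.sign (frontCycle p q) = (-1) ^ p := by
  rw [frontCycle, Perm.sign_permCongr]
  have : ∀ (n : ℕ) (i : Fin n), Perm.sign (Fin.cycleRange i) = (-1) ^ (i : ℕ) := by
    intro n i
    cases n with
    | zero => exact i.elim0
    | succ n => exact Fin.sign_cycleRange i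
  exact this _ _

/-- The arguments of a product of forms, read off from a list. -/
def listArgs (p q : ℕ) (l : List M) : Fin p ⊕ Fin q → M :=
  -- The default value `0` is never reached when the list has length `p + q`.
  Sum.elim (fun i => l.getD i 0) (fun j => l.getD (p + j) 0)

/-- The head `ξ` of the list passes from the front into the first slot of the right factor, and the
slots of the left factor receive the entries that follow it. The price is the sign of a cycle of
length `p + 1`. -/
theorem listArgs_frontCycle (p q : ℕ) (ξ : M) (l : List M) :
    listArgs p (q + 1) (ξ :: l) ∘ frontCycle p q =
      Sum.elim (fun i : Fin p => l.getD i 0)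
        (Matrix.vecCons ξ (fun j : Fin q => l.getD (p + j) 0)) := by
  have key : ∀ x : Fin p ⊕ Fin (q + 1), listArgs p (q + 1) (ξ :: l) x =
      (ξ :: l).getD (finSumFinEquiv x : ℕ) 0 := by
    rintro (x | x) <;> simp [listArgs]
  funext x
  rw [Function.comp_apply, key]
  simp only [frontCycle, Equiv.permCongr_apply, Equiv.symm_symm, Equiv.apply_symm_apply]
  rcases x with i | j
  · rw [finSumFinEquiv_apply_left, Fin.coe_cycleRange_of_lt (by simp [Fin.lt_def])]
    simp
  · induction j using Fin.cases with
    | zero =>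
      have : (finSumFinEquiv (Sum.inr 0 : Fin p ⊕ Fin (q + 1))) = ⟨p, by omega⟩ := by
        ext; simp
      rw [this, Fin.coe_cycleRange_of_le le_rfl]
      simp
    | succ j =>
      rw [Fin.cycleRange_of_gt (by simp [Fin.lt_def])]
      simp [← add_assoc]

theorem frontCycle_inr_zero (p q : ℕ) :
    frontCycle p q (Sum.inr 0) = finSumFinEquiv.symm ⟨0, by omega⟩ := by
  simp only [frontCycle, Equiv.permCongr_apply, Equiv.symm_symm]
  congr 1
  have : (finSumFinEquiv (Sum.inr 0 : Fin p ⊕ Fin (q + 1))) = ⟨p, by omega⟩ := by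
    ext; simp
  apply Fin.ext
  rw [this, Fin.coe_cycleRange_of_le le_rfl]
  simp

/-- Left translation by `frontCycle` carries the classes of `sum_shuffleSide_right` to those in
which the head of the list is fed to `g`, and multiplies every summand by `(-1)^p`. -/
theorem sum_shuffleSide_front {p q : ℕ} (f : M [⋀^Fin p]→ₗ[A] N₁)
    (g : M [⋀^Fin (q + 1)]→ₗ[A] N₂) (ξ : M) (l : List M) :
    ∑ s with shuffleSide (frontCycle p q (Sum.inr 0)) s = false,
      AlternatingMap.domCoprod.summand f g s (listArgs p (q + 1) (ξ :: l)) =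
      (-1 : ℤ) ^ p • f.domCoprod (g.curryLeft ξ) (listArgs p q l) := by
  have h1 : ∀ s : Perm.ModSumCongr (Fin p) (Fin (q + 1)),
      AlternatingMap.domCoprod.summand f g (frontCycle p q • s) (listArgs p (q + 1) (ξ :: l)) =
      (-1 : ℤ) ^ p • AlternatingMap.domCoprod.summand f g s
        (listArgs p (q + 1) (ξ :: l) ∘ frontCycle p q) := by
    intro s
    induction s using Quotient.inductionOn' with
    | h σ =>
      change AlternatingMap.domCoprod.summand f g (Quotient.mk'' (frontCycle p q * σ)) _ = _
      rw [AlternatingMap.domCoprod.summand_mk'', AlternatingMap.domCoprod.summand_mk'']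
      rw [Perm.sign_mul, sign_frontCycle, mul_smul]
      simp only [_root_.smul_apply, MultilinearMap.domDomCongr_apply, Units.smul_def]
      push_cast
      rfl
  have h2 := sum_shuffleSide_right f g (listArgs p (q + 1) (ξ :: l) ∘ frontCycle p q)
  rw [listArgs_frontCycle] at h2
  have h3 : Sum.elim (fun i : Fin p => l.getD i 0)
      (Matrix.vecCons ξ (fun j : Fin q => l.getD (p + j) 0)) ∘ Sum.map id Fin.succ =
      listArgs p q l := by
    funext x; rcases x with x | x <;> simp [listArgs]
  rw [h3, Sum.elim_inr, Matrix.cons_val_zero] at h2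
  rw [← h2, Finset.smul_sum]
  symm
  refine Finset.sum_bij (fun s _ => frontCycle p q • s) ?_ ?_ ?_ ?_
  · intro s hs
    rw [Finset.mem_filter] at hs ⊢
    refine ⟨Finset.mem_univ _, ?_⟩
    have hk : (frontCycle p q)⁻¹ (frontCycle p q (Sum.inr 0)) = Sum.inr 0 :=
      (frontCycle p q).symm_apply_apply _
    rw [shuffleSide_smul, hk]
    exact hs.2
  · intro s _ t _ h
    exact smul_left_cancel _ h
  · intro s hs
    refine ⟨(frontCycle p q)⁻¹ • s, ?_, smul_inv_smul _ _⟩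
    rw [Finset.mem_filter] at hs ⊢
    refine ⟨Finset.mem_univ _, ?_⟩
    rw [shuffleSide_smul, inv_inv]
    exact hs.2
  · intro s _
    rw [h1, listArgs_frontCycle]

theorem domCoprod_eq_sum_add_sum {p q : ℕ} (f : M [⋀^Fin p]→ₗ[A] N₁)
    (g : M [⋀^Fin q]→ₗ[A] N₂) (k : Fin p ⊕ Fin q) (w : Fin p ⊕ Fin q → M) :
    f.domCoprod g w =
      ∑ s with shuffleSide k s = true, AlternatingMap.domCoprod.summand f g s w +
      ∑ s with shuffleSide k s = false, AlternatingMap.domCoprod.summand f g s w := by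
  rw [AlternatingMap.domCoprod_apply, sum_apply,
    ← Finset.sum_filter_add_sum_filter_not _ (fun s => shuffleSide k s = true)]
  simp only [Bool.not_eq_true]

theorem listArgs_succ_comp (p q : ℕ) (ξ : M) (l : List M) :
    listArgs (p + 1) q (ξ :: l) ∘ Sum.map Fin.succ id = listArgs p q l := by
  funext x
  rcases x with x | x
  · simp [listArgs]
  · simp [listArgs, add_right_comm p 1]

/-- The head of the list is fed either to `f` or to `g`. This is the recursion that defines the
product of functions on lists. -/
theorem domCoprod_listArgs {p q : ℕ} (f : M [⋀^Fin (p + 1)]→ₗ[A] N₁)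
    (g : M [⋀^Fin (q + 1)]→ₗ[A] N₂) (ξ : M) (l : List M) :
    f.domCoprod g (listArgs (p + 1) (q + 1) (ξ :: l)) =
      (f.curryLeft ξ).domCoprod g (listArgs p (q + 1) l) +
        (-1 : ℤ) ^ (p + 1) • f.domCoprod (g.curryLeft ξ) (listArgs (p + 1) q l) := by
  rw [domCoprod_eq_sum_add_sum f g (frontCycle (p + 1) q (Sum.inr 0)), sum_shuffleSide_front]
  -- The left block is not empty, so the front position belongs to it.
  have : frontCycle (p + 1) q (Sum.inr 0) = Sum.inl 0 := by
    rw [frontCycle_inr_zero, Equiv.symm_apply_eq]; rfl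
  rw [this, sum_shuffleSide_left, listArgs_succ_comp]
  rfl

/-- A factor without arguments cannot receive `ξ`, so only one of the two terms of
`domCoprod_listArgs` is left; likewise in `domCoprod_listArgs_zero_left`. -/
theorem domCoprod_listArgs_zero_right {p : ℕ} (f : M [⋀^Fin (p + 1)]→ₗ[A] N₁)
    (g : M [⋀^Fin 0]→ₗ[A] N₂) (ξ : M) (l : List M) :
    f.domCoprod g (listArgs (p + 1) 0 (ξ :: l)) =
      (f.curryLeft ξ).domCoprod g (listArgs p 0 l) := by
  rw [domCoprod_eq_sum_add_sum f g (Sum.inl 0), sum_shuffleSide_left, listArgs_succ_comp]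
  have : ∀ s : Perm.ModSumCongr (Fin (p + 1)) (Fin 0), shuffleSide (Sum.inl 0) s = true := by
    intro s
    induction s using Quotient.inductionOn' with
    | h σ =>
      rw [shuffleSide_mk]
      rcases σ⁻¹ (Sum.inl 0) with x | x
      · rfl
      · exact x.elim0
  simp only [this, Bool.true_eq_false, Finset.filter_false, Finset.sum_empty, add_zero]
  rfl

theorem domCoprod_listArgs_zero_left {q : ℕ} (f : M [⋀^Fin 0]→ₗ[A] N₁)
    (g : M [⋀^Fin (q + 1)]→ₗ[A] N₂) (ξ : M) (l : List M) :
    f.domCoprod g (listArgs 0 (q + 1) (ξ :: l)) =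
      f.domCoprod (g.curryLeft ξ) (listArgs 0 q l) := by
  rw [domCoprod_eq_sum_add_sum f g (frontCycle 0 q (Sum.inr 0)), sum_shuffleSide_front]
  have : ∀ s : Perm.ModSumCongr (Fin 0) (Fin (q + 1)),
      shuffleSide (frontCycle 0 q (Sum.inr 0)) s = false := by
    intro s
    induction s using Quotient.inductionOn' with
    | h σ =>
      rw [shuffleSide_mk]
      rcases σ⁻¹ (frontCycle 0 q (Sum.inr 0)) with x | x
      · exact x.elim0
      · rfl
  simp only [this, Bool.false_eq_true, Finset.filter_false, Finset.sum_empty, zero_add, pow_zero,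
    one_smul]

end DomCoprod

/-! ### Grade involution and graded commutativity of the exterior algebra -/

/-- The grade involution of the exterior algebra. -/
def gradeInvolution (A N : Type*) [CommRing A] [AddCommGroup N] [Module A N] :
    ExteriorAlgebra A N →ₐ[A] ExteriorAlgebra A N :=
  CliffordAlgebra.involute

section GradeInvolution

variable {A N : Type*} [CommRing A] [AddCommGroup N] [Module A N]

theorem gradeInvolution_ι (n : N) :
    gradeInvolution A N (ExteriorAlgebra.ι A n) = -ExteriorAlgebra.ι A n :=
  CliffordAlgebra.involute_ι n

theorem gradeInvolution_gradeInvolution (u : ExteriorAlgebra A N) :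
    gradeInvolution A N (gradeInvolution A N u) = u :=
  CliffordAlgebra.involute_involute u

theorem gradeInvolution_of_mem {q : ℕ} {u : ExteriorAlgebra A N} (hu : u ∈ ⋀[A]^q N) :
    gradeInvolution A N u = (-1 : ℤ) ^ q • u := by
  induction hu using Submodule.pow_induction_on_left' with
  | algebraMap a => simp
  | add u v i hu hv h1 h2 => rw [map_add, h1, h2, smul_add]
  | mem_mul m hm i u hu h =>
    obtain ⟨n, rfl⟩ := hm
    rw [map_mul, gradeInvolution_ι, h, pow_succ, mul_smul_comm, neg_mul, mul_neg_one, smul_neg,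
      neg_smul]

theorem ι_mul_eq_of_mem {q : ℕ} (n : N) {u : ExteriorAlgebra A N} (hu : u ∈ ⋀[A]^q N) :
    ExteriorAlgebra.ι A n * u = (-1 : ℤ) ^ q • (u * ExteriorAlgebra.ι A n) := by
  induction hu using Submodule.pow_induction_on_left' with
  | algebraMap a => rw [Algebra.commutes, pow_zero, one_smul]
  | add u v i hu hv h1 h2 => rw [mul_add, h1, h2, add_mul, smul_add]
  | mem_mul m hm i u hu h =>
    obtain ⟨n', rfl⟩ := hm
    have h2 : ExteriorAlgebra.ι A n * ExteriorAlgebra.ι A n' =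
        -(ExteriorAlgebra.ι A n' * ExteriorAlgebra.ι A n) :=
      eq_neg_of_add_eq_zero_left (ExteriorAlgebra.ι_add_mul_swap n n')
    rw [← mul_assoc, h2, neg_mul, mul_assoc, h, mul_smul_comm, ← mul_assoc, pow_succ,
      mul_neg_one, neg_smul]

theorem exteriorAlgebra_mul_comm {q r : ℕ} {u v : ExteriorAlgebra A N} (hu : u ∈ ⋀[A]^q N)
    (hv : v ∈ ⋀[A]^r N) : u * v = (-1 : ℤ) ^ (q * r) • (v * u) := by
  induction hu using Submodule.pow_induction_on_left' with
  | algebraMap a => rw [Algebra.commutes, zero_mul, pow_zero, one_smul]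
  | add u v i hu hv h1 h2 => rw [add_mul, h1, h2, mul_add, smul_add]
  | mem_mul m hm i u hu h =>
    obtain ⟨n, rfl⟩ := hm
    rw [mul_assoc, h, mul_smul_comm, ← mul_assoc, ι_mul_eq_of_mem n hv, smul_mul_assoc,
      smul_smul, ← pow_add, mul_assoc]
    congr 2
    rw [Nat.succ_eq_add_one]; ring

end GradeInvolution

/-! ### The embedding of homogeneous forms into the functions on lists -/

/-- Functions on lists in `L''` with values in the exterior algebra of `L'`. -/
abbrev PolyList (A L' L'' : Type*) [CommRing A] [AddCommGroup L'] [Module A L'] : Type _ :=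
  ListForm L'' (gradeInvolution A L' : ExteriorAlgebra A L' →+* ExteriorAlgebra A L')

/-- The sign `(-1)^(p (p + 1) / 2)`. -/
def reversalSign : ℕ → ℤ
  | 0 => 1
  | p + 1 => (-1) ^ (p + 1) * reversalSign p

/-- The witness `c` certifies that the two exponents have the same parity. -/
theorem neg_one_pow_eq_of_add_eq {a b : ℕ} (c : ℕ) (h : a + b = 2 * c) :
    (-1 : ℤ) ^ a = (-1) ^ b := by
  have h1 : (-1 : ℤ) ^ a * (-1) ^ b = 1 := by rw [← pow_add, h, pow_mul]; simp
  have h2 : (-1 : ℤ) ^ b * (-1) ^ b = 1 := by rw [← mul_pow]; simp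
  exact mul_right_cancel₀ (right_ne_zero_of_mul_eq_one h2) (h1.trans h2.symm)

theorem reversalSign_mul_self (p : ℕ) : reversalSign p * reversalSign p = 1 := by
  induction p with
  | zero => rfl
  | succ p ih =>
    rw [reversalSign, mul_mul_mul_comm, ih, ← mul_pow]
    simp

section PolyList

variable {R A L' L'' : Type*} [CommRing R] [CommRing A] [Algebra R A]
  [AddCommGroup L'] [Module R L'] [Module A L'] [IsScalarTower R A L']
  [AddCommGroup L''] [Module R L''] [Module A L''] [IsScalarTower R A L'']

/-- A homogeneous form, as a function on lists. -/
def homToList (i : ℕ × ℕ) : PolyForm A L' L'' i →ₗ[A] PolyList A L' L'' where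
  -- The reversal sign absorbs the Eilenberg-Koszul signs: with it the product and the operator
  -- `d''` become the recursive ones, without any further sign.
  toFun f := ⟨fun l => if l.length = i.1 then
    reversalSign i.1 • (f (fun k => l.getD k 0) : ExteriorAlgebra A L') else 0⟩
  map_add' f g := by
    apply ListForm.ext_eval; intro l
    simp only [ListForm.add_eval, AlternatingMap.add_apply, Submodule.coe_add, smul_add]
    split_ifs <;> simp
  map_smul' a f := by
    apply ListForm.ext_eval; intro l
    simp only [ListForm.smul_eval, AlternatingMap.smul_apply, Submodule.coe_smul,
      RingHom.id_apply]
    split_ifs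
    · rw [smul_comm]
    · simp

theorem homToList_eval (i : ℕ × ℕ) (f : PolyForm A L' L'' i) (l : List L'') :
    (homToList i f).eval l = if l.length = i.1 then
      reversalSign i.1 • (f (fun k => l.getD k 0) : ExteriorAlgebra A L') else 0 := rfl

theorem contr_homToList_zero (q : ℕ) (f : PolyForm A L' L'' (0, q)) (ξ : L'') :
    ListForm.contr ξ (homToList (0, q) f) = 0 := by
  apply ListForm.ext_eval; intro l
  rw [← ListForm.eval_cons, homToList_eval]
  simp

/-- The sign is the quotient of `reversalSign (p + 1)` by `reversalSign p`. -/
theorem contr_homToList_succ (p q : ℕ) (f : PolyForm A L' L'' (p + 1, q)) (ξ : L'') :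
    ListForm.contr ξ (homToList (p + 1, q) f) =
      (-1 : ℤ) ^ (p + 1) • homToList (p, q) (AlternatingMap.curryLeft f ξ) := by
  apply ListForm.ext_eval; intro l
  rw [← ListForm.eval_cons, ListForm.zsmul_eval, homToList_eval, homToList_eval]
  simp only [List.length_cons, Nat.add_right_cancel_iff, smul_ite, smul_zero]
  congr 1
  rw [smul_smul, AlternatingMap.curryLeft_apply_apply]
  congr 3
  funext k
  induction k using Fin.cases with
  | zero => rfl
  | succ k => simp

theorem homToList_nil_zero (q : ℕ) (f : PolyForm A L' L'' (0, q)) :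
    (homToList (0, q) f).eval [] = f ![] := by
  rw [homToList_eval]
  simp only [List.length_nil, if_true, reversalSign, one_smul]
  congr 2
  exact Subsingleton.elim _ _

theorem homToList_nil_succ (p q : ℕ) (f : PolyForm A L' L'' (p + 1, q)) :
    (homToList (p + 1, q) f).eval [] = 0 := by
  rw [homToList_eval]
  simp

theorem isForm_zsmul {V : Submodule A (ExteriorAlgebra A L')} {p : ℕ} {F : PolyList A L' L''}
    (h : ListForm.IsForm V p F) (n : ℤ) : ListForm.IsForm V p (n • F) := by
  induction p generalizing F with
  | zero => exact ⟨zsmul_mem h.1 n, fun ξ => by rw [map_zsmul, h.2, smul_zero]⟩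
  | succ p ih =>
    refine ⟨?_, fun ξ => ?_, fun ξ η => ?_, fun a ξ => ?_, fun ξ => ?_⟩
    · rw [ListForm.zsmul_eval, h.1, smul_zero]
    · rw [map_zsmul]; exact ih (h.2.1 ξ)
    · simp only [map_zsmul, h.2.2.1, smul_add]
    · simp only [map_zsmul, h.2.2.2.1]
      exact smul_comm _ _ _
    · simp only [map_zsmul, h.2.2.2.2, smul_zero]

theorem isForm_homToList (p q : ℕ) (f : PolyForm A L' L'' (p, q)) :
    ListForm.IsForm (⋀[A]^q L') p (homToList (p, q) f) := by
  induction p with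
  | zero =>
    refine ⟨?_, fun ξ => contr_homToList_zero q f ξ⟩
    rw [homToList_nil_zero]
    exact Subtype.prop _
  | succ p ih =>
    refine ⟨homToList_nil_succ p q f, fun ξ => ?_, fun ξ η => ?_, fun a ξ => ?_, fun ξ => ?_⟩
    · rw [contr_homToList_succ]
      exact isForm_zsmul (ih _) _
    · simp only [contr_homToList_succ, map_add, smul_add]
    · simp only [contr_homToList_succ, map_smul]
      exact smul_comm _ _ _
    · rw [contr_homToList_succ, map_zsmul]
      cases p with
      | zero => rw [contr_homToList_zero, smul_zero]
      | succ p =>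
        rw [contr_homToList_succ, AlternatingMap.curryLeft_same, map_zero, smul_zero, smul_zero]

theorem parity_homToList (p q : ℕ) (f : PolyForm A L' L'' (p, q)) :
    ListForm.parity (homToList (p, q) f) = (-1 : ℤ) ^ (p + q) • homToList (p, q) f :=
  (isForm_homToList p q f).parity_eq fun _ hu => gradeInvolution_of_mem hu

variable (A L') in
/-- The product of the exterior algebra on homogeneous components. -/
def wedgeMap (q r : ℕ) : (⋀[A]^q L') ⊗[A] (⋀[A]^r L') →ₗ[A] ExteriorAlgebra A L' :=
  (⋀[A]^(q + r) L').subtype ∘ₗ wedge A L' q r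

theorem wedgeMap_tmul (q r : ℕ) (u : ⋀[A]^q L') (v : ⋀[A]^r L') :
    wedgeMap A L' q r (u ⊗ₜ v) = (u : ExteriorAlgebra A L') * v := rfl

theorem domCoprod_listArgs_nil {N₁ N₂ : Type*} [AddCommGroup N₁] [Module A N₁] [AddCommGroup N₂]
    [Module A N₂] (f : L'' [⋀^Fin 0]→ₗ[A] N₁) (g : L'' [⋀^Fin 0]→ₗ[A] N₂) (l : List L'') :
    f.domCoprod g (listArgs 0 0 l) = f ![] ⊗ₜ g ![] := by
  rw [AlternatingMap.domCoprod_apply, sum_apply]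
  have : Subsingleton (Equiv.Perm (Fin 0 ⊕ Fin 0)) := inferInstance
  have : Unique (Equiv.Perm.ModSumCongr (Fin 0) (Fin 0)) :=
    { default := Quotient.mk'' 1
      uniq := fun q => by
        induction q using Quotient.inductionOn' with
        | h σ => rw [Subsingleton.elim σ 1] }
  rw [Fintype.sum_unique, this.uniq (Quotient.mk'' 1) |>.symm]
  change AlternatingMap.domCoprod.summand f g (Quotient.mk'' 1) _ = _
  rw [AlternatingMap.domCoprod.summand_mk'']
  simp only [Equiv.Perm.sign_one, one_smul, MultilinearMap.domDomCongr_apply,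
      MultilinearMap.domCoprod_apply, AlternatingMap.coe_multilinearMap]
  congr 2 <;> exact Subsingleton.elim _ _

/-- Both sides obey the same recursion in the list, by `contr_mul` on the left and by
`domCoprod_listArgs` on the right. The four cases record which factors still have arguments to be
contracted. -/
theorem homToList_mul_eval (l : List L'') : ∀ {p q p' q' : ℕ} (f : PolyForm A L' L'' (p, q))
    (g : PolyForm A L' L'' (p', q')),
    (homToList (p, q) f * homToList (p', q') g).eval l = if l.length = p + p' then
      ((-1 : ℤ) ^ ((p + q) * p') * reversalSign (p + p')) •
        wedgeMap A L' q q' (AlternatingMap.domCoprod f g (listArgs p p' l)) else 0 := by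
  induction l with
  | nil =>
    intro p q p' q' f g
    rw [ListForm.mul_nil]
    rcases p with _ | p <;> rcases p' with _ | p'
    · rw [homToList_nil_zero, homToList_nil_zero, domCoprod_listArgs_nil, wedgeMap_tmul]
      simp [reversalSign]
    · rw [homToList_nil_succ]; simp
    · rw [homToList_nil_succ]; simp
    · rw [homToList_nil_succ]; simp
  | cons ξ l ih =>
    intro p q p' q' f g
    rw [ListForm.eval_cons, ListForm.contr_mul, parity_homToList]
    rcases p with _ | p <;> rcases p' with _ | p'
    · rw [contr_homToList_zero, contr_homToList_zero]
      simp
    · rw [contr_homToList_zero, contr_homToList_succ, zero_mul, zero_add, smul_mul_assoc,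
        mul_smul_comm, ListForm.zsmul_eval, ListForm.zsmul_eval, ih, domCoprod_listArgs_zero_left]
      simp only [zero_add]
      simp only [List.length_cons, Nat.add_right_cancel_iff, smul_ite, smul_zero,
        smul_smul, reversalSign]
      congr 2
      ring
    · rw [contr_homToList_zero, contr_homToList_succ, mul_zero, add_zero, smul_mul_assoc,
        ListForm.zsmul_eval, ih, domCoprod_listArgs_zero_right]
      simp only [List.length_cons, add_zero, Nat.add_right_cancel_iff, smul_ite, smul_zero,
        zero_add, smul_smul, reversalSign]
      congr 2
      ring
    · rw [contr_homToList_succ, contr_homToList_succ, smul_mul_assoc, smul_mul_assoc,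
        mul_smul_comm, ListForm.add_eval, ListForm.zsmul_eval, ListForm.zsmul_eval,
        ListForm.zsmul_eval, ih, ih, domCoprod_listArgs]
      have e1 : p + (p' + 1) = p + p' + 1 := by ring
      have e2 : p + 1 + p' = p + p' + 1 := by ring
      have e3 : p + 1 + (p' + 1) = p + p' + 1 + 1 := by ring
      simp only [List.length_cons, e1, e2, e3, Nat.add_right_cancel_iff]
      split_ifs with hl
      · have hr : reversalSign (p + p' + 1 + 1) =
            (-1) ^ (p + p' + 1 + 1) * reversalSign (p + p' + 1) := rfl
        rw [map_add, map_zsmul, smul_add, smul_smul, smul_smul, smul_smul, smul_smul, hr]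
        congr 2
        · rw [← mul_assoc, ← mul_assoc, ← pow_add, ← pow_add]
          congr 1
          exact neg_one_pow_eq_of_add_eq ((p + q) * (p' + 1) + p + p' + 2) (by ring)
        · rw [← mul_assoc, ← mul_assoc, ← pow_add, ← pow_add, mul_right_comm, ← pow_add,
            ← pow_add]
          congr 1
          exact neg_one_pow_eq_of_add_eq ((p + 1 + q) * (p' + 1) + p + p' + 2) (by ring)
      · simp

theorem homToList_shuffle (i j : ℕ × ℕ) (f : PolyForm A L' L'' i) (g : PolyForm A L' L'' j) :
    (-1 : ℤ) ^ ((i.1 + i.2) * j.1) • homToList (i + j) (shuffle A L' L'' i j (f ⊗ₜ g)) =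
      homToList i f * homToList j g := by
  apply ListForm.ext_eval; intro l
  obtain ⟨p, q⟩ := i
  obtain ⟨p', q'⟩ := j
  rw [homToList_mul_eval, ListForm.zsmul_eval, homToList_eval]
  simp only [Prod.mk_add_mk]
  split_ifs
  · rw [smul_smul]
    congr 1
    change wedgeMap A L' q q' (AlternatingMap.domCoprod f g _) = _
    congr 2
    funext x
    rcases x with x | x
    · simp [listArgs]
    · simp [listArgs]
  · simp

end PolyList

instance {R A M Λ : Type*} [CommRing R] [CommRing A] [Algebra R A] [Ring Λ] [Module R Λ]
    [Module A Λ] [IsScalarTower R A Λ] {σ : Λ →+* Λ} : IsScalarTower R A (ListForm M σ) :=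
  ⟨fun r a F => ListForm.ext_eval fun l => smul_assoc r a (F.eval l)⟩

/-! ### The ring of forms -/

/-- The bigraded module of forms, as a type on which the product of forms is the multiplication. -/
def PolyAlg (R A L' L'' : Type*) [CommRing R] [CommRing A] [Algebra R A]
    [AddCommGroup L'] [Module R L'] [Module A L'] [IsScalarTower R A L']
    [AddCommGroup L''] [Module R L''] [Module A L''] [IsScalarTower R A L''] : Type _ :=
  PolyForms A L' L''

section PolyAlg

variable (R A L' L'' : Type*) [CommRing R] [CommRing A] [Algebra R A]
  [AddCommGroup L'] [Module R L'] [Module A L'] [IsScalarTower R A L']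
  [AddCommGroup L''] [Module R L''] [Module A L''] [IsScalarTower R A L'']

/-- The direct sum of a family of groups, with the group structure found from that of the
summands. -/
abbrev GroupSum (V : ℕ × ℕ → Type*) [∀ i, AddCommGroup (V i)] : Type _ := ⨁ i, V i

instance : AddCommGroup (PolyAlg R A L' L'') :=
  inferInstanceAs (AddCommGroup (GroupSum (PolyForm A L' L'')))

instance : Module R (PolyAlg R A L' L'') :=
  inferInstanceAs (Module R (GroupSum (PolyForm A L' L'')))

namespace PolyAlg

variable {A L' L''}

/-- The inclusion of the forms of bidegree `i`. -/
def of (i : ℕ × ℕ) : PolyForm A L' L'' i →ₗ[R] PolyAlg R A L' L'' :=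
  DirectSum.lof R (ℕ × ℕ) (PolyForm A L' L'') i

variable {R}

/-- A linear map on the forms, from its homogeneous components. -/
def lift {N : Type*} [AddCommGroup N] [Module R N] (F : ∀ i, PolyForm A L' L'' i →ₗ[R] N) :
    PolyAlg R A L' L'' →ₗ[R] N :=
  DirectSum.toModule R (ℕ × ℕ) N F

@[simp] theorem lift_of {N : Type*} [AddCommGroup N] [Module R N]
    (F : ∀ i, PolyForm A L' L'' i →ₗ[R] N) (i : ℕ × ℕ) (f : PolyForm A L' L'' i) :
    lift F (of R i f) = F i f :=
  DirectSum.toModule_lof (M := PolyForm A L' L'') R i f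

theorem induction_of {P : PolyAlg R A L' L'' → Prop} (x : PolyAlg R A L' L'') (zero : P 0)
    (of : ∀ i (f : PolyForm A L' L'' i), P (of R i f))
    (add : ∀ x y, P x → P y → P (x + y)) : P x :=
  DirectSum.induction_on (β := PolyForm A L' L'') (motive := P) x zero of add

/-- The `(p, q)`-component of a form. -/
def component (i : ℕ × ℕ) (x : PolyAlg R A L' L'') : PolyForm A L' L'' i :=
  (show GroupSum (PolyForm A L' L'') from x) i

theorem component_add (i : ℕ × ℕ) (x y : PolyAlg R A L' L'') :
    component i (x + y) = component i x + component i y := rfl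

theorem component_zero (i : ℕ × ℕ) : component i (0 : PolyAlg R A L' L'') = 0 := rfl

theorem component_of_same (i : ℕ × ℕ) (f : PolyForm A L' L'' i) :
    component i (of R i f) = f :=
  DirectSum.of_eq_same (β := PolyForm A L' L'') i f

theorem component_of_ne {i j : ℕ × ℕ} (h : i ≠ j) (f : PolyForm A L' L'' j) :
    component i (of R j f) = 0 :=
  DirectSum.of_eq_of_ne (β := PolyForm A L' L'') _ _ _ h

theorem ext_component {x y : PolyAlg R A L' L''} (h : ∀ i, component i x = component i y) : x = y :=
  DFinsupp.ext h

variable (R A L' L'') in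
/-- The homogeneous forms. -/
def hom (p q : ℕ) : Submodule R (PolyAlg R A L' L'') := LinearMap.range (of R (p, q))

theorem of_mem {p q : ℕ} (f : PolyForm A L' L'' (p, q)) : of R (p, q) f ∈ hom R A L' L'' p q :=
  ⟨f, rfl⟩

theorem induction_hom {P : PolyAlg R A L' L'' → Prop} (x : PolyAlg R A L' L'') (zero : P 0)
    (hom : ∀ p q, ∀ x ∈ hom R A L' L'' p q, P x)
    (add : ∀ x y, P x → P y → P (x + y)) : P x :=
  induction_of x zero (fun i f => hom i.1 i.2 _ (of_mem f)) add

/-- The embedding of the forms into the functions on lists. -/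
def toList : PolyAlg R A L' L'' →ₗ[R] PolyList A L' L'' :=
  lift fun i => (homToList i).restrictScalars R

theorem toList_of (i : ℕ × ℕ) (f : PolyForm A L' L'' i) :
    toList (of R i f) = homToList i f := by
  rw [toList, lift_of]; rfl

/-- Lists of length `p` see only the components of form degree `p`, and the projection of the
exterior algebra separates the degrees `q`. Hence every component of `x` can be recovered from
`toList x`. -/
theorem proj_toList (p q : ℕ) (v : Fin p → L'') (x : PolyAlg R A L' L'') :
    GradedAlgebra.proj (fun n : ℕ => ⋀[A]^n L') q ((toList x).eval (List.ofFn v)) =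
      reversalSign p • ((component (p, q) x v : ⋀[A]^q L') : ExteriorAlgebra A L') := by
  induction x using induction_of with
  | zero =>
    rw [map_zero, ListForm.zero_eval, map_zero, component_zero, AlternatingMap.zero_apply,
      Submodule.coe_zero, smul_zero]
  | add x y hx hy =>
    rw [map_add, ListForm.add_eval, map_add, hx, hy, component_add,
      AlternatingMap.add_apply, Submodule.coe_add, smul_add]
  | of i f =>
    obtain ⟨p', q'⟩ := i
    rw [toList_of, homToList_eval, List.length_ofFn]
    dsimp only
    by_cases hp : p = p'
    · subst hp
      rw [if_pos rfl, map_zsmul, GradedAlgebra.proj_apply]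
      have hv : (fun k : Fin p => (List.ofFn v).getD (k : ℕ) 0) = v := by
        funext k; simp
      rw [hv]
      by_cases hq : q = q'
      · subst hq
        rw [DirectSum.decompose_coe, DirectSum.of_eq_same, component_of_same]
      · rw [DirectSum.decompose_coe, DirectSum.of_eq_of_ne _ _ _ hq,
          component_of_ne (by simp [hq])]
        rfl
    · rw [if_neg hp, map_zero, component_of_ne (by simp [hp])]
      simp

theorem toList_injective : Function.Injective (toList : PolyAlg R A L' L'' → PolyList A L' L'') := by
  rw [injective_iff_map_eq_zero]
  intro x hx
  apply ext_component
  rintro ⟨p, q⟩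
  apply AlternatingMap.ext
  intro v
  have h := proj_toList p q v x
  rw [hx, ListForm.zero_eval, map_zero] at h
  -- The reversal sign is its own inverse.
  have h2 := congrArg (fun u => reversalSign p • u) h
  simp only [smul_zero, smul_smul, reversalSign_mul_self, one_smul] at h2
  exact Subtype.ext h2.symm

variable (R A L' L'') in
/-- The product of forms. -/
def mulHom : PolyAlg R A L' L'' →ₗ[R] PolyAlg R A L' L'' →ₗ[R] PolyAlg R A L' L'' := polyMul R A L' L''

theorem mulHom_of (i j : ℕ × ℕ) (f : PolyForm A L' L'' i) (g : PolyForm A L' L'' j) :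
    mulHom R A L' L'' (of R i f) (of R j g) =
      (-1 : ℤ) ^ ((i.1 + i.2) * j.1) • of R (i + j) (shuffle A L' L'' i j (f ⊗ₜ g)) := by
  change polyMul R A L' L'' (DirectSum.lof R _ _ i f) (DirectSum.lof R _ _ j g) = _
  rw [polyMul, DirectSum.toModule_lof, LinearMap.flip_apply, DirectSum.toModule_lof,
    LinearMap.flip_apply]
  rfl

theorem toList_mulHom (x y : PolyAlg R A L' L'') :
    toList (mulHom R A L' L'' x y) = toList x * toList y := by
  induction x using induction_of with
  | zero => simp
  | add x x' hx hx' => simp only [map_add, LinearMap.add_apply, hx, hx', add_mul]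
  | of i f =>
    induction y using induction_of with
    | zero => simp
    | add y y' hy hy' => simp only [map_add, hy, hy', mul_add]
    | of j g => rw [mulHom_of, map_zsmul, toList_of, toList_of, toList_of, homToList_shuffle]

instance : Mul (PolyAlg R A L' L'') := ⟨fun x y => mulHom R A L' L'' x y⟩

instance : One (PolyAlg R A L' L'') := ⟨polyOne R A L' L''⟩

theorem toList_mul (x y : PolyAlg R A L' L'') : toList (x * y) = toList x * toList y :=
  toList_mulHom x y

theorem toList_one : toList (1 : PolyAlg R A L' L'') = 1 := by
  change toList (of R (0, 0) ((exteriorPower.zeroEquiv A L').symm.toLinearMap.compAlternatingMap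
    (AlternatingMap.constOfIsEmpty A L'' (Fin 0) (1 : A)))) = 1
  rw [toList_of]
  apply ListForm.ext_contr
  · rw [homToList_nil_zero, ListForm.one_nil]
    simp only [LinearMap.compAlternatingMap_apply, AlternatingMap.constOfIsEmpty_apply]
    simp [exteriorPower.zeroEquiv_symm_apply]
  · intro ξ
    rw [contr_homToList_zero, ListForm.contr_one]

/-- Associativity and the unit laws are pulled back along the injective map `toList`; the other
axioms are bilinearity. -/
instance : Ring (PolyAlg R A L' L'') where
  __ := (inferInstance : AddCommGroup (PolyAlg R A L' L''))
  left_distrib x y z := map_add (mulHom R A L' L'' x) y z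
  right_distrib x y z := LinearMap.map_add₂ (mulHom R A L' L'') x y z
  zero_mul x := LinearMap.map_zero₂ (mulHom R A L' L'') x
  mul_zero x := map_zero (mulHom R A L' L'' x)
  mul_assoc x y z := toList_injective (by simp only [toList_mul, mul_assoc])
  one_mul x := toList_injective (by simp only [toList_mul, toList_one, one_mul])
  mul_one x := toList_injective (by simp only [toList_mul, toList_one, mul_one])

theorem smul_mul (r : R) (x y : PolyAlg R A L' L'') : r • x * y = r • (x * y) :=
  LinearMap.map_smul₂ (mulHom R A L' L'') r x y

theorem mul_smul' (r : R) (x y : PolyAlg R A L' L'') : x * r • y = r • (x * y) :=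
  map_smul (mulHom R A L' L'' x) r y

theorem isForm_toList {p q : ℕ} {x : PolyAlg R A L' L''} (hx : x ∈ hom R A L' L'' p q) :
    ListForm.IsForm (⋀[A]^q L') p (toList x) := by
  obtain ⟨f, rfl⟩ := hx
  rw [toList_of]
  exact isForm_homToList p q f

theorem one_mem : (1 : PolyAlg R A L' L'') ∈ hom R A L' L'' 0 0 := ⟨_, rfl⟩

theorem mul_mem {p q p' q' : ℕ} {x y : PolyAlg R A L' L''} (hx : x ∈ hom R A L' L'' p q)
    (hy : y ∈ hom R A L' L'' p' q') : x * y ∈ hom R A L' L'' (p + p') (q + q') := by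
  obtain ⟨f, rfl⟩ := hx
  obtain ⟨g, rfl⟩ := hy
  change mulHom R A L' L'' _ _ ∈ _
  rw [mulHom_of]
  exact zsmul_mem (of_mem _) _

theorem mul_comm_of_mem {p q p' q' : ℕ} {x y : PolyAlg R A L' L''} (hx : x ∈ hom R A L' L'' p q)
    (hy : y ∈ hom R A L' L'' p' q') : x * y = (-1 : ℤ) ^ ((p + q) * (p' + q')) • (y * x) := by
  apply toList_injective
  rw [map_zsmul, toList_mul, toList_mul]
  exact (isForm_toList hx).mul_comm (isForm_toList hy)
    (fun u hu => gradeInvolution_of_mem hu) (fun u hu => gradeInvolution_of_mem hu)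
    (fun u hu w hw => exteriorAlgebra_mul_comm hu hw)

end PolyAlg

theorem isBigradedCommAlgebra_polyForms :
    IsBigradedCommAlgebra (PolyForm A L' L'') (polyMul R A L' L'') (polyOne R A L' L'') where
  one_mem := PolyAlg.one_mem
  mul_mem := PolyAlg.mul_mem
  one_mul := one_mul (M := PolyAlg R A L' L'')
  mul_assoc := mul_assoc (G := PolyAlg R A L' L'')
  mul_comm := PolyAlg.mul_comm_of_mem

end PolyAlg

/-! ### Contractions and derivations of the exterior algebra -/

section ExteriorOperators

variable {R A N : Type*} [CommRing R] [CommRing A] [Algebra R A]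
  [AddCommGroup N] [Module R N] [Module A N] [IsScalarTower R A N]

/-- The contraction of the exterior algebra with a linear form. -/
def exteriorContraction (θ : N →ₗ[A] A) : ExteriorAlgebra A N →ₗ[A] ExteriorAlgebra A N :=
  CliffordAlgebra.contractLeft θ

theorem exteriorContraction_ι_mul (θ : N →ₗ[A] A) (n : N) (u : ExteriorAlgebra A N) :
    exteriorContraction θ (ExteriorAlgebra.ι A n * u) =
      θ n • u - ExteriorAlgebra.ι A n * exteriorContraction θ u :=
  CliffordAlgebra.contractLeft_ι_mul θ n u

theorem exteriorContraction_ι (θ : N →ₗ[A] A) (n : N) :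
    exteriorContraction θ (ExteriorAlgebra.ι A n) = algebraMap A _ (θ n) :=
  CliffordAlgebra.contractLeft_ι _ θ n

theorem exteriorContraction_algebraMap (θ : N →ₗ[A] A) (a : A) :
    exteriorContraction θ (algebraMap A _ a) = 0 :=
  CliffordAlgebra.contractLeft_algebraMap _ θ a

theorem exteriorContraction_mul (θ : N →ₗ[A] A) (u v : ExteriorAlgebra A N) :
    exteriorContraction θ (u * v) =
      exteriorContraction θ u * v + gradeInvolution A N u * exteriorContraction θ v := by
  induction u using ExteriorAlgebra.induction generalizing v with
  | algebraMap a =>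
    rw [← Algebra.smul_def, map_smul, exteriorContraction_algebraMap, zero_mul, zero_add,
      AlgHom.commutes, ← Algebra.smul_def]
  | ι n =>
    rw [exteriorContraction_ι_mul, exteriorContraction_ι, gradeInvolution_ι, neg_mul,
      ← sub_eq_add_neg, ← Algebra.smul_def]
  | mul u w hu hw =>
    rw [mul_assoc, hu, hw, hu, map_mul, mul_add, add_mul, ← mul_assoc, ← mul_assoc, ← mul_assoc,
      add_assoc]
  | add u w hu hw => rw [add_mul, map_add, map_add, map_add, hu, hw, add_mul, add_mul]; abel

theorem gradeInvolution_exteriorContraction (θ : N →ₗ[A] A) (u : ExteriorAlgebra A N) :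
    gradeInvolution A N (exteriorContraction θ u) =
      -exteriorContraction θ (gradeInvolution A N u) := by
  induction u using ExteriorAlgebra.induction with
  | algebraMap a => simp [exteriorContraction_algebraMap]
  | ι n => simp [exteriorContraction_ι, gradeInvolution_ι]
  | mul u w hu hw =>
    simp only [exteriorContraction_mul, map_add, map_mul, hu, hw, neg_mul, mul_neg, neg_add]
  | add u w hu hw => simp only [map_add, hu, hw, neg_add]

theorem exteriorContraction_mem (θ : N →ₗ[A] A) {q : ℕ} {u : ExteriorAlgebra A N}
    (hu : u ∈ ⋀[A]^(q + 1) N) : exteriorContraction θ u ∈ ⋀[A]^q N := by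
  -- The induction passes through all degrees, including degree zero, which has no predecessor;
  -- there the contraction vanishes instead of lowering the degree.
  suffices h : ∀ (k : ℕ) (u : ExteriorAlgebra A N), u ∈ ⋀[A]^k N →
      (k = 0 ∧ exteriorContraction θ u = 0) ∨
        ∃ j, k = j + 1 ∧ exteriorContraction θ u ∈ ⋀[A]^j N by
    rcases h _ u hu with ⟨h1, _⟩ | ⟨j, h1, h2⟩
    · omega
    · rwa [Nat.add_right_cancel h1]
  intro k u hu
  induction hu using Submodule.pow_induction_on_left' with
  | algebraMap a => exact Or.inl ⟨rfl, exteriorContraction_algebraMap θ a⟩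
  | add u v i hu hv h1 h2 =>
    rw [map_add]
    rcases h1 with ⟨h1, h1'⟩ | ⟨j, h1, h1'⟩ <;> rcases h2 with ⟨h2, h2'⟩ | ⟨j', h2, h2'⟩
    · exact Or.inl ⟨h1, by rw [h1', h2', add_zero]⟩
    · omega
    · omega
    · obtain rfl : j = j' := by omega
      exact Or.inr ⟨j, h1, add_mem h1' h2'⟩
  | mem_mul m hm i u hu h =>
    obtain ⟨n, rfl⟩ := hm
    refine Or.inr ⟨i, rfl, ?_⟩
    rw [exteriorContraction_ι_mul]
    refine sub_mem (Submodule.smul_mem _ _ hu) ?_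
    rcases h with ⟨_, h⟩ | ⟨j, rfl, h⟩
    · rw [h, mul_zero]; exact zero_mem _
    · rw [ExteriorAlgebra.exteriorPower, pow_succ']
      exact Submodule.mul_mem_mul ⟨n, rfl⟩ h

theorem exteriorContraction_of_mem_zero (θ : N →ₗ[A] A) {u : ExteriorAlgebra A N}
    (hu : u ∈ ⋀[A]^0 N) : exteriorContraction θ u = 0 := by
  rw [ExteriorAlgebra.exteriorPower, pow_zero, Submodule.mem_one] at hu
  obtain ⟨a, rfl⟩ := hu
  exact exteriorContraction_algebraMap θ a

/-- The contraction with a linear form, between exterior powers. -/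
def exteriorPowerContraction (θ : N →ₗ[A] A) (q : ℕ) : ⋀[A]^(q + 1) N →ₗ[A] ⋀[A]^q N :=
  (exteriorContraction θ).restrict fun _ hu => exteriorContraction_mem θ hu

/-- The derivation of the exterior algebra, as an additive map. -/
def exteriorDerivationHom (δ : Derivation R A A) (E : N →ₗ[R] N)
    (hE : ∀ (a : A) (n : N), E (a • n) = δ a • n + a • E n) :
    ExteriorAlgebra A N →+ ExteriorAlgebra A N where
  toFun := exteriorDerivation δ E hE
  map_add' := exteriorDerivation_add δ E hE
  map_zero' := by
    have := exteriorDerivation_add δ E hE 0 0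
    rw [add_zero] at this
    exact left_eq_add.mp this

section

variable (δ : Derivation R A A) (E : N →ₗ[R] N)
    (hE : ∀ (a : A) (n : N), E (a • n) = δ a • n + a • E n)

theorem exteriorDerivationHom_algebraMap (a : A) :
    exteriorDerivationHom δ E hE (algebraMap A _ a) = algebraMap A _ (δ a) :=
  exteriorDerivation_algebraMap δ E hE a

theorem exteriorDerivationHom_ι (n : N) :
    exteriorDerivationHom δ E hE (ExteriorAlgebra.ι A n) = ExteriorAlgebra.ι A (E n) :=
  exteriorDerivation_ι δ E hE n

theorem exteriorDerivationHom_mul (u v : ExteriorAlgebra A N) :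
    exteriorDerivationHom δ E hE (u * v) =
      exteriorDerivationHom δ E hE u * v + u * exteriorDerivationHom δ E hE v :=
  (exteriorDerivation_mul δ E hE u v).trans (add_comm _ _)

theorem gradeInvolution_exteriorDerivationHom (u : ExteriorAlgebra A N) :
    gradeInvolution A N (exteriorDerivationHom δ E hE u) =
      exteriorDerivationHom δ E hE (gradeInvolution A N u) := by
  induction u using ExteriorAlgebra.induction with
  | algebraMap a => simp [exteriorDerivationHom_algebraMap]
  | ι n => simp [exteriorDerivationHom_ι, gradeInvolution_ι]
  | mul u w hu hw => simp only [exteriorDerivationHom_mul, map_add, map_mul, hu, hw]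
  | add u w hu hw => simp only [map_add, hu, hw]

/-- The derivation of the exterior algebra, on an exterior power. -/
def exteriorPowerDerivation (q : ℕ) : ⋀[A]^q N →ₗ[R] ⋀[A]^q N where
  toFun u := ⟨exteriorDerivation δ E hE u, exteriorDerivation_mem _ _ _ u.2⟩
  map_add' u v := Subtype.ext (exteriorDerivation_add _ _ _ _ _)
  map_smul' r u := Subtype.ext <| by
    change exteriorDerivation _ _ _ (r • (u : ExteriorAlgebra A N)) =
      r • exteriorDerivation _ _ _ _
    rw [← algebraMap_smul A r, exteriorDerivation_smul]
    simp

theorem exteriorPowerDerivation_smul (q : ℕ) (a : A) (u : ⋀[A]^q N) :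
    exteriorPowerDerivation δ E hE q (a • u) = δ a • u + a • exteriorPowerDerivation δ E hE q u :=
  Subtype.ext (exteriorDerivation_smul _ _ _ _ _)

theorem coe_exteriorPowerDerivation (q : ℕ) (u : ⋀[A]^q N) :
    (exteriorPowerDerivation δ E hE q u : ExteriorAlgebra A N) = exteriorDerivationHom δ E hE u :=
  rfl

end

/-- Both sides are derivations of the exterior algebra, so it is enough to compare them on `A` and
on `N`. -/
theorem exteriorDerivationHom_commutator {δ₁ δ₂ δ₃ : Derivation R A A} {E₁ E₂ E₃ : N →ₗ[R] N}
    (h₁ : ∀ (a : A) (n : N), E₁ (a • n) = δ₁ a • n + a • E₁ n)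
    (h₂ : ∀ (a : A) (n : N), E₂ (a • n) = δ₂ a • n + a • E₂ n)
    (h₃ : ∀ (a : A) (n : N), E₃ (a • n) = δ₃ a • n + a • E₃ n)
    (hδ : ∀ a, δ₁ (δ₂ a) - δ₂ (δ₁ a) = δ₃ a) (hE : ∀ n, E₁ (E₂ n) - E₂ (E₁ n) = E₃ n)
    (u : ExteriorAlgebra A N) :
    exteriorDerivationHom δ₁ E₁ h₁ (exteriorDerivationHom δ₂ E₂ h₂ u) -
      exteriorDerivationHom δ₂ E₂ h₂ (exteriorDerivationHom δ₁ E₁ h₁ u) =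
        exteriorDerivationHom δ₃ E₃ h₃ u := by
  induction u using ExteriorAlgebra.induction with
  | algebraMap a => simp only [exteriorDerivationHom_algebraMap, ← map_sub, hδ]
  | ι n => simp only [exteriorDerivationHom_ι, ← map_sub, hE]
  | mul u v hu hv => simp only [exteriorDerivationHom_mul, map_add, ← hu, ← hv]; noncomm_ring
  | add u v hu hv => simp only [map_add, ← hu, ← hv]; abel

end ExteriorOperators

/-- Contractions of forms and induced derivations. -/
theorem formDerivation_curryLeft {R A M N : Type*} [CommRing R] [CommRing A] [Algebra R A]
    [AddCommGroup M] [Module R M] [Module A M] [IsScalarTower R A M]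
    [AddCommGroup N] [Module R N] [Module A N] [IsScalarTower R A N]
    (δ : Derivation R A A) (D : M →ₗ[R] M) (E : N →ₗ[R] N)
    (hD : ∀ (a : A) (ξ : M), D (a • ξ) = δ a • ξ + a • D ξ)
    (hE : ∀ (a : A) (x : N), E (a • x) = δ a • x + a • E x) {p : ℕ}
    (f : M [⋀^Fin (p + 1)]→ₗ[A] N) (ξ : M) :
    (formDerivation δ D E hD hE f).curryLeft ξ =
      formDerivation δ D E hD hE (f.curryLeft ξ) - f.curryLeft (D ξ) := by
  ext v
  rw [AlternatingMap.curryLeft_apply_apply, formDerivation_apply, AlternatingMap.sub_apply,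
    formDerivation_apply, Fin.sum_univ_succ]
  simp only [Matrix.cons_val_zero, Matrix.cons_val_succ, AlternatingMap.curryLeft_apply_apply]
  have h1 : Function.update (Matrix.vecCons ξ v) 0 (D ξ) = Matrix.vecCons (D ξ) v := by
    funext i
    induction i using Fin.cases with
    | zero => simp
    | succ i => simp
  have h2 : ∀ k, Function.update (Matrix.vecCons ξ v) (Fin.succ k) (D (v k)) =
      Matrix.vecCons ξ (Function.update v k (D (v k))) := by
    intro k
    funext i
    induction i using Fin.cases with
    | zero => simp [Function.update_of_ne (Fin.succ_ne_zero k).symm]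
    | succ i =>
      by_cases hik : i = k
      · subst hik; simp
      · simp [Function.update_of_ne, hik]
  simp only [h1, h2]
  abel

/-! ### Parity, contractions, Lie derivatives and the differential on forms -/

namespace PolyAlg

variable {R A L' L'' : Type*} [CommRing R] [CommRing A] [Algebra R A]
  [AddCommGroup L'] [Module R L'] [Module A L'] [IsScalarTower R A L']
  [AddCommGroup L''] [Module R L''] [Module A L''] [IsScalarTower R A L'']

/-- The parity involution. -/
def parity : PolyAlg R A L' L'' →ₗ[R] PolyAlg R A L' L'' :=
  lift fun i => (-1 : ℤ) ^ (i.1 + i.2) • of R i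

theorem toList_parity (x : PolyAlg R A L' L'') : toList (parity x) = (toList x).parity := by
  induction x using induction_of with
  | zero => simp
  | add x y hx hy => simp only [map_add, hx, hy]
  | of i f =>
    rw [parity, lift_of, LinearMap.smul_apply, map_zsmul, toList_of, parity_homToList]

theorem parity_of_mem {p q : ℕ} {x : PolyAlg R A L' L''} (hx : x ∈ hom R A L' L'' p q) :
    parity x = (-1 : ℤ) ^ (p + q) • x := by
  obtain ⟨f, rfl⟩ := hx
  rw [parity, lift_of, LinearMap.smul_apply]

theorem parity_mul (x y : PolyAlg R A L' L'') : parity (x * y) = parity x * parity y :=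
  toList_injective (by simp only [toList_parity, toList_mul, ListForm.parity_mul])

theorem parity_parity (x : PolyAlg R A L' L'') : parity (parity x) = x :=
  toList_injective (by
    simp only [toList_parity]
    exact ListForm.parity_parity (fun u => gradeInvolution_gradeInvolution u) _)

/-- The contraction with a linear form on `L'`, on homogeneous forms. -/
def contractHom (θ : L' →ₗ[A] A) (p q : ℕ) :
    PolyForm A L' L'' (p, q + 1) →ₗ[R] PolyForm A L' L'' (p, q) where
  toFun f := (exteriorPowerContraction θ q).compAlternatingMap f
  map_add' f g := by ext v; simp
  map_smul' r f := AlternatingMap.ext fun v => by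
    simp only [LinearMap.compAlternatingMap_apply, AlternatingMap.smul_apply, RingHom.id_apply]
    rw [← algebraMap_smul A r, map_smul, algebraMap_smul]

/-- The contraction with a linear form on `L'`. -/
def contract (θ : L' →ₗ[A] A) : PolyAlg R A L' L'' →ₗ[R] PolyAlg R A L' L'' :=
  lift fun i => match i with
    | (_, 0) => 0
    -- The sign of moving an odd operator past `p` arguments; with it the contraction is an odd
    -- derivation for the total degree.
    | (p, q + 1) => (-1 : ℤ) ^ p • of R (p, q) ∘ₗ contractHom θ p q

theorem toList_contract (θ : L' →ₗ[A] A) (x : PolyAlg R A L' L'') :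
    toList (contract θ x) = (toList x).odd (exteriorContraction θ).toAddMonoidHom := by
  induction x using induction_of with
  | zero => simp
  | add x y hx hy => simp only [map_add, hx, hy]
  | of i f =>
    rw [contract, lift_of]
    obtain ⟨p, _ | q⟩ := i
    · rw [toList_of]
      apply ListForm.ext_eval; intro l
      rw [ListForm.odd_eval, homToList_eval]
      split_ifs
      · rw [map_zsmul]
        change _ = _ • _ • exteriorContraction θ _
        rw [exteriorContraction_of_mem_zero θ (Subtype.prop _)]
        simp
      · simp
    · simp only [LinearMap.smul_apply, LinearMap.comp_apply, map_zsmul, toList_of]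
      apply ListForm.ext_eval; intro l
      rw [ListForm.odd_eval, ListForm.zsmul_eval, homToList_eval, homToList_eval]
      split_ifs with h
      · rw [map_zsmul, h]; rfl
      · simp

theorem contract_mul (θ : L' →ₗ[A] A) (x y : PolyAlg R A L' L'') :
    contract θ (x * y) = contract θ x * y + parity x * contract θ y :=
  toList_injective (by
    simp only [toList_contract, toList_mul, toList_parity, map_add]
    exact ListForm.odd_mul (fun u => gradeInvolution_exteriorContraction θ u)
      (fun u v => exteriorContraction_mul θ u v) _ _)

theorem contract_mem (θ : L' →ₗ[A] A) {p q : ℕ} {x : PolyAlg R A L' L''}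
    (hx : x ∈ hom R A L' L'' p (q + 1)) : contract θ x ∈ hom R A L' L'' p q := by
  obtain ⟨f, rfl⟩ := hx
  rw [contract, lift_of]
  exact zsmul_mem (of_mem _) _

theorem contract_of_mem_zero (θ : L' →ₗ[A] A) {p : ℕ} {x : PolyAlg R A L' L''}
    (hx : x ∈ hom R A L' L'' p 0) : contract θ x = 0 := by
  obtain ⟨f, rfl⟩ := hx
  rw [contract, lift_of, LinearMap.zero_apply]

section LieDerivative

variable (δ : Derivation R A A) (D : L'' →ₗ[R] L'') (E : L' →ₗ[R] L')
    (hD : ∀ (a : A) (ξ : L''), D (a • ξ) = δ a • ξ + a • D ξ)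
    (hE : ∀ (a : A) (x : L'), E (a • x) = δ a • x + a • E x)

/-- The operator on homogeneous forms that is induced by derivations `D` of `L''` and `E` of `L'`,
over the same derivation of `A`. -/
def lieHom (i : ℕ × ℕ) : PolyForm A L' L'' i →ₗ[R] PolyForm A L' L'' i where
  toFun f := formDerivation δ D (exteriorPowerDerivation δ E hE i.2) hD
    (exteriorPowerDerivation_smul δ E hE i.2) f
  map_add' f g := by
    ext v
    simp only [formDerivation_apply, AlternatingMap.add_apply, map_add,
      Finset.sum_add_distrib, Submodule.coe_add, Submodule.coe_sub]
    abel
  map_smul' r f := by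
    ext v
    simp only [formDerivation_apply, AlternatingMap.smul_apply, map_smul, ← Finset.smul_sum,
      smul_sub, RingHom.id_apply]

theorem lieHom_apply (i : ℕ × ℕ) (f : PolyForm A L' L'' i) (v : Fin i.1 → L'') :
    lieHom δ D E hD hE i f v = exteriorPowerDerivation δ E hE i.2 (f v) -
      ∑ k, f (Function.update v k (D (v k))) := rfl

theorem lieHom_curryLeft (p q : ℕ) (f : PolyForm A L' L'' (p + 1, q)) (ξ : L'') :
    (lieHom δ D E hD hE (p + 1, q) f).curryLeft ξ =
      lieHom δ D E hD hE (p, q) (f.curryLeft ξ) - f.curryLeft (D ξ) :=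
  formDerivation_curryLeft δ D _ hD (exteriorPowerDerivation_smul δ E hE q) f ξ

/-- The operator on forms that is induced by derivations `D` of `L''` and `E` of `L'`, over the same
derivation of `A`. -/
def lieDerivative : PolyAlg R A L' L'' →ₗ[R] PolyAlg R A L' L'' :=
  lift fun i => of R i ∘ₗ lieHom δ D E hD hE i

theorem lieDerivative_of (i : ℕ × ℕ) (f : PolyForm A L' L'' i) :
    lieDerivative δ D E hD hE (of R i f) = of R i (lieHom δ D E hD hE i f) := by
  rw [lieDerivative, lift_of, LinearMap.comp_apply]

theorem toList_lieDerivative (x : PolyAlg R A L' L'') :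
    toList (lieDerivative δ D E hD hE x) = (toList x).lie (exteriorDerivationHom δ E hE) D := by
  induction x using induction_of with
  | zero => simp
  | add x y hx hy => simp only [map_add, hx, hy]
  | of i f =>
    obtain ⟨p, q⟩ := i
    rw [lieDerivative_of, toList_of, toList_of]
    apply ListForm.ext_eval; intro l
    induction l generalizing p with
    | nil =>
      rw [ListForm.lie_nil]
      cases p with
      | zero =>
        rw [homToList_nil_zero, homToList_nil_zero, lieHom_apply]
        simp only [Finset.univ_eq_empty, Finset.sum_empty, sub_zero]
        exact coe_exteriorPowerDerivation δ E hE q _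
      | succ p => rw [homToList_nil_succ, homToList_nil_succ, map_zero]
    | cons ξ l ih =>
      rw [ListForm.eval_cons, ListForm.eval_cons, ListForm.contr_lie]
      cases p with
      | zero =>
        simp only [contr_homToList_zero, map_zero, sub_zero]
      | succ p =>
        rw [contr_homToList_succ, contr_homToList_succ, contr_homToList_succ]
        refine (congrArg (fun g => ((-1 : ℤ) ^ (p + 1) • homToList (p, q) g).eval l)
          (lieHom_curryLeft δ D E hD hE p q f ξ)).trans ?_
        refine (congrArg (fun F : PolyList A L' L'' => ((-1 : ℤ) ^ (p + 1) • F).eval l)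
          (map_sub (homToList (p, q)) (lieHom δ D E hD hE (p, q) (f.curryLeft ξ))
            (f.curryLeft (D ξ)))).trans ?_
        simp only [map_sub, map_zsmul, ListForm.sub_eval, ListForm.zsmul_eval, ih, smul_sub]

theorem lieDerivative_mul (x y : PolyAlg R A L' L'') : lieDerivative δ D E hD hE (x * y) =
    lieDerivative δ D E hD hE x * y + x * lieDerivative δ D E hD hE y :=
  toList_injective (by
    simp only [toList_lieDerivative, toList_mul, map_add]
    exact ListForm.lie_mul (fun u => gradeInvolution_exteriorDerivationHom δ E hE u)
      (exteriorDerivationHom_mul δ E hE) _ _ _)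

theorem lieDerivative_mem {p q : ℕ} {x : PolyAlg R A L' L''} (hx : x ∈ hom R A L' L'' p q) :
    lieDerivative δ D E hD hE x ∈ hom R A L' L'' p q := by
  obtain ⟨f, rfl⟩ := hx
  rw [lieDerivative_of]
  exact of_mem _

end LieDerivative

section Differential

variable (S : AlmostTwilledPre R A L' L'')

/-- The Lie-Rinehart operator for `L''`. -/
def differential : PolyAlg R A L' L'' →ₗ[R] PolyAlg R A L' L'' := S.dBar

theorem differential_of (i : ℕ × ℕ) (f : PolyForm A L' L'' i) : differential S (of R i f) =
    of R (i.1 + 1, i.2) (lieRinehartDifferential (S.conn''.exteriorPower i.2) i.1 f) := by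
  change S.dBar (DirectSum.lof R (ℕ × ℕ) (PolyForm A L' L'') i f) = _
  rw [AlmostTwilledPre.dBar, DirectSum.toModule_lof]
  rfl

theorem differential_mem {p q : ℕ} {x : PolyAlg R A L' L''} (hx : x ∈ hom R A L' L'' p q) :
    differential S x ∈ hom R A L' L'' (p + 1) q := by
  obtain ⟨f, rfl⟩ := hx
  rw [differential_of]
  exact of_mem _

/-- The action of `ξ ∈ L''` on the exterior algebra of `L'`. -/
abbrev exteriorAct (ξ : L'') : ExteriorAlgebra A L' →+ ExteriorAlgebra A L' :=
  exteriorDerivationHom (S.pre''.anchor ξ) (S.conn''.act ξ) (S.conn''.act_smul ξ)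

/-- The relation `ceSum_cons` is Cartan's formula for the explicit expression, so both sides satisfy
the same recursion. The overall sign of the operator is compensated by the change of the reversal
sign from `p` to `p + 1`. -/
theorem homToList_lieRinehartDifferential (p q : ℕ) (f : PolyForm A L' L'' (p, q)) :
    homToList (p + 1, q) (lieRinehartDifferential (S.conn''.exteriorPower q) p f) =
      (homToList (p, q) f).ce (exteriorAct S) fun ξ η => S.pre''.bracket ξ η := by
  apply ListForm.ext_eval; intro l
  induction l generalizing p with
  | nil => rw [homToList_nil_succ, ListForm.ce_nil]
  | cons ξ l ih =>
    rw [ListForm.eval_cons, ListForm.eval_cons, ListForm.contr_ce, contr_homToList_succ]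
    have hlie := toList_lieDerivative (S.pre''.anchor ξ) (S.pre''.bracket ξ) (S.conn''.act ξ)
      (S.pre''.bracket_smul ξ) (S.conn''.act_smul ξ) (of R (p, q) f)
    rw [lieDerivative_of, toList_of, toList_of] at hlie
    rw [← hlie]
    cases p with
    | zero =>
      rw [contr_homToList_zero, map_zero, sub_zero, show (-1 : ℤ) ^ (0 + 1) = -1 from rfl, neg_smul,
        one_smul, ListForm.neg_eval, homToList_eval, homToList_eval]
      dsimp only
      split_ifs with hl
      · obtain rfl := List.length_eq_zero_iff.mp hl
        simp only [reversalSign, one_smul]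
        rw [lieHom_apply, AlternatingMap.curryLeft_apply_apply]
        change -(((-1 : ℤ) ^ (0 + 1) • (ceSum (S.conn''.exteriorPower q) f _) : ⋀[A]^q L') :
          ExteriorAlgebra A L') = _
        rw [ceSum_zero]
        simp only [Finset.univ_eq_empty, Finset.sum_empty, sub_zero, zero_add, pow_one, neg_smul,
          one_smul, neg_neg, Matrix.cons_val_zero, Submodule.coe_neg]
        rw [Subsingleton.elim (![] : Fin 0 → L'')]
        rfl
      · simp
    | succ p =>
      have h1 : (lieRinehartDifferential (S.conn''.exteriorPower q) (p + 1) f).curryLeft ξ =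
          (-1 : ℤ) ^ (p + 2) • lieHom (S.pre''.anchor ξ) (S.pre''.bracket ξ) (S.conn''.act ξ)
            (S.pre''.bracket_smul ξ) (S.conn''.act_smul ξ) (p + 1, q) f +
          lieRinehartDifferential (S.conn''.exteriorPower q) p (f.curryLeft ξ) := by
        apply AlternatingMap.ext
        intro v
        change (-1 : ℤ) ^ (p + 1 + 1) • ceSum (S.conn''.exteriorPower q) f (Matrix.vecCons ξ v) =
          (-1 : ℤ) ^ (p + 2) • lieHom _ _ _ _ (S.conn''.act_smul ξ) (p + 1, q) f v +
            (-1 : ℤ) ^ (p + 1) • ceSum (S.conn''.exteriorPower q) (f.curryLeft ξ) v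
        rw [ceSum_cons, smul_sub, pow_succ _ (p + 1), mul_neg_one, neg_smul, neg_smul, neg_smul,
          sub_neg_eq_add]
        rfl
      rw [h1, map_add, smul_add, map_zsmul, smul_smul, ← mul_pow, contr_homToList_succ,
        map_zsmul, ListForm.sub_eval, ListForm.add_eval, ListForm.zsmul_eval, ListForm.zsmul_eval,
        ListForm.zsmul_eval, ih]
      rw [show (-1 : ℤ) ^ (p + 1 + 1) = -(-1) ^ (p + 1) by rw [pow_succ, mul_neg_one], neg_smul,
        ← sub_eq_add_neg, show (-1 : ℤ) * -1 = 1 from rfl, one_pow, one_smul]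

theorem toList_differential (x : PolyAlg R A L' L'') : toList (differential S x) =
    (toList x).ce (exteriorAct S) fun ξ η => S.pre''.bracket ξ η := by
  induction x using induction_of with
  | zero => simp
  | add x y hx hy => simp only [map_add, hx, hy]
  | of i f =>
    obtain ⟨p, q⟩ := i
    rw [differential_of, toList_of, toList_of, homToList_lieRinehartDifferential]

theorem differential_mul (x y : PolyAlg R A L' L'') : differential S (x * y) =
    differential S x * y + parity x * differential S y :=
  toList_injective (by
    simp only [toList_differential, toList_mul, map_add, toList_parity]
    exact ListForm.ce_mul (fun u => gradeInvolution_gradeInvolution u)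
      (fun ξ u => gradeInvolution_exteriorDerivationHom _ _ _ u)
      (fun ξ => exteriorDerivationHom_mul _ _ _) _ _)

/-- The commutator relations required by `ce_ce` are flatness and the anchor identity on the values,
and the Jacobi identity on the arguments. -/
theorem differential_differential (h : S.pre''.IsLieRinehart) (hS : S.conn''.IsFlat)
    (x : PolyAlg R A L' L'') : differential S (differential S x) = 0 := by
  induction x using induction_hom with
  | zero => simp
  | add x y hx hy => simp only [map_add, hx, hy, add_zero]
  | hom p q x hx =>
    apply toList_injective
    simp only [toList_differential, map_zero]
    refine (isForm_toList hx).ce_ce (fun ξ η u => ?_) (fun ξ η ζ => ?_)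
    · refine exteriorDerivationHom_commutator _ _ _ (fun a => ?_) (fun n => (hS ξ η n).symm) u
      rw [h.anchor_bracket, Derivation.commutator_apply]
    · rw [h.jacobi ξ η ζ, add_sub_cancel_right]

end Differential

end PolyAlg

/-! ### Dual bases and generators of the algebra of forms -/

/-- A finitely generated projective module has a finite dual basis. -/
theorem exists_dualBasis (A N : Type*) [CommRing A] [AddCommGroup N] [Module A N]
    [Module.Finite A N] [Module.Projective A N] :
    ∃ (n : ℕ) (e : Fin n → N) (θ : Fin n → N →ₗ[A] A), ∀ x, ∑ i, θ i x • e i = x := by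
  obtain ⟨n, f, g, -, -, h⟩ := Module.Finite.exists_comp_eq_id_of_projective A N
  refine ⟨n, fun i => f (Pi.single i 1), fun i => LinearMap.proj i ∘ₗ g, fun x => ?_⟩
  have h1 := LinearMap.congr_fun h x
  rw [LinearMap.comp_apply, LinearMap.id_apply] at h1
  conv_rhs => rw [← h1, pi_eq_sum_univ' (g x), map_sum]
  refine Finset.sum_congr rfl fun i _ => ?_
  rw [map_smul]
  simp

/-- A module with a finite dual basis is projective. -/
theorem projective_of_dualBasis {A N : Type*} [CommRing A] [AddCommGroup N] [Module A N]
    {ι : Type*} [Fintype ι] (e : ι → N) (θ : ι → N →ₗ[A] A) (h : ∀ x, ∑ i, θ i x • e i = x) :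
    Module.Finite A N ∧ Module.Projective A N := by
  have hc : Fintype.linearCombination A e ∘ₗ LinearMap.pi θ = LinearMap.id := by
    ext x
    simp [Fintype.linearCombination_apply, h]
  exact ⟨Module.Finite.of_surjective (Fintype.linearCombination A e) fun x =>
    ⟨LinearMap.pi θ x, LinearMap.congr_fun hc x⟩, Module.Projective.of_split _ _ hc⟩

/-- By functoriality a retraction of a finite free module onto `N` induces one of its exterior
power, which is free, onto that of `N`. -/
instance exteriorPower.projective (A N : Type*) [CommRing A] [AddCommGroup N] [Module A N]
    [Module.Finite A N] [Module.Projective A N] (q : ℕ) : Module.Projective A (⋀[A]^q N) := by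
  obtain ⟨n, f, g, -, -, h⟩ := Module.Finite.exists_comp_eq_id_of_projective A N
  refine Module.Projective.of_split (exteriorPower.map q g) (exteriorPower.map q f) ?_
  rw [← exteriorPower.map_comp, h, exteriorPower.map_id]

/-- Products with functions on lists that are concentrated on the empty list. -/
theorem ListForm.mul_eval_of_contr_eq_zero {M Λ : Type*} [Ring Λ] {σ : Λ →+* Λ}
    {F G : ListForm M σ} (hG : ∀ ξ, ListForm.contr ξ G = 0) (l : List M) :
    (F * G).eval l = F.eval l * G.eval [] := by
  induction l generalizing F with
  | nil => rfl
  | cons ξ l ih =>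
    rw [ListForm.eval_cons, ListForm.contr_mul, hG, mul_zero, add_zero, ih, ListForm.eval_cons]

namespace PolyAlg

variable {R A L' L'' : Type*} [CommRing R] [CommRing A] [Algebra R A]
  [AddCommGroup L'] [Module R L'] [Module A L'] [IsScalarTower R A L']
  [AddCommGroup L''] [Module R L''] [Module A L''] [IsScalarTower R A L'']

variable (R L'') in
/-- The elements of `L'`, as forms of bidegree `(0, 1)`. -/
def vec (x : L') : PolyAlg R A L' L'' := polyVector R A L'' x

variable (R L') in
/-- The `A`-valued forms, as forms of bidegree `(p, 0)`. -/
def scal {p : ℕ} (α : L'' [⋀^Fin p]→ₗ[A] A) : PolyAlg R A L' L'' := polyScalarForm R L' α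

theorem vec_mem (x : L') : vec R L'' x ∈ hom R A L' L'' 0 1 := of_mem (p := 0) (q := 1) _

theorem scal_mem {p : ℕ} (α : L'' [⋀^Fin p]→ₗ[A] A) : scal R L' α ∈ hom R A L' L'' p 0 :=
  of_mem (p := p) (q := 0) _

theorem toList_vec (x : L') : toList (vec R L'' x : PolyAlg R A L' L'') =
    homToList (0, 1) (AlternatingMap.constOfIsEmpty A L'' (Fin 0)
      ((exteriorPower.oneEquiv A L').symm x)) :=
  toList_of (R := R) (0, 1) _

theorem toList_vec_nil (x : L') :
    (toList (vec R L'' x : PolyAlg R A L' L'')).eval [] = ExteriorAlgebra.ι A x := by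
  rw [toList_vec, homToList_nil_zero, AlternatingMap.constOfIsEmpty_apply, Function.const_apply]
  have h := exteriorPower.oneEquiv_ιMulti (R := A) (M := L') (fun _ : Fin 1 => x)
  rw [(LinearEquiv.eq_symm_apply _).mpr h |>.symm, exteriorPower.ιMulti_apply_coe,
    ExteriorAlgebra.ιMulti_apply]
  simp

theorem contr_toList_vec (x : L') (ξ : L'') :
    ListForm.contr ξ (toList (vec R L'' x : PolyAlg R A L' L'')) = 0 := by
  rw [toList_vec, contr_homToList_zero]

theorem toList_scal {p : ℕ} (α : L'' [⋀^Fin p]→ₗ[A] A) :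
    toList (scal R L' α : PolyAlg R A L' L'') = homToList (p, 0)
      ((exteriorPower.zeroEquiv A L').symm.toLinearMap.compAlternatingMap α) :=
  toList_of (R := R) (p, 0) _

theorem coe_zeroEquiv_symm (a : A) :
    (((exteriorPower.zeroEquiv A L').symm a : ⋀[A]^0 L') : ExteriorAlgebra A L') =
      algebraMap A _ a := by
  rw [exteriorPower.zeroEquiv_symm_apply, Submodule.coe_smul, exteriorPower.ιMulti_apply_coe,
    ExteriorAlgebra.ιMulti_apply]
  simp [Algebra.smul_def]

theorem toList_scal_eval {p : ℕ} (α : L'' [⋀^Fin p]→ₗ[A] A) (l : List L'') :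
    (toList (scal R L' α : PolyAlg R A L' L'')).eval l = if l.length = p then
      reversalSign p • algebraMap A _ (α fun k => l.getD k 0) else 0 := by
  rw [toList_scal, homToList_eval, LinearMap.compAlternatingMap_apply]
  simp only [LinearEquiv.coe_coe, coe_zeroEquiv_symm]

theorem scal_zero_eval (α : L'' [⋀^Fin 0]→ₗ[A] A) :
    (toList (scal R L' α : PolyAlg R A L' L'')).eval [] = algebraMap A _ (α ![]) := by
  rw [toList_scal_eval]
  simp only [List.length_nil, if_true, reversalSign, one_smul]
  congr 2
  exact Subsingleton.elim _ _

variable (R L'') in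
/-- A form of bidegree `(0, q)`, from its value. -/
def const {q : ℕ} (u : ⋀[A]^q L') : PolyAlg R A L' L'' :=
  of R (0, q) (AlternatingMap.constOfIsEmpty A L'' (Fin 0) u)

theorem toList_const_nil {q : ℕ} (u : ⋀[A]^q L') :
    (toList (const R L'' u : PolyAlg R A L' L'')).eval [] = u := by
  rw [const, toList_of, homToList_nil_zero, AlternatingMap.constOfIsEmpty_apply, Function.const_apply]

theorem contr_toList_const {q : ℕ} (u : ⋀[A]^q L') (ξ : L'') :
    ListForm.contr ξ (toList (const R L'' u : PolyAlg R A L' L'')) = 0 := by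
  rw [const, toList_of, contr_homToList_zero]

theorem const_mem {q : ℕ} (u : ⋀[A]^q L') : const R L'' u ∈ hom R A L' L'' 0 q := of_mem _

/-- The values are expanded in a finite dual basis of the exterior power: the coefficients become
scalar forms, the basis elements become forms without arguments. This is how finiteness of `L'`
yields generators. -/
theorem of_eq_sum [Module.Finite A L'] [Module.Projective A L'] {p q n : ℕ} {u : Fin n → ⋀[A]^q L'}
    {θ : Fin n → (⋀[A]^q L') →ₗ[A] A} (h : ∀ x, ∑ i, θ i x • u i = x)
    (f : PolyForm A L' L'' (p, q)) : of R (p, q) f =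
      ∑ i, scal R L' ((θ i).compAlternatingMap f) * const R L'' (u i) := by
  apply toList_injective
  rw [map_sum, toList_of]
  apply ListForm.ext_eval; intro l
  rw [ListForm.sum_eval, homToList_eval]
  simp only [toList_mul, ListForm.mul_eval_of_contr_eq_zero (contr_toList_const _),
    toList_const_nil, toList_scal_eval]
  split_ifs with hl
  · simp only [smul_mul_assoc, ← Algebra.smul_def, ← Finset.smul_sum]
    congr 1
    conv_lhs => rw [← h (f _)]
    simp
  · simp

/-- Induction over the forms: they are generated by the scalar forms and the elements of `L'`. -/
theorem induction_generators [Module.Finite A L'] [Module.Projective A L']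
    {P : PolyAlg R A L' L'' → Prop} (x : PolyAlg R A L' L'') (zero : P 0)
    (add : ∀ x y, P x → P y → P (x + y))
    (mul : ∀ p q p' q', ∀ x ∈ hom R A L' L'' p q, ∀ y ∈ hom R A L' L'' p' q', P x → P y →
      P (x * y))
    (scal : ∀ (p : ℕ) (α : L'' [⋀^Fin p]→ₗ[A] A), P (scal R L' α))
    (vec : ∀ x : L', P (vec R L'' x)) : P x := by
  -- Forms without arguments are reached first: the exterior power is built up from `A` by sums and
  -- left multiplication with elements of `L'`.
  have hconst : ∀ (q : ℕ) (u : ExteriorAlgebra A L') (hu : u ∈ ⋀[A]^q L'),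
      P (const R L'' ⟨u, hu⟩) := by
    intro q u hu
    induction hu using Submodule.pow_induction_on_left' with
    | algebraMap a =>
      convert scal 0 (AlternatingMap.constOfIsEmpty A L'' (Fin 0) a) using 1
      apply toList_injective
      apply ListForm.ext_contr
      · rw [toList_const_nil, scal_zero_eval, AlternatingMap.constOfIsEmpty_apply, Function.const_apply]
      · intro ξ; rw [contr_toList_const, toList_scal, contr_homToList_zero]
    | add u v i hu hv h1 h2 =>
      convert add _ _ h1 h2 using 1
      apply toList_injective
      apply ListForm.ext_contr
      · rw [map_add, ListForm.add_eval, toList_const_nil, toList_const_nil, toList_const_nil]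
      · intro ξ
        rw [map_add, map_add, contr_toList_const, contr_toList_const, contr_toList_const, add_zero]
    | mem_mul m hm i u hu h =>
      obtain ⟨n, rfl⟩ := hm
      convert mul _ _ _ _ _ (vec_mem n) _ (const_mem _) (vec n) h using 1
      apply toList_injective
      apply ListForm.ext_contr
      · rw [toList_mul, ListForm.mul_nil, toList_const_nil, toList_const_nil, toList_vec_nil]
      · intro ξ
        rw [toList_mul, ListForm.contr_mul, contr_toList_const, contr_toList_const,
          contr_toList_vec, zero_mul, mul_zero, add_zero]
  induction x using induction_of with
  | zero => exact zero
  | add x y hx hy => exact add x y hx hy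
  | of i f =>
    obtain ⟨p, q⟩ := i
    obtain ⟨n, u, θ, h⟩ := exists_dualBasis A (⋀[A]^q L')
    rw [of_eq_sum h]
    exact Finset.sum_induction _ P add zero fun i _ =>
      mul _ _ _ _ _ (scal_mem _) _ (const_mem _) (scal _ _) (hconst _ _ _)

end PolyAlg

/-! ### Signs modulo two and induction over homogeneous generators -/

/-- The sign of a parity. -/
def paritySign (a : ZMod 2) : ℤ := if a = 0 then 1 else -1

@[simp] theorem paritySign_zero : paritySign 0 = 1 := rfl

@[simp] theorem paritySign_one : paritySign 1 = -1 := rfl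

theorem one_add_one_parity : (1 + 1 : ZMod 2) = 0 := rfl

theorem parity_eq_zero_or_one (a : ZMod 2) : a = 0 ∨ a = 1 := by
  revert a; decide

theorem paritySign_add (a b : ZMod 2) : paritySign (a + b) = paritySign a * paritySign b := by
  revert a b; decide

theorem paritySign_natCast (n : ℕ) : paritySign n = (-1) ^ n := by
  induction n with
  | zero => simp
  | succ n ih => rw [Nat.cast_succ, paritySign_add, ih, pow_succ, paritySign_one]

theorem paritySign_intCast (n : ℤ) : paritySign n = n.negOnePow := by
  obtain ⟨k, rfl | rfl⟩ := Int.even_or_odd' n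
  · rw [Int.negOnePow_two_mul]
    push_cast
    rw [show (2 : ZMod 2) = 0 from rfl, zero_mul, paritySign_zero]
  · rw [Int.negOnePow_two_mul_add_one]
    push_cast
    rw [show (2 : ZMod 2) = 0 from rfl, zero_mul, zero_add, paritySign_one]

namespace PolyAlg

variable {R A L' L'' : Type*} [CommRing R] [CommRing A] [Algebra R A]
  [AddCommGroup L'] [Module R L'] [Module A L'] [IsScalarTower R A L']
  [AddCommGroup L''] [Module R L''] [Module A L''] [IsScalarTower R A L'']

/-- The homogeneous elements whose total degree has the parity `a`. -/
def Deg (a : ZMod 2) (x : PolyAlg R A L' L'') : Prop :=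
  ∃ p q : ℕ, x ∈ hom R A L' L'' p q ∧ (p + q : ZMod 2) = a

theorem deg_of_mem {p q : ℕ} {x : PolyAlg R A L' L''} (hx : x ∈ hom R A L' L'' p q) :
    Deg (p + q : ZMod 2) x := ⟨p, q, hx, rfl⟩

theorem deg_zero (a : ZMod 2) : Deg a (0 : PolyAlg R A L' L'') := by
  rcases parity_eq_zero_or_one a with rfl | rfl
  · exact ⟨0, 0, zero_mem _, by simp⟩
  · exact ⟨0, 1, zero_mem _, by simp⟩

theorem deg_vec (x : L') : Deg 1 (vec R L'' x : PolyAlg R A L' L'') :=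
  ⟨0, 1, vec_mem x, by simp⟩

theorem deg_scal {p : ℕ} (α : L'' [⋀^Fin p]→ₗ[A] A) :
    Deg (p : ZMod 2) (scal R L' α : PolyAlg R A L' L'') :=
  ⟨p, 0, scal_mem α, by simp⟩

section

variable {a b c : ZMod 2} {x y z : PolyAlg R A L' L''}

theorem Deg.mul (hx : Deg a x) (hy : Deg b y) : Deg (a + b) (x * y) := by
  obtain ⟨p, q, hx, rfl⟩ := hx
  obtain ⟨p', q', hy, rfl⟩ := hy
  exact ⟨_, _, mul_mem hx hy, by push_cast; ring⟩

theorem Deg.mul_comm (hx : Deg a x) (hy : Deg b y) : x * y = paritySign (a * b) • (y * x) := by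
  obtain ⟨p, q, hx, rfl⟩ := hx
  obtain ⟨p', q', hy, rfl⟩ := hy
  rw [mul_comm_of_mem hx hy, ← paritySign_natCast]
  push_cast
  rfl

theorem Deg.parity_eq (hx : Deg a x) : parity x = paritySign a • x := by
  obtain ⟨p, q, hx, rfl⟩ := hx
  rw [parity_of_mem hx, ← paritySign_natCast]
  push_cast
  rfl

theorem Deg.parity (hx : Deg a x) : Deg a (parity x) := by
  obtain ⟨p, q, hx, rfl⟩ := hx
  rw [parity_of_mem hx]
  exact ⟨p, q, zsmul_mem hx _, rfl⟩

theorem Deg.contract (hx : Deg a x) (θ : L' →ₗ[A] A) : Deg (a + 1) (contract θ x) := by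
  obtain ⟨p, _ | q, hx, rfl⟩ := hx
  · rw [contract_of_mem_zero θ hx]
    exact deg_zero _
  · refine ⟨p, q, contract_mem θ hx, ?_⟩
    push_cast
    rw [add_assoc, add_assoc, one_add_one_parity, add_zero]

theorem Deg.lieDerivative (hx : Deg a x) (δ : Derivation R A A) (D : L'' →ₗ[R] L'')
    (E : L' →ₗ[R] L') (hD : ∀ (a : A) (ξ : L''), D (a • ξ) = δ a • ξ + a • D ξ)
    (hE : ∀ (a : A) (x : L'), E (a • x) = δ a • x + a • E x) :
    Deg a (lieDerivative δ D E hD hE x) := by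
  obtain ⟨p, q, hx, rfl⟩ := hx
  exact ⟨p, q, lieDerivative_mem δ D E hD hE hx, rfl⟩

theorem Deg.differential (hx : Deg a x) (S : AlmostTwilledPre R A L' L'') :
    Deg (a + 1) (differential S x) := by
  obtain ⟨p, q, hx, rfl⟩ := hx
  refine ⟨p + 1, q, differential_mem S hx, ?_⟩
  push_cast
  ring

/-- A property of the homogeneous forms that holds for the generators and is preserved under sums
and products. -/
theorem Deg.induction [Module.Finite A L'] [Module.Projective A L']
    {P : ZMod 2 → PolyAlg R A L' L'' → Prop} (zero : ∀ a, P a 0)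
    (add : ∀ a x y, Deg a x → Deg a y → P a x → P a y → P a (x + y))
    (mul : ∀ a b x y, Deg a x → Deg b y → P a x → P b y → P (a + b) (x * y))
    (scal : ∀ (p : ℕ) (α : L'' [⋀^Fin p]→ₗ[A] A), P p (scal R L' α))
    (vec : ∀ x : L', P 1 (vec R L'' x)) {a : ZMod 2} {x : PolyAlg R A L' L''} (hx : Deg a x) :
    P a x := by
  have hconst : ∀ (q : ℕ) (u : ExteriorAlgebra A L') (hu : u ∈ ⋀[A]^q L'),
      P q (const R L'' ⟨u, hu⟩) := by
    intro q u hu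
    induction hu using Submodule.pow_induction_on_left' with
    | algebraMap a =>
      convert scal 0 (AlternatingMap.constOfIsEmpty A L'' (Fin 0) a) using 1
      apply toList_injective
      apply ListForm.ext_contr
      · rw [toList_const_nil, scal_zero_eval, AlternatingMap.constOfIsEmpty_apply,
          Function.const_apply]
      · intro ξ; rw [contr_toList_const, toList_scal, contr_homToList_zero]
    | add u v i hu hv h1 h2 =>
      have hd : ∀ u : ⋀[A]^i L', Deg (i : ZMod 2) (const R L'' u : PolyAlg R A L' L'') :=
        fun u => ⟨0, i, const_mem _, by simp⟩
      convert add _ _ _ (hd _) (hd _) h1 h2 using 1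
      apply toList_injective
      apply ListForm.ext_contr
      · rw [map_add, ListForm.add_eval, toList_const_nil, toList_const_nil, toList_const_nil]
      · intro ξ
        rw [map_add, map_add, contr_toList_const, contr_toList_const, contr_toList_const, add_zero]
    | mem_mul m hm i u hu h =>
      obtain ⟨n, rfl⟩ := hm
      have hd : Deg (i : ZMod 2) (const R L'' ⟨u, hu⟩ : PolyAlg R A L' L'') :=
        ⟨0, i, const_mem _, by simp⟩
      convert mul _ _ _ _ (deg_vec n) hd (vec n) h using 1
      · rw [Nat.succ_eq_add_one, Nat.cast_succ, add_comm]
      apply toList_injective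
      apply ListForm.ext_contr
      · rw [toList_mul, ListForm.mul_nil, toList_const_nil, toList_const_nil, toList_vec_nil]
      · intro ξ
        rw [toList_mul, ListForm.contr_mul, contr_toList_const, contr_toList_const,
          contr_toList_vec, zero_mul, mul_zero, add_zero]
  obtain ⟨p, q, hx, rfl⟩ := hx
  obtain ⟨f, rfl⟩ := hx
  obtain ⟨n, u, θ, h⟩ := exists_dualBasis A (⋀[A]^q L')
  rw [of_eq_sum h]
  refine (Finset.sum_induction _ (fun y => y ∈ hom R A L' L'' p q ∧ P (p + q) y) ?_ ?_ ?_).2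
  · exact fun x y hx hy => ⟨add_mem hx.1 hy.1,
      add _ _ _ (deg_of_mem hx.1) (deg_of_mem hy.1) hx.2 hy.2⟩
  · exact ⟨zero_mem _, zero _⟩
  · intro i _
    refine ⟨?_, mul _ _ _ _ (deg_scal _) ⟨0, q, const_mem _, by simp⟩ (scal _ _) (hconst _ _ _)⟩
    have := mul_mem (scal_mem (R := R) (L' := L') ((θ i).compAlternatingMap f))
      (const_mem (R := R) (L'' := L'') (u i))
    simpa using this

/-- A symmetric property of pairs of homogeneous forms that holds for the generators and is
preserved under sums and products. -/
theorem Deg.induction_pair [Module.Finite A L'] [Module.Projective A L']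
    {P : ZMod 2 → ZMod 2 → PolyAlg R A L' L'' → PolyAlg R A L' L'' → Prop}
    (symm : ∀ a b x y, Deg a x → Deg b y → P a b x y → P b a y x) (zero : ∀ a b x, P a b x 0)
    (add : ∀ a b x y z, Deg a x → Deg b y → Deg b z → P a b x y → P a b x z → P a b x (y + z))
    (mul : ∀ a b c x y z, Deg a x → Deg b y → Deg c z → P a b x y → P a c x z →
      P a (b + c) x (y * z))
    (scal_scal : ∀ (p p' : ℕ) (α : L'' [⋀^Fin p]→ₗ[A] A) (β : L'' [⋀^Fin p']→ₗ[A] A),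
      P p p' (scal R L' α) (scal R L' β))
    (vec_scal : ∀ (x : L') (p : ℕ) (α : L'' [⋀^Fin p]→ₗ[A] A), P 1 p (vec R L'' x) (scal R L' α))
    (vec_vec : ∀ x y : L', P 1 1 (vec R L'' x) (vec R L'' y))
    (hx : Deg a x) (hy : Deg b y) : P a b x y := by
  -- For a fixed first argument, generators suffice in the second. Applied to a generator in the
  -- first place and turned around by symmetry, this supplies its own hypotheses for an arbitrary
  -- first argument.
  have key : ∀ a x, Deg a x → (∀ (p : ℕ) (α : L'' [⋀^Fin p]→ₗ[A] A), P a p x (scal R L' α)) →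
      (∀ y : L', P a 1 x (vec R L'' y)) → ∀ b y, Deg b y → P a b x y := by
    intro a x hx h1 h2 b y hy
    exact Deg.induction (P := fun b y => P a b x y) (fun b => zero a b x)
      (fun b y z hy hz => add a b x y z hx hy hz)
      (fun b c y z hy hz => mul a b c x y z hx hy hz) h1 h2 hy
  refine key a x hx (fun p α => ?_) (fun v => ?_) b y hy
  · exact symm _ _ _ _ (deg_scal α) hx (key _ _ (deg_scal α) (fun p' β => scal_scal p p' α β)
      (fun v => symm _ _ _ _ (deg_vec v) (deg_scal α) (vec_scal v p α)) a x hx)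
  · exact symm _ _ _ _ (deg_vec v) hx (key _ _ (deg_vec v) (vec_scal v) (vec_vec v) a x hx)

end

/-- Two linear maps that satisfy the same derivation rule agree if they agree on generators. -/
theorem linearMap_eq_of_derivation [Module.Finite A L'] [Module.Projective A L']
    {D₁ D₂ : PolyAlg R A L' L'' →ₗ[R] PolyAlg R A L' L''} {s : ZMod 2 → ℤ}
    (h₁ : ∀ b y z, Deg b y → D₁ (y * z) = D₁ y * z + s b • (y * D₁ z))
    (h₂ : ∀ b y z, Deg b y → D₂ (y * z) = D₂ y * z + s b • (y * D₂ z))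
    (scal : ∀ (p : ℕ) (α : L'' [⋀^Fin p]→ₗ[A] A), D₁ (scal R L' α) = D₂ (scal R L' α))
    (vec : ∀ x : L', D₁ (vec R L'' x) = D₂ (vec R L'' x)) : D₁ = D₂ := by
  ext x
  induction x using induction_generators with
  | zero => simp
  | add x y hx hy => rw [map_add, map_add, hx, hy]
  | mul p q p' q' x hx y hy h h' => rw [h₁ _ _ _ (deg_of_mem hx), h₂ _ _ _ (deg_of_mem hx), h, h']
  | scal p α => exact scal p α
  | vec x => exact vec x

end PolyAlg

/-! ### Construction of the crossed product bracket -/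

/-- A finite dual basis of a module. -/
structure DualBasisData (A N : Type*) [CommRing A] [AddCommGroup N] [Module A N] where
  n : ℕ
  e : Fin n → N
  θ : Fin n → N →ₗ[A] A
  sum_eq : ∀ x, ∑ i, θ i x • e i = x

namespace PolyAlg

variable {R A L' L'' : Type*} [CommRing R] [CommRing A] [Algebra R A]
  [AddCommGroup L'] [Module R L'] [Module A L'] [IsScalarTower R A L']
  [AddCommGroup L''] [Module R L''] [Module A L''] [IsScalarTower R A L'']
  (S : AlmostTwilledPre R A L' L'') (B : DualBasisData A L')

/-- The derivation of `L'` that vanishes on the given generators. -/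
def dualBasisDerivation (δ : Derivation R A A) : L' →ₗ[R] L' where
  toFun y := ∑ k, δ (B.θ k y) • B.e k
  map_add' y z := by simp only [map_add, add_smul, Finset.sum_add_distrib]
  map_smul' r y := by
    simp only [RingHom.id_apply, Finset.smul_sum]
    refine Finset.sum_congr rfl fun k _ => ?_
    rw [← algebraMap_smul A r y, map_smul, algebraMap_smul, Derivation.map_smul, smul_assoc]

theorem dualBasisDerivation_apply (δ : Derivation R A A) (y : L') :
    dualBasisDerivation B δ y = ∑ k, δ (B.θ k y) • B.e k := rfl

theorem dualBasisDerivation_smul (δ : Derivation R A A) (a : A) (y : L') :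
    dualBasisDerivation B δ (a • y) = δ a • y + a • dualBasisDerivation B δ y := by
  simp only [dualBasisDerivation_apply, map_smul, smul_eq_mul, Derivation.leibniz, add_smul,
    Finset.sum_add_distrib, Finset.smul_sum]
  rw [add_comm]
  congr 1
  · conv_rhs => rw [← B.sum_eq y, Finset.smul_sum]
    exact Finset.sum_congr rfl fun k _ => by rw [smul_smul, mul_comm]
  · exact Finset.sum_congr rfl fun k _ => by rw [smul_smul]

/-- The action of `x ∈ L'` on forms, by the bracket of `L'` and the connection on `L''`. -/
def lieVec (x : L') : PolyAlg R A L' L'' →ₗ[R] PolyAlg R A L' L'' :=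
  lieDerivative (S.pre'.anchor x) (S.conn'.act x) (S.pre'.bracket x) (S.conn'.act_smul x)
    (S.pre'.bracket_smul x)

/-- The action of `x ∈ L'` on forms, by the connection for which the given generators of `L'` are
constant and the connection on `L''`. -/
def nabla (x : L') : PolyAlg R A L' L'' →ₗ[R] PolyAlg R A L' L'' :=
  lieDerivative (S.pre'.anchor x) (S.conn'.act x) (dualBasisDerivation B (S.pre'.anchor x))
    (S.conn'.act_smul x) (dualBasisDerivation_smul B _)

/-- The crossed product bracket. -/
def brac : PolyAlg R A L' L'' →ₗ[R] PolyAlg R A L' L'' →ₗ[R] PolyAlg R A L' L'' :=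
  LinearMap.mk₂ R
    -- The action `lieVec` is not `A`-linear in the acting vector, so for `x, y ∈ L'` the first sum
    -- exceeds `[x, y]'` by `∑ y(θᵢ x) eᵢ`. The second sum subtracts this term, because `nabla` uses
    -- the connection that `L'` inherits from a free module through the dual basis.
    (fun x y => ∑ i, (parity (contract (B.θ i) x) * lieVec S (B.e i) y -
      nabla S B (B.e i) x * contract (B.θ i) y))
    (fun x x' y => by
      rw [← Finset.sum_add_distrib]
      refine Finset.sum_congr rfl fun i _ => ?_
      simp only [map_add, add_mul]; abel)
    (fun r x y => by
      rw [Finset.smul_sum]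
      refine Finset.sum_congr rfl fun i _ => ?_
      simp only [map_smul, smul_mul, smul_sub])
    (fun x y y' => by
      rw [← Finset.sum_add_distrib]
      refine Finset.sum_congr rfl fun i _ => ?_
      simp only [map_add, mul_add]; abel)
    (fun r x y => by
      rw [Finset.smul_sum]
      refine Finset.sum_congr rfl fun i _ => ?_
      simp only [map_smul, mul_smul', smul_sub])

theorem brac_apply (x y : PolyAlg R A L' L'') : brac S B x y =
    ∑ i, (parity (contract (B.θ i) x) * lieVec S (B.e i) y -
      nabla S B (B.e i) x * contract (B.θ i) y) := rfl

section Leibniz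

variable {a b c : ZMod 2} {x y z : PolyAlg R A L' L''}

/-- In the second argument each summand is a multiple of a derivation, `lieVec` being even and
`contract` odd. In both cases coefficient and derivation have total parity `a + 1`. -/
theorem brac_mul (hx : Deg a x) (hy : Deg b y) (z : PolyAlg R A L' L'') :
    brac S B x (y * z) = brac S B x y * z + paritySign ((a + 1) * b) • (y * brac S B x z) := by
  simp only [brac_apply, Finset.sum_mul, Finset.mul_sum, Finset.smul_sum, ← Finset.sum_add_distrib]
  refine Finset.sum_congr rfl fun i _ => ?_
  have h1 := ((hx.contract (B.θ i)).parity).mul_comm hy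
  have h2 : nabla S B (B.e i) x * parity y = paritySign ((a + 1) * b) • (y * nabla S B (B.e i) x) := by
    have hx' : Deg a (nabla S B (B.e i) x) := hx.lieDerivative _ _ _ _ _
    rw [hy.parity_eq, mul_smul_comm, hx'.mul_comm hy, smul_smul, ← paritySign_add]
    congr 2; ring
  rw [contract_mul, lieVec, lieDerivative_mul, mul_add, mul_add, ← mul_assoc, ← mul_assoc,
    ← mul_assoc, ← mul_assoc, h1, h2, sub_mul, mul_sub, smul_sub, smul_mul_assoc, smul_mul_assoc,
    mul_assoc y, mul_assoc y]
  abel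

/-- In the first argument `contract` and `nabla` act by derivations. The additional parity in the
first summand turns the odd derivation rule of `contract` into the sign required here. -/
theorem mul_brac (hx : Deg a x) (hy : Deg b y) (z : PolyAlg R A L' L'') :
    brac S B (x * y) z = x * brac S B y z + paritySign (a * b) • (y * brac S B x z) := by
  simp only [brac_apply, Finset.sum_mul, Finset.mul_sum, Finset.smul_sum, ← Finset.sum_add_distrib]
  refine Finset.sum_congr rfl fun i _ => ?_
  have h1 : parity (contract (B.θ i) x) * parity y =
      paritySign (a * b) • (y * parity (contract (B.θ i) x)) := by
    rw [hy.parity_eq, mul_smul_comm, ((hx.contract (B.θ i)).parity).mul_comm hy, smul_smul,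
      ← paritySign_add]
    congr 2
    linear_combination b * one_add_one_parity
  have h2 : nabla S B (B.e i) x * y = paritySign (a * b) • (y * nabla S B (B.e i) x) := by
    have hx' : Deg a (nabla S B (B.e i) x) := hx.lieDerivative _ _ _ _ _
    exact hx'.mul_comm hy
  rw [contract_mul, map_add, parity_mul, parity_mul, parity_parity, h1, nabla, lieDerivative_mul,
    ← nabla, h2, add_mul, add_mul, mul_sub, mul_sub, smul_sub, smul_mul_assoc, smul_mul_assoc,
    mul_assoc y, mul_assoc y, mul_assoc x, mul_assoc x]
  abel

end Leibniz

theorem brac_mem {p q p' q' r : ℕ} {x y : PolyAlg R A L' L''} (hx : x ∈ hom R A L' L'' p q)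
    (hy : y ∈ hom R A L' L'' p' q') (h : q + q' = r + 1) :
    brac S B x y ∈ hom R A L' L'' (p + p') r := by
  rw [brac_apply]
  refine sum_mem fun i _ => sub_mem ?_ ?_
  · rcases q with _ | q
    · rw [contract_of_mem_zero _ hx, map_zero, zero_mul]; exact zero_mem _
    · obtain rfl : q + q' = r := by omega
      rw [parity_of_mem (contract_mem _ hx)]
      exact mul_mem (zsmul_mem (contract_mem _ hx) _) (lieDerivative_mem _ _ _ _ _ hy)
  · rcases q' with _ | q'
    · rw [contract_of_mem_zero _ hy, mul_zero]; exact zero_mem _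
    · obtain rfl : q + q' = r := by omega
      exact mul_mem (lieDerivative_mem _ _ _ _ _ hx) (contract_mem _ hy)

theorem brac_eq_zero {p p' : ℕ} {x y : PolyAlg R A L' L''} (hx : x ∈ hom R A L' L'' p 0)
    (hy : y ∈ hom R A L' L'' p' 0) : brac S B x y = 0 := by
  rw [brac_apply]
  refine Finset.sum_eq_zero fun i _ => ?_
  rw [contract_of_mem_zero _ hx, contract_of_mem_zero _ hy, map_zero, zero_mul, mul_zero, sub_zero]

theorem Deg.brac {a b : ZMod 2} {x y : PolyAlg R A L' L''} (hx : Deg a x) (hy : Deg b y) :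
    Deg (a + b + 1) (brac S B x y) := by
  obtain ⟨p, q, hx, rfl⟩ := hx
  obtain ⟨p', q', hy, rfl⟩ := hy
  obtain h | ⟨r, h⟩ : q + q' = 0 ∨ ∃ r, q + q' = r + 1 := by
    rcases q + q' with _ | r
    · exact Or.inl rfl
    · exact Or.inr ⟨r, rfl⟩
  · obtain ⟨rfl, rfl⟩ : q = 0 ∧ q' = 0 := by omega
    rw [brac_eq_zero S B hx hy]
    exact deg_zero _
  · refine ⟨_, _, brac_mem S B hx hy h, ?_⟩
    have h' : (q + q' : ZMod 2) = r + 1 := by exact_mod_cast congrArg (Nat.cast (R := ZMod 2)) h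
    push_cast
    linear_combination -h' - one_add_one_parity

end PolyAlg

/-! ### The bracket on generators and its skew-symmetry -/

theorem ListForm.smul_one_mul {A M Λ : Type*} [CommRing A] [Ring Λ] [Algebra A Λ] {σ : Λ →+* Λ}
    (hσ : ∀ (r : A) (u : Λ), σ (r • u) = r • σ u) (a : A) (F : ListForm M σ) :
    a • (1 : ListForm M σ) * F = a • F := by
  rw [ListForm.smul_mul_of_map_smul hσ, one_mul]

namespace PolyAlg

variable {R A L' L'' : Type*} [CommRing R] [CommRing A] [Algebra R A]
  [AddCommGroup L'] [Module R L'] [Module A L'] [IsScalarTower R A L']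
  [AddCommGroup L''] [Module R L''] [Module A L''] [IsScalarTower R A L'']

variable (R L' L'') in
/-- An element of `A`, as a form of bidegree `(0, 0)`. -/
def cst (a : A) : PolyAlg R A L' L'' := scal R L' (AlternatingMap.constOfIsEmpty A L'' (Fin 0) a)

theorem toList_cst (a : A) : toList (cst R L' L'' a) = a • (1 : PolyList A L' L'') := by
  apply ListForm.ext_contr
  · rw [cst, scal_zero_eval, AlternatingMap.constOfIsEmpty_apply, Function.const_apply,
      ListForm.smul_eval, ListForm.one_nil, Algebra.smul_def, mul_one]
  · intro ξ
    rw [cst, toList_scal, contr_homToList_zero, ListForm.contr_smul, ListForm.contr_one, smul_zero]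

theorem toList_cst_mul (a : A) (x : PolyAlg R A L' L'') :
    toList (cst R L' L'' a * x) = a • toList x := by
  rw [toList_mul, toList_cst]
  exact ListForm.smul_one_mul (fun r u => map_smul (gradeInvolution A L') r u) a _

theorem deg_cst (a : A) : Deg 0 (cst R L' L'' a) := ⟨0, 0, scal_mem _, by simp⟩

theorem mul_cst (a : A) (x : PolyAlg R A L' L'') : x * cst R L' L'' a = cst R L' L'' a * x := by
  induction x using induction_hom with
  | zero => simp
  | add x y hx hy => rw [add_mul, mul_add, hx, hy]
  | hom p q x hx => rw [(deg_of_mem hx).mul_comm (deg_cst a), mul_zero, paritySign_zero, one_smul]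

theorem cst_mul_scal (a : A) {p : ℕ} (α : L'' [⋀^Fin p]→ₗ[A] A) :
    cst R L' L'' a * scal R L' α = scal R L' (a • α) := by
  apply toList_injective
  rw [toList_cst_mul]
  apply ListForm.ext_eval; intro l
  rw [ListForm.smul_eval, toList_scal_eval, toList_scal_eval]
  split_ifs
  · rw [AlternatingMap.smul_apply, smul_eq_mul, map_mul, smul_comm, ← Algebra.smul_def]
  · rw [smul_zero]

theorem cst_mul_vec (a : A) (x : L') : cst R L' L'' a * vec R L'' x = vec R L'' (a • x) := by
  apply toList_injective
  rw [toList_cst_mul]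
  apply ListForm.ext_contr
  · rw [ListForm.smul_eval, toList_vec_nil, toList_vec_nil, map_smul]
  · intro ξ; rw [ListForm.contr_smul, contr_toList_vec, contr_toList_vec, smul_zero]

variable (R L'') in
/-- The inclusion of `L'`, as a linear map. -/
def vecHom : L' →ₗ[R] PolyAlg R A L' L'' where
  toFun := vec R L''
  map_add' x y := by
    apply toList_injective
    rw [map_add]
    apply ListForm.ext_contr
    · rw [ListForm.add_eval, toList_vec_nil, toList_vec_nil, toList_vec_nil, map_add]
    · intro ξ; rw [map_add, contr_toList_vec, contr_toList_vec, contr_toList_vec, add_zero]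
  map_smul' r x := by
    apply toList_injective
    rw [map_smul]
    apply ListForm.ext_contr
    · rw [RingHom.id_apply, ListForm.smul_eval, toList_vec_nil, toList_vec_nil,
        ← algebraMap_smul A r x, map_smul, algebraMap_smul]
    · intro ξ; rw [contr_toList_vec, ListForm.contr_smul, contr_toList_vec, smul_zero]

theorem vec_add (x y : L') : (vec R L'' (x + y) : PolyAlg R A L' L'') = vec R L'' x + vec R L'' y :=
  map_add (vecHom R L'') x y

theorem vec_neg (x : L') : (vec R L'' (-x) : PolyAlg R A L' L'') = -vec R L'' x :=
  map_neg (vecHom R L'') x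

theorem vec_sub (x y : L') : (vec R L'' (x - y) : PolyAlg R A L' L'') = vec R L'' x - vec R L'' y :=
  map_sub (vecHom R L'') x y

theorem vec_sum {ι : Type*} (s : Finset ι) (x : ι → L') :
    (vec R L'' (∑ i ∈ s, x i) : PolyAlg R A L' L'') = ∑ i ∈ s, vec R L'' (x i) :=
  map_sum (vecHom R L'') x s

theorem vec_injective : Function.Injective (vec R L'' : L' → PolyAlg R A L' L'') := by
  intro x y h
  have h1 := congrArg (fun z => (toList z).eval []) h
  simp only [toList_vec_nil] at h1
  exact (ExteriorAlgebra.ι_inj A x y).mp h1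

variable (R L') in
/-- The inclusion of the scalar forms, as a linear map. -/
def scalHom (p : ℕ) : L'' [⋀^Fin p]→ₗ[A] A →ₗ[R] PolyAlg R A L' L'' where
  toFun := scal R L'
  map_add' α β := by
    apply toList_injective
    rw [map_add]
    apply ListForm.ext_eval; intro l
    rw [ListForm.add_eval, toList_scal_eval, toList_scal_eval, toList_scal_eval]
    split_ifs
    · rw [AlternatingMap.add_apply, map_add, smul_add]
    · rw [add_zero]
  map_smul' r α := by
    apply toList_injective
    rw [map_smul]
    apply ListForm.ext_eval; intro l
    rw [RingHom.id_apply, ListForm.smul_eval, toList_scal_eval, toList_scal_eval]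
    split_ifs
    · rw [AlternatingMap.smul_apply, ← algebraMap_smul A r, smul_eq_mul, map_mul,
        ← Algebra.smul_def, smul_comm, algebraMap_smul]
    · rw [smul_zero]

theorem scal_sum {p : ℕ} {ι : Type*} (s : Finset ι) (α : ι → L'' [⋀^Fin p]→ₗ[A] A) :
    scal R L' (∑ i ∈ s, α i) = ∑ i ∈ s, scal R L' (α i) :=
  map_sum (scalHom R L' p) α s

theorem contract_vec (θ : L' →ₗ[A] A) (x : L') :
    contract θ (vec R L'' x) = cst R L' L'' (θ x) := by
  apply toList_injective
  rw [toList_contract, toList_cst]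
  apply ListForm.ext_contr
  · rw [ListForm.odd_eval, toList_vec_nil, ListForm.smul_eval, ListForm.one_nil]
    change (-1 : ℤ) ^ 0 • exteriorContraction θ _ = _
    rw [exteriorContraction_ι, pow_zero, one_smul, Algebra.smul_def, mul_one]
  · intro ξ
    rw [ListForm.contr_odd, contr_toList_vec, map_zero, neg_zero, ListForm.contr_smul,
      ListForm.contr_one, smul_zero]

theorem parity_cst (a : A) : parity (cst R L' L'' a) = cst R L' L'' a := by
  rw [(deg_cst a).parity_eq, paritySign_zero, one_smul]

section LieDerivative

variable (δ : Derivation R A A) (D : L'' →ₗ[R] L'') (E : L' →ₗ[R] L')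
    (hD : ∀ (a : A) (ξ : L''), D (a • ξ) = δ a • ξ + a • D ξ)
    (hE : ∀ (a : A) (x : L'), E (a • x) = δ a • x + a • E x)

theorem lieDerivative_vec (x : L') :
    lieDerivative δ D E hD hE (vec R L'' x) = vec R L'' (E x) := by
  apply toList_injective
  rw [toList_lieDerivative]
  apply ListForm.ext_contr
  · rw [ListForm.lie_nil, toList_vec_nil, toList_vec_nil, exteriorDerivationHom_ι]
  · intro ξ
    rw [ListForm.contr_lie, contr_toList_vec, contr_toList_vec, contr_toList_vec, map_zero,
      sub_zero]

theorem lieDerivative_scal (hA : ∀ a b : A, δ (a • b) = δ a • b + a • δ b) {p : ℕ}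
    (α : L'' [⋀^Fin p]→ₗ[A] A) : lieDerivative δ D E hD hE (scal R L' α) =
      scal R L' (formDerivation δ D (δ : A →ₗ[R] A) hD hA α) := by
  change lieDerivative δ D E hD hE (of R (p, 0) _) = of R (p, 0) _
  rw [lieDerivative_of]
  congr 1
  apply AlternatingMap.ext
  intro v
  rw [lieHom_apply]
  apply Subtype.ext
  simp only [LinearMap.compAlternatingMap_apply, LinearEquiv.coe_coe, formDerivation_apply,
    map_sub, map_sum, Submodule.coe_sub, Submodule.coe_sum, coe_exteriorPowerDerivation,
    coe_zeroEquiv_symm, exteriorDerivationHom_algebraMap, Derivation.coeFn_coe]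

end LieDerivative

variable (S : AlmostTwilledPre R A L' L'') (B : DualBasisData A L')

theorem lieVec_vec (x y : L') : lieVec S x (vec R L'' y) = vec R L'' (S.pre'.bracket x y) :=
  lieDerivative_vec _ _ _ _ _ y

theorem lieVec_scal (x : L') {p : ℕ} (α : L'' [⋀^Fin p]→ₗ[A] A) :
    lieVec S x (scal R L' α) = scal R L' (S.formAct x α) :=
  lieDerivative_scal _ _ _ _ _ _ α

theorem nabla_scal (x : L') {p : ℕ} (α : L'' [⋀^Fin p]→ₗ[A] A) :
    nabla S B x (scal R L' α) = scal R L' (S.formAct x α) :=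
  lieDerivative_scal _ _ _ _ _ _ α

theorem nabla_vec (x y : L') : nabla S B x (vec R L'' y) =
    vec R L'' (dualBasisDerivation B (S.pre'.anchor x) y) :=
  lieDerivative_vec _ _ _ _ _ y

theorem anchor_sum_smul_apply {L : Type*} [AddCommGroup L] [Module R L] [Module A L]
    [IsScalarTower R A L] (P : PreLieRinehart R A L) {ι : Type*} (s : Finset ι) (a : ι → A)
    (x : ι → L) (b : A) : P.anchor (∑ i ∈ s, a i • x i) b = ∑ i ∈ s, a i * P.anchor (x i) b := by
  classical
  induction s using Finset.induction_on with
  | empty => simp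
  | insert i s hi ih =>
    rw [Finset.sum_insert hi, Finset.sum_insert hi, map_add, Derivation.add_apply, ih, map_smul,
      Derivation.smul_apply, smul_eq_mul]

/-- The action of `L'` on scalar forms is linear over `A` in the elements of `L'`. -/
def formActHom {p : ℕ} (α : L'' [⋀^Fin p]→ₗ[A] A) : L' →ₗ[A] L'' [⋀^Fin p]→ₗ[A] A where
  toFun x := S.formAct x α
  map_add' x y := by
    ext v
    simp only [AlmostTwilledPre.formAct, AlternatingMap.add_apply, formDerivation_apply, map_add,
      Derivation.coeFn_coe, LinearMap.add_apply, Derivation.add_apply, AlternatingMap.map_update_add,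
      Finset.sum_add_distrib]
    abel
  map_smul' a x := by
    ext v
    simp only [AlmostTwilledPre.formAct, AlternatingMap.smul_apply, formDerivation_apply, map_smul,
      Derivation.coeFn_coe, LinearMap.smul_apply, Derivation.smul_apply,
      AlternatingMap.map_update_smul, RingHom.id_apply, smul_sub, Finset.smul_sum]

theorem formAct_sum_smul {ι : Type*} (s : Finset ι) (a : ι → A) (x : ι → L') {p : ℕ}
    (α : L'' [⋀^Fin p]→ₗ[A] A) :
    S.formAct (∑ i ∈ s, a i • x i) α = ∑ i ∈ s, a i • S.formAct (x i) α := by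
  change formActHom S α _ = ∑ i ∈ s, a i • formActHom S α (x i)
  simp only [map_sum, map_smul]

/-- On scalar forms the action of `L'` is `A`-linear in the acting vector, so `∑ θᵢ(x) eᵢ = x` can
be applied inside it. -/
theorem brac_vec_scal (x : L') {p : ℕ} (α : L'' [⋀^Fin p]→ₗ[A] A) :
    brac S B (vec R L'' x) (scal R L' α) = scal R L' (S.formAct x α) := by
  rw [brac_apply]
  simp only [contract_vec, parity_cst, lieVec_scal, contract_of_mem_zero _ (scal_mem α), mul_zero,
    sub_zero, cst_mul_scal, ← scal_sum, ← formAct_sum_smul, B.sum_eq]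

theorem brac_scal_vec {p : ℕ} (α : L'' [⋀^Fin p]→ₗ[A] A) (x : L') :
    brac S B (scal R L' α) (vec R L'' x) = -scal R L' (S.formAct x α) := by
  rw [brac_apply]
  simp only [contract_vec, nabla_scal, contract_of_mem_zero _ (scal_mem α), map_zero, zero_mul,
    zero_sub, mul_cst, Finset.sum_neg_distrib, cst_mul_scal, ← scal_sum, ← formAct_sum_smul,
    B.sum_eq]

theorem pre_bracket_skew {L : Type*} [AddCommGroup L] [Module R L] [Module A L]
    [IsScalarTower R A L] (P : PreLieRinehart R A L) (x y : L) :
    P.bracket x y = -P.bracket y x := by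
  have h := P.bracket_self (x + y)
  simp only [map_add, LinearMap.add_apply, P.bracket_self, zero_add, add_zero] at h
  exact eq_neg_of_add_eq_zero_right h

/-- Both sums contain `∑ y(θₖ x) eₖ`, which cancels. In the first it comes from moving the
coefficient `θᵢ x` into the bracket; in the second from `∑ θᵢ(y) eᵢ = y`, the connection being
`A`-linear in its direction. -/
theorem brac_vec_vec (x y : L') :
    brac S B (vec R L'' x) (vec R L'' y) = vec R L'' (S.pre'.bracket x y) := by
  rw [brac_apply]
  simp only [contract_vec, parity_cst, lieVec_vec, nabla_vec, mul_cst, cst_mul_vec,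
    Finset.sum_sub_distrib, ← vec_sum]
  rw [← vec_sub]
  congr 1
  have h1 : ∀ i, B.θ i x • S.pre'.bracket (B.e i) y =
      S.pre'.anchor y (B.θ i x) • B.e i + S.pre'.bracket (B.θ i x • B.e i) y := by
    intro i
    rw [pre_bracket_skew S.pre' (_ • _), S.pre'.bracket_smul, pre_bracket_skew S.pre' _ y, neg_add]
    simp
  have h2 : ∑ i, B.θ i y • dualBasisDerivation B (S.pre'.anchor (B.e i)) x =
      ∑ k, S.pre'.anchor y (B.θ k x) • B.e k := by
    conv_rhs => rw [← B.sum_eq y]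
    simp only [dualBasisDerivation_apply, Finset.smul_sum, anchor_sum_smul_apply, Finset.sum_smul]
    rw [Finset.sum_comm]
    simp only [smul_smul]
  rw [h2]
  simp only [h1, Finset.sum_add_distrib]
  rw [add_sub_cancel_left, ← LinearMap.sum_apply, ← map_sum, B.sum_eq]

variable [Module.Finite A L'] [Module.Projective A L']

/-- Two derivations with equal values on generators. As a consequence the bracket with an element of
`L'` no longer involves the dual basis. -/
theorem brac_vec (x : L') : brac S B (vec R L'' x) = lieVec S x := by
  refine linearMap_eq_of_derivation (s := fun _ => 1) (fun b y z hy => ?_) (fun b y z hy => ?_)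
    (fun p α => ?_) (fun y => ?_)
  · rw [brac_mul S B (deg_vec x) hy, one_add_one_parity, zero_mul, paritySign_zero]
  · rw [one_smul, lieVec, lieDerivative_mul]
  · rw [brac_vec_scal, lieVec_scal]
  · rw [brac_vec_vec, lieVec_vec]

section Skew

variable {a b c : ZMod 2} {x y z : PolyAlg R A L' L''}

theorem skew_of_neg {G : Type*} [AddCommGroup G] {u v : G} {s : ℤ} (hs : s * s = 1)
    (h : u = -(s • v)) : v = -(s • u) := by
  rw [h, smul_neg, neg_neg, smul_smul, hs, one_smul]

theorem paritySign_mul_self (a : ZMod 2) : paritySign a * paritySign a = 1 := by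
  revert a; decide

/-- The derivation rules in the two arguments correspond to each other under the exchange, so
generators decide. There it amounts to skew-symmetry of the bracket of `L'` and to `brac_scal_vec`.
-/
theorem brac_skew (hx : Deg a x) (hy : Deg b y) :
    brac S B x y = -(paritySign ((a + 1) * (b + 1)) • brac S B y x) := by
  refine Deg.induction_pair (P := fun a b x y =>
    brac S B x y = -(paritySign ((a + 1) * (b + 1)) • brac S B y x)) ?_ ?_ ?_ ?_ ?_ ?_ ?_ hx hy
  · intro a b x y _ _ h
    rw [mul_comm]
    exact skew_of_neg (paritySign_mul_self _) h
  · intro a b x; simp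
  · intro a b x y z _ _ _ h h'
    rw [map_add, h, h', map_add, LinearMap.add_apply, smul_add, neg_add]
  · intro a b c x y z hx hy hz h h'
    rw [brac_mul S B hx hy, mul_brac S B hy hz, h, h', neg_mul, smul_mul_assoc,
      (hy.brac S B hx).mul_comm hz, mul_neg, mul_smul_comm]
    generalize y * brac S B z x = u
    generalize z * brac S B y x = w
    -- All signs depend on the parities only, which leaves eight cases.
    rcases parity_eq_zero_or_one a with rfl | rfl <;>
      rcases parity_eq_zero_or_one b with rfl | rfl <;>
      rcases parity_eq_zero_or_one c with rfl | rfl <;>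
      simp [one_add_one_parity, add_comm]
  · intro p p' α β
    rw [brac_eq_zero S B (scal_mem α) (scal_mem β), brac_eq_zero S B (scal_mem β) (scal_mem α),
      smul_zero, neg_zero]
  · intro x p α
    rw [brac_vec_scal, brac_scal_vec, one_add_one_parity, zero_mul, paritySign_zero, one_smul,
      neg_neg]
  · intro x y
    rw [brac_vec_vec, brac_vec_vec, one_add_one_parity, zero_mul, paritySign_zero, one_smul,
      pre_bracket_skew, vec_neg]

end Skew

end PolyAlg

/-! ### Uniqueness of the bracket and the Jacobi identity -/

namespace PolyAlg

variable {R A L' L'' : Type*} [CommRing R] [CommRing A] [Algebra R A]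
  [AddCommGroup L'] [Module R L'] [Module A L'] [IsScalarTower R A L']
  [AddCommGroup L''] [Module R L''] [Module A L''] [IsScalarTower R A L'']
  (S : AlmostTwilledPre R A L' L'') (B : DualBasisData A L')
  [Module.Finite A L'] [Module.Projective A L']

theorem paritySign_shifted_mul (p q p' q' : ℕ) :
    ((((p : ℤ) + q - 1) * ((p' : ℤ) + q' - 1)).negOnePow : ℤ) =
      paritySign ((p + q + 1) * (p' + q' + 1)) := by
  rw [← paritySign_intCast]
  push_cast
  simp only [sub_eq_add_neg, show (-1 : ZMod 2) = 1 from rfl]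

theorem paritySign_mul_shifted (p q p' q' : ℕ) :
    ((((p : ℤ) + q - 1) * ((p' : ℤ) + q')).negOnePow : ℤ) =
      paritySign ((p + q + 1) * (p' + q')) := by
  rw [← paritySign_intCast]
  push_cast
  simp only [sub_eq_add_neg, show (-1 : ZMod 2) = 1 from rfl]

theorem paritySign_mul_natCast (p q p' q' : ℕ) :
    (-1 : ℤ) ^ ((p + q) * (p' + q')) = paritySign ((p + q) * (p' + q')) := by
  rw [← paritySign_natCast]
  push_cast
  rfl

theorem bidegree_brac : HasBidegreeZeroNegOne (PolyForm A L' L'') (brac S B) where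
  mem hx hy h := brac_mem S B hx hy h
  eq_zero hx hy := brac_eq_zero S B hx hy

theorem isShiftedSkew_brac : IsShiftedSkew (PolyForm A L' L'') (brac S B) := by
  intro p q p' q' x y hx hy
  have h := brac_skew S B (deg_of_mem hx) (deg_of_mem hy)
  rw [← paritySign_shifted_mul] at h
  exact h

theorem isCrossedProductBracket_brac : S.IsCrossedProductBracket (brac S B) where
  bidegree := bidegree_brac S B
  bracket_vector x y := brac_vec_vec S B x y
  bracket_scalarForm x _ α := brac_vec_scal S B x α
  mul_bracket := by
    intro p q p' q' x y z hx hy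
    have h := mul_brac S B (deg_of_mem hx) (deg_of_mem hy) z
    rw [← paritySign_mul_natCast] at h
    exact h
  skew := isShiftedSkew_brac S B

/-- The values with an element of `L'` are prescribed on generators, those on two scalar forms
vanish because the exterior degree would become negative. The derivation rule and skew-symmetry
determine the rest. -/
theorem eq_brac {br : PolyAlg R A L' L'' →ₗ[R] PolyAlg R A L' L'' →ₗ[R] PolyAlg R A L' L''}
    (h : S.IsCrossedProductBracket br) : br = brac S B := by
  have hskew : ∀ a b x y, Deg a x → Deg b y →
      br x y = -(paritySign ((a + 1) * (b + 1)) • br y x) := by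
    rintro a b x y ⟨p, q, hx, rfl⟩ ⟨p', q', hy, rfl⟩
    rw [← paritySign_shifted_mul]
    exact h.skew hx hy
  have hmul : ∀ a b x y z, Deg a x → Deg b y →
      br (x * y) z = x * br y z + paritySign (a * b) • (y * br x z) := by
    rintro a b x y z ⟨p, q, hx, rfl⟩ ⟨p', q', hy, rfl⟩
    rw [← paritySign_mul_natCast]
    exact h.mul_bracket z hx hy
  -- The arguments are reversed because the derivation rule is assumed in the first argument,
  -- whereas the induction over pairs multiplies in the second.
  have key : ∀ a b x y, Deg a x → Deg b y → br y x = brac S B y x := by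
    intro a b x y hx hy
    refine Deg.induction_pair (P := fun a b x y => br y x = brac S B y x) ?_ ?_ ?_ ?_ ?_ ?_ ?_ hx hy
    · intro a b x y hx hy h
      rw [hskew a b x y hx hy, brac_skew S B hx hy, h]
    · intro a b x; rw [map_zero, map_zero]
    · intro a b x y z _ _ _ h h'
      rw [map_add, map_add, LinearMap.add_apply, LinearMap.add_apply, h, h']
    · intro a b c x y z hx hy hz h h'
      rw [hmul b c y z x hy hz, mul_brac S B hy hz, h, h']
    · intro p p' α β
      rw [brac_eq_zero S B (scal_mem β) (scal_mem α)]
      exact h.bidegree.eq_zero (scal_mem β) (scal_mem α)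
    · intro x p α
      rw [hskew _ _ _ _ (deg_scal α) (deg_vec x), brac_skew S B (deg_scal α) (deg_vec x),
        brac_vec_scal]
      exact congrArg (fun u : PolyAlg R A L' L'' => -(paritySign _ • u)) (h.bracket_scalarForm x α)
    · intro x y
      rw [brac_vec_vec]
      exact h.bracket_vector y x
  refine LinearMap.ext fun y => LinearMap.ext fun x => ?_
  induction x using induction_hom with
  | zero => rw [map_zero, map_zero]
  | add x z hx hz => rw [map_add, map_add, hx, hz]
  | hom p q x hx =>
    induction y using induction_hom with
    | zero => rw [map_zero, map_zero]
    | add y z hy hz => rw [map_add, map_add, LinearMap.add_apply, LinearMap.add_apply, hy, hz]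
    | hom p' q' y hy => exact key _ _ _ _ (deg_of_mem hx) (deg_of_mem hy)

section Jacobi

variable {a b c : ZMod 2} {x y z : PolyAlg R A L' L''}

/-- The Jacobiator of the crossed product bracket. -/
def jacobiator (a b : ZMod 2) (x y z : PolyAlg R A L' L'') : PolyAlg R A L' L'' :=
  brac S B x (brac S B y z) - brac S B (brac S B x y) z -
    paritySign ((a + 1) * (b + 1)) • brac S B y (brac S B x z)

/-- As an operator on the third argument the Jacobiator is the graded commutator of two derivations
minus a derivation. The mixed products `u₇` and `u₈` cancel for every choice of parities. -/
theorem jacobiator_mul (hx : Deg a x) (hy : Deg b y) (hz : Deg c z) (w : PolyAlg R A L' L'') :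
    jacobiator S B a b x y (z * w) = jacobiator S B a b x y z * w +
      paritySign ((a + b) * c) • (z * jacobiator S B a b x y w) := by
  simp only [jacobiator, brac_mul S B hx hz, brac_mul S B hy hz,
    brac_mul S B (hx.brac S B hy) hz, map_add, map_zsmul,
    brac_mul S B hx (hy.brac S B hz), brac_mul S B hy (hx.brac S B hz), mul_sub, sub_mul,
    mul_smul_comm, smul_mul_assoc]
  generalize z * brac S B x (brac S B y w) = u₁
  generalize z * brac S B y (brac S B x w) = u₂
  generalize z * brac S B (brac S B x y) w = u₃
  generalize brac S B x (brac S B y z) * w = u₄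
  generalize brac S B y (brac S B x z) * w = u₅
  generalize brac S B (brac S B x y) z * w = u₆
  generalize brac S B x z * brac S B y w = u₇
  generalize brac S B y z * brac S B x w = u₈
  rcases parity_eq_zero_or_one a with rfl | rfl <;>
    rcases parity_eq_zero_or_one b with rfl | rfl <;>
    rcases parity_eq_zero_or_one c with rfl | rfl <;>
    simp only [one_add_one_parity, zero_add, add_zero, mul_one, mul_zero, paritySign_zero,
      paritySign_one, one_smul, neg_smul, zero_mul] <;> abel

/-- The Jacobiator inherits a graded symmetry from the bracket. Together with
`jacobiator_swap_right` this transfers the derivation rule from the third argument to the others. -/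
theorem jacobiator_swap_left (hx : Deg a x) (hy : Deg b y) (h : jacobiator S B a b x y z = 0) :
    jacobiator S B b a y x z = 0 := by
  rw [jacobiator, sub_sub, sub_eq_zero] at h
  rw [jacobiator, h, brac_skew S B hy hx, map_neg, map_zsmul, LinearMap.neg_apply,
    LinearMap.smul_apply]
  generalize brac S B y (brac S B x z) = u₁
  generalize brac S B (brac S B x y) z = u₂
  rcases parity_eq_zero_or_one a with rfl | rfl <;>
    rcases parity_eq_zero_or_one b with rfl | rfl <;>
    simp only [one_add_one_parity, zero_add, add_zero, mul_one, mul_zero, paritySign_zero,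
      paritySign_one, one_smul, neg_smul, zero_mul] <;> abel

theorem jacobiator_swap_right (hx : Deg a x) (hy : Deg b y) (hz : Deg c z)
    (h : jacobiator S B a b x y z = 0) : jacobiator S B a c x z y = 0 := by
  rw [jacobiator, sub_sub, sub_eq_zero] at h
  rw [jacobiator, brac_skew S B hz hy, map_neg, map_zsmul, h,
    brac_skew S B (hx.brac S B hz) hy, brac_skew S B hz (hx.brac S B hy)]
  generalize brac S B y (brac S B x z) = u₁
  generalize brac S B (brac S B x y) z = u₂
  rcases parity_eq_zero_or_one a with rfl | rfl <;>
    rcases parity_eq_zero_or_one b with rfl | rfl <;>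
    rcases parity_eq_zero_or_one c with rfl | rfl <;>
    simp only [one_add_one_parity, zero_add, add_zero, mul_one, mul_zero, paritySign_zero,
      paritySign_one, one_smul, neg_smul, zero_mul] <;> abel

/-- On the values of a form this is the Jacobi identity of `L'` with the anchor identity, on its
arguments the flatness of the action on `L''`. -/
theorem lieVec_commutator (h : S.pre'.IsLieRinehart) (hflat : S.conn'.IsFlat) (x y : L')
    (z : PolyAlg R A L' L'') : lieVec S x (lieVec S y z) - lieVec S y (lieVec S x z) =
      lieVec S (S.pre'.bracket x y) z := by
  induction z using induction_hom with
  | zero => simp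
  | add z w hz hw => simp only [map_add, ← hz, ← hw]; abel
  | hom p q z hz =>
    apply toList_injective
    simp only [map_sub, lieVec, toList_lieDerivative]
    refine (isForm_toList hz).lie_lie (fun u => ?_) (fun ξ => (hflat x y ξ).symm)
    refine exteriorDerivationHom_commutator _ _ _ (fun a => ?_) (fun v => ?_) u
    · rw [h.anchor_bracket, Derivation.commutator_apply]
    · rw [h.jacobi x y v, add_sub_cancel_right]

/-- Reduced to generators in the first two arguments. If at least two of three generators are scalar
forms, every term vanishes because of its exterior degree; if two are elements of `L'`, the
statement is `lieVec_commutator`. -/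
theorem jacobiator_eq_zero (h : S.pre'.IsLieRinehart) (hflat : S.conn'.IsFlat) (hx : Deg a x)
    (hy : Deg b y) (z : PolyAlg R A L' L'') : jacobiator S B a b x y z = 0 := by
  have hz0 : ∀ a b (x y : PolyAlg R A L' L''), jacobiator S B a b x y 0 = 0 := by
    intro a b x y; simp [jacobiator]
  have hzadd : ∀ a b (x y z w : PolyAlg R A L' L''), jacobiator S B a b x y (z + w) =
      jacobiator S B a b x y z + jacobiator S B a b x y w := by
    intro a b x y z w
    simp only [jacobiator, map_add, smul_add]; abel
  have key : ∀ c z, Deg c z → jacobiator S B a b x y z = 0 := by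
    refine Deg.induction_pair (P := fun a b x y => ∀ c z, Deg c z → jacobiator S B a b x y z = 0)
      ?_ ?_ ?_ ?_ ?_ ?_ ?_ hx hy
    · intro a b x y hx hy h c z hz
      exact jacobiator_swap_left S B hx hy (h c z hz)
    · intro a b x c z hz
      simp [jacobiator]
    · intro a b x y w hx hy hw h h' c z hz
      have e := h c z hz
      have e' := h' c z hz
      simp only [jacobiator, map_add, LinearMap.add_apply, smul_add] at e e' ⊢
      refine Eq.trans ?_ ((congrArg₂ (· + ·) e e').trans (add_zero 0))
      abel
    · intro a b b' x y w hx hy hw h h' c z hz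
      -- The product is moved to the third argument, where the derivation rule is known.
      refine jacobiator_swap_right S B hx hz (hy.mul hw) ?_
      rw [jacobiator_mul S B hx hz hy, jacobiator_swap_right S B hx hy hz (h c z hz),
        jacobiator_swap_right S B hx hw hz (h' c z hz), zero_mul, mul_zero, smul_zero, add_zero]
    · intro p p' α β c z hz
      refine Deg.induction (P := fun c z => jacobiator S B p p' (scal R L' α) (scal R L' β) z = 0)
        (fun _ => hz0 _ _ _ _) (fun a x y _ _ h h' => by rw [hzadd, h, h', add_zero]) ?_ ?_ ?_ hz
      · intro a b x y hx hy h h'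
        rw [jacobiator_mul S B (deg_scal α) (deg_scal β) hx, h, h', zero_mul, mul_zero, smul_zero,
          add_zero]
      · intro p'' γ
        simp [jacobiator, brac_eq_zero S B (scal_mem α) (scal_mem β),
          brac_eq_zero S B (scal_mem α) (scal_mem γ), brac_eq_zero S B (scal_mem β) (scal_mem γ)]
      · intro v
        simp [jacobiator, brac_eq_zero S B (scal_mem α) (scal_mem β), brac_scal_vec,
          brac_eq_zero S B (scal_mem α) (scal_mem (S.formAct v β)),
          brac_eq_zero S B (scal_mem β) (scal_mem (S.formAct v α))]
    · intro v p α c z hz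
      refine Deg.induction (P := fun c z => jacobiator S B 1 p (vec R L'' v) (scal R L' α) z = 0)
        (fun _ => hz0 _ _ _ _) (fun a x y _ _ h h' => by rw [hzadd, h, h', add_zero]) ?_ ?_ ?_ hz
      · intro a b x y hx hy h h'
        rw [jacobiator_mul S B (deg_vec v) (deg_scal α) hx, h, h', zero_mul, mul_zero, smul_zero,
          add_zero]
      · intro p' β
        simp [jacobiator, brac_eq_zero S B (scal_mem α) (scal_mem β), brac_vec_scal,
          brac_eq_zero S B (scal_mem α) (scal_mem (S.formAct v β)),
          brac_eq_zero S B (scal_mem (S.formAct v α)) (scal_mem β)]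
      · intro w
        have e := lieVec_commutator S h hflat v w (scal R L' α)
        simp only [lieVec_scal] at e
        simp only [jacobiator, brac_vec_scal, brac_scal_vec, brac_vec_vec, map_neg, ← e,
          one_add_one_parity, zero_mul, paritySign_zero, one_smul]
        abel
    · intro v w c z hz
      simp only [jacobiator, brac_vec, one_add_one_parity, zero_mul, paritySign_zero, one_smul,
        lieVec_vec, ← lieVec_commutator S h hflat v w z]
      abel
  induction z using induction_hom with
  | zero => exact hz0 _ _ _ _
  | add z w hz hw => rw [hzadd, hz, hw, add_zero]
  | hom p q z hz => exact key _ z (deg_of_mem hz)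

end Jacobi

theorem brac_brac (h : S.IsAlmostTwilled) {p q p' q' : ℕ} {x y : PolyAlg R A L' L''}
    (z : PolyAlg R A L' L'') (hx : x ∈ hom R A L' L'' p q) (hy : y ∈ hom R A L' L'' p' q') :
    brac S B x (brac S B y z) = brac S B (brac S B x y) z +
      ((((p : ℤ) + q - 1) * ((p' : ℤ) + q' - 1)).negOnePow : ℤ) • brac S B y (brac S B x z) := by
  have e := jacobiator_eq_zero S B h.isLieRinehart' h.isFlat' (deg_of_mem hx) (deg_of_mem hy) z
  rw [jacobiator, sub_sub, sub_eq_zero, ← paritySign_shifted_mul] at e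
  exact e

theorem isGerstenhaber_brac (h : S.IsAlmostTwilled) : S.IsGerstenhaber (brac S B) :=
  { isBigradedCommAlgebra_polyForms R A L' L'' with
    bidegree := bidegree_brac S B
    skew := isShiftedSkew_brac S B
    jacobi := fun z hx hy => brac_brac S B h z hx hy
    bracket_mul := by
      intro p q p' q' x y z hx hy
      have e := brac_mul S B (deg_of_mem hx) (deg_of_mem hy) z
      rw [← paritySign_mul_shifted] at e
      exact e }

end PolyAlg

namespace ListForm.IsForm

variable {A M Λ : Type*} [CommRing A] [Ring Λ] [Module A Λ] [AddCommGroup M] [Module A M]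
  {σ : Λ →+* Λ} {V : Submodule A Λ} {p : ℕ} {F : ListForm M σ}

theorem contr_sum_smul (h : IsForm V p F) {ι : Type*} (s : Finset ι) (a : ι → A) (ξ : ι → M) :
    contr (∑ i ∈ s, a i • ξ i) F = ∑ i ∈ s, a i • contr (ξ i) F := by
  classical
  induction s using Finset.induction_on with
  | empty => simp [h.contr_zero]
  | insert i s hi ih =>
    rw [Finset.sum_insert hi, Finset.sum_insert hi, h.contr_add, h.contr_smul, ih]

/-- Linearity of the operators on values is required on `V` only. This is what makes the lemma
applicable to scalar forms: the action of `L'` is linear over `A` there, but not on forms with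
values in `L'`. -/
theorem sum_smul_lie (h : IsForm V p F) {ι : Type*} [Fintype ι] {a : ι → A} {E : ι → Λ →+ Λ}
    {E' : Λ →+ Λ} {D : ι → M → M} {D' : M → M} (hE : ∀ u ∈ V, ∑ i, a i • E i u = E' u)
    (hD : ∀ ξ, ∑ i, a i • D i ξ = D' ξ) : ∑ i, a i • lie (E i) (D i) F = lie E' D' F := by
  apply ext_eval; intro l
  induction l generalizing p F with
  | nil =>
    rw [sum_eval, lie_nil]
    cases p with
    | zero => exact hE _ h.1
    | succ p => rw [h.1, map_zero]; simp [lie_nil, h.1]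
  | cons ξ l ih =>
    obtain ⟨p', h'⟩ := h.exists_contr ξ
    have e := ih h'
    simp only [eval_cons, map_sum, ListForm.contr_smul, contr_lie, ← hD, h.contr_sum_smul]
    rw [sub_eval, ← e]
    simp only [smul_sub, Finset.sum_sub_distrib, sub_eval, sum_eval]

end ListForm.IsForm

/-! ### Twilled algebras in terms of compatibility conditions -/

namespace AlmostTwilledPre

variable {R A L' L'' : Type*} [CommRing R] [CommRing A] [Algebra R A]
  [AddCommGroup L'] [Module R L'] [Module A L'] [IsScalarTower R A L']
  [AddCommGroup L''] [Module R L''] [Module A L''] [IsScalarTower R A L'']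
  (S : AlmostTwilledPre R A L' L'')

/-- The compatibility of the two pairings with the actions on `A`. -/
def AnchorCompatible : Prop := ∀ (x : L') (ξ : L'') (a : A),
  S.pre'.anchor x (S.pre''.anchor ξ a) - S.pre''.anchor ξ (S.pre'.anchor x a) =
    S.pre''.anchor (S.conn'.act x ξ) a - S.pre'.anchor (S.conn''.act ξ x) a

/-- The compatibility of the pairing `L'' ⊗ L' → L'` with the bracket of `L'`. -/
def BracketCompatible' : Prop := ∀ (ξ : L'') (x y : L'),
  S.conn''.act ξ (S.pre'.bracket x y) = S.pre'.bracket (S.conn''.act ξ x) y +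
    S.pre'.bracket x (S.conn''.act ξ y) + S.conn''.act (S.conn'.act y ξ) x -
      S.conn''.act (S.conn'.act x ξ) y

/-- The compatibility of the pairing `L' ⊗ L'' → L''` with the bracket of `L''`. -/
def BracketCompatible'' : Prop := ∀ (x : L') (ξ η : L''),
  S.conn'.act x (S.pre''.bracket ξ η) = S.pre''.bracket (S.conn'.act x ξ) η +
    S.pre''.bracket ξ (S.conn'.act x η) + S.conn'.act (S.conn''.act η x) ξ -
      S.conn'.act (S.conn''.act ξ x) η

theorem sum_bracket (u v : L' × L'') : S.sum.bracket u v =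
    (S.pre'.bracket u.1 v.1 + S.conn''.act u.2 v.1 - S.conn''.act v.2 u.1,
      S.pre''.bracket u.2 v.2 + S.conn'.act u.1 v.2 - S.conn'.act v.1 u.2) := rfl

theorem sum_anchor (u : L' × L'') :
    S.sum.anchor u = S.pre'.anchor u.1 + S.pre''.anchor u.2 := rfl

/-- Each axiom is a component of an axiom of the sum: arguments from one summand give the
Lie-Rinehart identities, two arguments from one summand and one from the other give flatness. -/
theorem isAlmostTwilled_of_sum (h : S.sum.IsLieRinehart) : S.IsAlmostTwilled where
  isLieRinehart' :=
    { jacobi := fun x y z => by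
        have := congrArg Prod.fst (h.jacobi (x, 0) (y, 0) (z, 0))
        simpa [sum_bracket] using this
      anchor_bracket := fun x y => by
        have := h.anchor_bracket (x, 0) (y, 0)
        simpa [sum_bracket, sum_anchor] using this }
  isLieRinehart'' :=
    { jacobi := fun x y z => by
        have := congrArg Prod.snd (h.jacobi (0, x) (0, y) (0, z))
        simpa [sum_bracket] using this
      anchor_bracket := fun x y => by
        have := h.anchor_bracket (0, x) (0, y)
        simpa [sum_bracket, sum_anchor] using this }
  isFlat' x y ξ := by
    have := congrArg Prod.snd (h.jacobi (x, 0) (y, 0) (0, ξ))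
    simp [sum_bracket] at this
    rw [this, add_sub_cancel_right]
  isFlat'' ξ η x := by
    have := congrArg Prod.fst (h.jacobi (0, ξ) (0, η) (x, 0))
    simp [sum_bracket] at this
    rw [this, add_sub_cancel_right]

theorem isTwilled_of_sum (h : S.sum.IsLieRinehart) : S.IsTwilled :=
  { S.isAlmostTwilled_of_sum h with isLieRinehart_sum := h }

theorem anchorCompatible_of_sum (h : S.sum.IsLieRinehart) : S.AnchorCompatible := by
  intro x ξ a
  have := congrArg (fun D => D a) (h.anchor_bracket (x, 0) (0, ξ))
  simp [sum_bracket, sum_anchor, Derivation.commutator_apply] at this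
  rw [← this]
  abel

theorem bracketCompatible'_of_sum (h : S.sum.IsLieRinehart) : S.BracketCompatible' := by
  intro ξ x y
  have := congrArg Prod.fst (h.jacobi (0, ξ) (x, 0) (y, 0))
  simp [sum_bracket] at this
  rw [this]
  abel

theorem bracketCompatible''_of_sum (h : S.sum.IsLieRinehart) : S.BracketCompatible'' := by
  intro x ξ η
  have := congrArg Prod.snd (h.jacobi (x, 0) (0, ξ) (0, η))
  simp [sum_bracket] at this
  rw [this]
  abel

/-- In the expanded axioms the terms with unmixed arguments cancel by the two Lie-Rinehart
structures. The mixed terms cancel by flatness and by the three conditions. -/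
theorem isLieRinehart_sum_of_compatible (h : S.IsAlmostTwilled) (h₁ : S.AnchorCompatible)
    (h₂ : S.BracketCompatible') (h₃ : S.BracketCompatible'') : S.sum.IsLieRinehart where
  jacobi := by
    rintro ⟨x, ξ⟩ ⟨y, η⟩ ⟨z, ζ⟩
    simp only [sum_bracket]
    apply Prod.ext
    · simp only [Prod.fst_add, map_add, map_sub, LinearMap.add_apply, LinearMap.sub_apply,
        h₂ _ _ _, h.isFlat'' _ _ _, h.isLieRinehart'.jacobi x y z]
      rw [PolyAlg.pre_bracket_skew S.pre' (S.conn''.act ζ x) y]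
      abel
    · simp only [Prod.snd_add, map_add, map_sub, LinearMap.add_apply, LinearMap.sub_apply,
        h₃ _ _ _, h.isFlat' _ _ _, h.isLieRinehart''.jacobi ξ η ζ]
      rw [PolyAlg.pre_bracket_skew S.pre'' (S.conn'.act z ξ) η]
      abel
  anchor_bracket := by
    rintro ⟨x, ξ⟩ ⟨y, η⟩
    ext a
    simp only [sum_bracket, sum_anchor, map_add, map_sub, h.isLieRinehart'.anchor_bracket,
      h.isLieRinehart''.anchor_bracket, Derivation.add_apply, Derivation.sub_apply,
      Derivation.commutator_apply]
    have e₁ := h₁ x η a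
    have e₂ := h₁ y ξ a
    linear_combination -e₁ + e₂

end AlmostTwilledPre

/-! ### The failure of the differential to be a derivation of the bracket -/

namespace PolyAlg

variable {R A L' L'' : Type*} [CommRing R] [CommRing A] [Algebra R A]
  [AddCommGroup L'] [Module R L'] [Module A L'] [IsScalarTower R A L']
  [AddCommGroup L''] [Module R L''] [Module A L''] [IsScalarTower R A L'']
  (S : AlmostTwilledPre R A L' L'') (B : DualBasisData A L')
  [Module.Finite A L'] [Module.Projective A L']

section Compatibility

variable {a b c : ZMod 2} {x y z : PolyAlg R A L' L''}

/-- The failure of the Lie-Rinehart operator to be a derivation of the bracket. -/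
def compatibilityDefect (a : ZMod 2) (x y : PolyAlg R A L' L'') : PolyAlg R A L' L'' :=
  differential S (brac S B x y) - brac S B (differential S x) y +
    paritySign a • brac S B x (differential S y)

/-- The differential and the bracket with `x` are derivations, hence so is their graded commutator;
the bracket with the differential of `x` is one of the same parity. -/
theorem compatibilityDefect_mul (hx : Deg a x) (hy : Deg b y) (z : PolyAlg R A L' L'') :
    compatibilityDefect S B a x (y * z) = compatibilityDefect S B a x y * z +
      paritySign (a * b) • (y * compatibilityDefect S B a x z) := by
  simp only [compatibilityDefect, brac_mul S B hx hy, differential_mul, map_add, map_zsmul,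
    hy.parity_eq, smul_mul_assoc, mul_smul_comm,
    (hx.brac S B hy).parity_eq, brac_mul S B (hx.differential S) hy,
    brac_mul S B hx (hy.differential S), mul_sub, sub_mul, add_mul, mul_add]
  generalize y * brac S B (differential S x) z = u₁
  generalize y * brac S B x (differential S z) = u₂
  generalize y * differential S (brac S B x z) = u₃
  generalize differential S (brac S B x y) * z = u₄
  generalize brac S B (differential S x) y * z = u₅
  generalize brac S B x (differential S y) * z = u₆
  generalize differential S y * brac S B x z = u₇
  generalize brac S B x y * differential S z = u₈
  rcases parity_eq_zero_or_one a with rfl | rfl <;>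
    rcases parity_eq_zero_or_one b with rfl | rfl <;>
    simp only [one_add_one_parity, zero_add, add_zero, mul_one, mul_zero, paritySign_zero,
      paritySign_one, one_smul, neg_smul, zero_mul] <;> abel

theorem compatibilityDefect_symm (hx : Deg a x) (hy : Deg b y)
    (h : compatibilityDefect S B a x y = 0) : compatibilityDefect S B b y x = 0 := by
  have e : compatibilityDefect S B b y x =
      -(paritySign ((a + 1) * (b + 1)) • compatibilityDefect S B a x y) := by
    rw [compatibilityDefect, compatibilityDefect, brac_skew S B hy hx,
      brac_skew S B (hy.differential S) hx, brac_skew S B hy (hx.differential S), map_neg,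
      map_zsmul]
    generalize differential S (brac S B x y) = u₁
    generalize brac S B (differential S x) y = u₂
    generalize brac S B x (differential S y) = u₃
    rcases parity_eq_zero_or_one a with rfl | rfl <;>
      rcases parity_eq_zero_or_one b with rfl | rfl <;>
      simp only [one_add_one_parity, zero_add, add_zero, mul_one, mul_zero, paritySign_zero,
        paritySign_one, one_smul, neg_smul, zero_mul] <;> abel
  rw [e, h, smul_zero, neg_zero]

/-- The defect is a derivation in the second argument and symmetric up to sign, so it is tested on
pairs of generators. Two scalar forms contribute nothing, since all brackets that occur have
exterior degree zero in both arguments. -/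
theorem compatibilityDefect_eq_zero
    (hvv : ∀ x y : L', compatibilityDefect S B 1 (vec R L'' x) (vec R L'' y) = 0)
    (hvs : ∀ (x : L') (p : ℕ) (α : L'' [⋀^Fin p]→ₗ[A] A),
      compatibilityDefect S B 1 (vec R L'' x) (scal R L' α) = 0) (hx : Deg a x)
    (y : PolyAlg R A L' L'') : compatibilityDefect S B a x y = 0 := by
  have hz0 : ∀ a (x : PolyAlg R A L' L''), compatibilityDefect S B a x 0 = 0 := by
    intro a x; simp [compatibilityDefect]
  have hadd : ∀ a (x y z : PolyAlg R A L' L''), compatibilityDefect S B a x (y + z) =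
      compatibilityDefect S B a x y + compatibilityDefect S B a x z := by
    intro a x y z; simp only [compatibilityDefect, map_add, smul_add]; abel
  have key : ∀ b y, Deg b y → compatibilityDefect S B a x y = 0 := by
    intro b y hy
    refine Deg.induction_pair (P := fun a b x y => compatibilityDefect S B a x y = 0)
      (fun a b x y hx hy h => compatibilityDefect_symm S B hx hy h) (fun a b x => hz0 a x)
      ?_ ?_ ?_ (fun x p α => hvs x p α) (fun x y => hvv x y) hx hy
    · intro a b x y z _ _ _ h h'
      rw [hadd, h, h', add_zero]
    · intro a b c x y z hx hy hz h h'
      rw [compatibilityDefect_mul S B hx hy, h, h', zero_mul, mul_zero, smul_zero, add_zero]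
    · intro p p' α β
      rw [compatibilityDefect, brac_eq_zero S B (scal_mem α) (scal_mem β),
        brac_eq_zero S B (differential_mem S (scal_mem α)) (scal_mem β),
        brac_eq_zero S B (scal_mem α) (differential_mem S (scal_mem β))]
      simp
  induction y using induction_hom with
  | zero => exact hz0 _ _
  | add z w hz hw => rw [hadd, hz, hw, add_zero]
  | hom p q z hz => exact key _ z (deg_of_mem hz)

end Compatibility

theorem contr_differential_vec (x : L') (ξ : L'') :
    ListForm.contr ξ (toList (differential S (vec R L'' x))) =
      toList (vec R L'' (S.conn''.act ξ x) : PolyAlg R A L' L'') := by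
  rw [toList_differential, ListForm.contr_ce, contr_toList_vec, map_zero, sub_zero]
  have := toList_lieDerivative (S.pre''.anchor ξ) (S.pre''.bracket ξ) (S.conn''.act ξ)
      (S.pre''.bracket_smul ξ) (S.conn''.act_smul ξ) (vec R L'' x)
  rw [← this, lieDerivative_vec]

/-- The coefficients of the bracket with `d x`, for `x ∈ L'`. -/
def dCoeff (x : L') (i : Fin B.n) : PolyList A L' L'' :=
  toList (parity (contract (B.θ i) (differential S (vec R L'' x))))

theorem dCoeff_nil (x : L') (i : Fin B.n) : (dCoeff S B x i).eval [] = 0 := by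
  rw [dCoeff, toList_parity, ListForm.parity_eval, toList_contract, ListForm.odd_eval,
    toList_differential, ListForm.ce_nil]
  simp

theorem parity_dCoeff (x : L') (i : Fin B.n) :
    ListForm.parity (dCoeff S B x i) = -dCoeff S B x i := by
  have h : contract (B.θ i) (differential S (vec R L'' x)) ∈ hom R A L' L'' 1 0 :=
    contract_mem _ (differential_mem S (vec_mem x))
  rw [dCoeff, ← toList_parity, parity_parity, parity_of_mem h]
  simp

theorem contr_dCoeff (x : L') (i : Fin B.n) (ξ : L'') :
    ListForm.contr ξ (dCoeff S B x i) = B.θ i (S.conn''.act ξ x) • (1 : PolyList A L' L'') := by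
  rw [dCoeff, toList_parity, ListForm.contr_parity, toList_contract, ListForm.contr_odd,
    contr_differential_vec, map_neg, neg_neg, ← toList_contract, ← toList_parity, contract_vec,
    parity_cst, toList_cst]

/-- The action of `x ∈ L'` on functions on lists. -/
abbrev listLie' (x : L') : PolyList A L' L'' →+ PolyList A L' L'' :=
  ListForm.lie (exteriorDerivationHom (S.pre'.anchor x) (S.pre'.bracket x) (S.pre'.bracket_smul x))
    (S.conn'.act x)

/-- The action of `ξ ∈ L''` on functions on lists. -/
abbrev listLie'' (ξ : L'') : PolyList A L' L'' →+ PolyList A L' L'' :=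
  ListForm.lie (exteriorAct S ξ) (S.pre''.bracket ξ)

/-- The Lie-Rinehart operator on functions on lists. -/
abbrev listCE : PolyList A L' L'' →+ PolyList A L' L'' :=
  ListForm.ce (exteriorAct S) fun ξ η => S.pre''.bracket ξ η

/-- The failure of the Lie-Rinehart operator to commute with `x ∈ L'`. -/
def listDefect (x : L') (F : PolyList A L' L'') : PolyList A L' L'' :=
  listCE S (listLie' S x F) - ∑ i, dCoeff S B x i * listLie' S (B.e i) F -
    listLie' S x (listCE S F)

/-- The curvature of the two actions. -/
def listCurvature (x : L') (ξ : L'') (F : PolyList A L' L'') : PolyList A L' L'' :=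
  listLie'' S ξ (listLie' S x F) - listLie' S x (listLie'' S ξ F) +
    listLie'' S (S.conn'.act x ξ) F - listLie' S (S.conn''.act ξ x) F -
    ∑ i, dCoeff S B x i * ListForm.contr (S.conn'.act (B.e i) ξ) F

/-- A scalar form is annihilated by the contractions with `θᵢ`, so the half of the bracket that
involves `nabla` disappears. -/
theorem toList_compatibilityDefect_scal (x : L') {p : ℕ} (α : L'' [⋀^Fin p]→ₗ[A] A) :
    toList (compatibilityDefect S B 1 (vec R L'' x) (scal R L' α)) =
      listDefect S B x (toList (scal R L' α : PolyAlg R A L' L'')) := by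
  rw [compatibilityDefect, listDefect, brac_vec, brac_apply (x := differential S _)]
  simp only [contract_of_mem_zero _ (scal_mem α), mul_zero, sub_zero, map_add, map_sub, map_sum,
    toList_differential, lieVec, toList_lieDerivative, toList_mul, paritySign_one, neg_smul,
    one_smul, map_neg, dCoeff]
  rw [← sub_eq_add_neg]

theorem smul_one_mul_list (r : A) (F : PolyList A L' L'') : r • (1 : PolyList A L' L'') * F = r • F :=
  ListForm.smul_one_mul (fun r u => map_smul (gradeInvolution A L') r u) r F

section Scalar

variable {p : ℕ} {F : PolyList A L' L''}

theorem sum_smul_listLie' (h : ListForm.IsForm (⋀[A]^0 L') p F) (a : Fin B.n → A) :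
    ∑ i, a i • listLie' S (B.e i) F = listLie' S (∑ i, a i • B.e i) F := by
  refine h.sum_smul_lie (fun u hu => ?_) (fun ξ => ?_)
  · rw [ExteriorAlgebra.exteriorPower, pow_zero, Submodule.mem_one] at hu
    obtain ⟨r, rfl⟩ := hu
    simp only [exteriorDerivationHom_algebraMap, anchor_sum_smul_apply]
    simp only [map_sum, map_mul, Algebra.smul_def]
  · simp only [map_sum, map_smul, LinearMap.sum_apply, LinearMap.smul_apply]

/-- Cartan's relations turn the commutator of `d''` with the action of `x` into a commutator of two
actions. Up to terms in the contracted form this is the curvature. -/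
theorem contr_listDefect (h : ListForm.IsForm (⋀[A]^0 L') p F) (x : L') (ξ : L'') :
    ListForm.contr ξ (listDefect S B x F) =
      listCurvature S B x ξ F - listDefect S B x (ListForm.contr ξ F) := by
  -- The contracted coefficients are the coordinates of `ξ · x`, and on scalar forms the action is
  -- linear over `A`.
  have e : ∑ i, B.θ i (S.conn''.act ξ x) • listLie' S (B.e i) F =
      listLie' S (S.conn''.act ξ x) F := by
    rw [sum_smul_listLie' S B h, B.sum_eq]
  simp only [listDefect, listCurvature, map_sub, map_sum, ListForm.contr_ce, ListForm.contr_lie,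
    ListForm.contr_mul, contr_dCoeff, parity_dCoeff, smul_one_mul_list, Finset.sum_add_distrib, e,
    mul_sub, neg_mul, Finset.sum_sub_distrib, Finset.sum_neg_distrib]
  abel

/-- The curvature commutes with `i_η` up to the contraction with a vector that measures the failure
of `BracketCompatible''`. Its value on functions, in `listCurvature_nil`, measures the failure of
`AnchorCompatible`. -/
theorem contr_listCurvature (h : ListForm.IsForm (⋀[A]^0 L') p F) (x : L') (ξ η : L'') :
    ListForm.contr η (listCurvature S B x ξ F) =
      listCurvature S B x ξ (ListForm.contr η F) + ListForm.contr
        (S.conn'.act x (S.pre''.bracket ξ η) - S.pre''.bracket ξ (S.conn'.act x η) -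
          S.pre''.bracket (S.conn'.act x ξ) η + S.conn'.act (S.conn''.act ξ x) η -
          S.conn'.act (S.conn''.act η x) ξ) F := by
  have e : ∑ i, B.θ i (S.conn''.act η x) • ListForm.contr (S.conn'.act (B.e i) ξ) F =
      ListForm.contr (S.conn'.act (S.conn''.act η x) ξ) F := by
    rw [← h.contr_sum_smul]
    conv_rhs => rw [← B.sum_eq (S.conn''.act η x)]
    simp only [map_sum, map_smul, LinearMap.sum_apply, LinearMap.smul_apply]
  have e' : ∀ i, ListForm.contr η (ListForm.contr (S.conn'.act (B.e i) ξ) F) =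
      -ListForm.contr (S.conn'.act (B.e i) ξ) (ListForm.contr η F) := fun i =>
    h.contr_contr _ _
  simp only [listCurvature, map_sub, map_add, map_sum, ListForm.contr_lie,
    ListForm.contr_mul, contr_dCoeff, parity_dCoeff, smul_one_mul_list, Finset.sum_add_distrib, e,
    e', h.contr_sub, h.contr_add, mul_neg, neg_mul, neg_neg]
  abel

theorem listCurvature_nil (x : L') (ξ : L'') {r : A}
    (hr : F.eval [] = algebraMap A _ r) : (listCurvature S B x ξ F).eval [] =
      algebraMap A _ (S.pre''.anchor ξ (S.pre'.anchor x r) - S.pre'.anchor x (S.pre''.anchor ξ r) +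
        S.pre''.anchor (S.conn'.act x ξ) r - S.pre'.anchor (S.conn''.act ξ x) r) := by
  simp only [listCurvature, ListForm.sub_eval, ListForm.add_eval, ListForm.sum_eval,
    ListForm.lie_nil, ListForm.mul_nil, hr, exteriorDerivationHom_algebraMap, dCoeff_nil, zero_mul,
    Finset.sum_const_zero, sub_zero, map_sub, map_add]

theorem listCurvature_eq_zero (h₁ : S.AnchorCompatible) (h₃ : S.BracketCompatible'')
    (h : ListForm.IsForm (⋀[A]^0 L') p F) (x : L') (ξ : L'') : listCurvature S B x ξ F = 0 := by
  apply ListForm.ext_eval; intro l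
  induction l generalizing p F with
  | nil =>
    cases p with
    | zero =>
      have hF := h.1
      rw [ExteriorAlgebra.exteriorPower, pow_zero, Submodule.mem_one] at hF
      obtain ⟨r, hr⟩ := hF
      rw [listCurvature_nil S B x ξ hr.symm, ListForm.zero_eval]
      have e : S.pre''.anchor ξ (S.pre'.anchor x r) - S.pre'.anchor x (S.pre''.anchor ξ r) +
          S.pre''.anchor (S.conn'.act x ξ) r - S.pre'.anchor (S.conn''.act ξ x) r = 0 := by
        linear_combination -h₁ x ξ r
      rw [e, map_zero]
    | succ p =>
      simp only [listCurvature, ListForm.sub_eval, ListForm.add_eval, ListForm.sum_eval,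
        ListForm.lie_nil, ListForm.mul_nil, h.1, map_zero, dCoeff_nil, zero_mul,
        Finset.sum_const_zero, sub_zero, add_zero, ListForm.zero_eval]
  | cons η l ih =>
    obtain ⟨p', h'⟩ := h.exists_contr η
    have hZ : S.conn'.act x (S.pre''.bracket ξ η) - S.pre''.bracket ξ (S.conn'.act x η) -
          S.pre''.bracket (S.conn'.act x ξ) η + S.conn'.act (S.conn''.act ξ x) η -
          S.conn'.act (S.conn''.act η x) ξ = 0 := by
      rw [h₃ x ξ η]; abel
    rw [ListForm.eval_cons, contr_listCurvature S B h, ListForm.add_eval, ih h', hZ,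
      h.contr_zero]
    simp

theorem listDefect_nil (x : L') (F : PolyList A L' L'') : (listDefect S B x F).eval [] = 0 := by
  simp only [listDefect, ListForm.sub_eval, ListForm.sum_eval, ListForm.lie_nil, ListForm.mul_nil,
    ListForm.ce_nil, dCoeff_nil, map_zero, zero_mul, Finset.sum_const_zero, sub_zero]

theorem listDefect_eq_zero (h₁ : S.AnchorCompatible) (h₃ : S.BracketCompatible'')
    (h : ListForm.IsForm (⋀[A]^0 L') p F) (x : L') : listDefect S B x F = 0 := by
  apply ListForm.ext_eval; intro l
  induction l generalizing p F with
  | nil => exact listDefect_nil S B x F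
  | cons η l ih =>
    obtain ⟨p', h'⟩ := h.exists_contr η
    rw [ListForm.eval_cons, contr_listDefect S B h, ListForm.sub_eval, ih h',
      listCurvature_eq_zero S B h₁ h₃ h]
    simp

end Scalar

/-- Contracting the defect for two elements of `L'` gives an element of `L'`, namely the failure of
`BracketCompatible'`. -/
theorem contr_compatibilityDefect_vec (x y : L') (ξ : L'') :
    ListForm.contr ξ (toList (compatibilityDefect S B 1 (vec R L'' x) (vec R L'' y))) =
      toList (vec R L'' (S.conn''.act ξ (S.pre'.bracket x y) -
        (S.pre'.bracket (S.conn''.act ξ x) y + S.pre'.bracket x (S.conn''.act ξ y) +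
          S.conn''.act (S.conn'.act y ξ) x - S.conn''.act (S.conn'.act x ξ) y)) :
          PolyAlg R A L' L'') := by
  -- Compared with the bracket of `ξ · x` and `y`, the connection `nabla` also acts on the argument
  -- of the differential of `x`. This gives `∑ θᵢ(y) (eᵢ · ξ) · x = (y · ξ) · x`.
  have h1 : ListForm.contr ξ (toList (brac S B (differential S (vec R L'' x)) (vec R L'' y))) =
      toList (vec R L'' (S.pre'.bracket (S.conn''.act ξ x) y) +
        vec R L'' (S.conn''.act (S.conn'.act y ξ) x) : PolyAlg R A L' L'') := by
    have h2 : vec R L'' (S.conn''.act (S.conn'.act y ξ) x) =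
        ∑ i, cst R L' L'' (B.θ i y) * vec R L'' (S.conn''.act (S.conn'.act (B.e i) ξ) x) := by
      conv_lhs => rw [← B.sum_eq y]
      simp only [cst_mul_vec, map_sum, map_smul, LinearMap.sum_apply, LinearMap.smul_apply, vec_sum]
    rw [h2, ← brac_vec_vec S B, brac_apply, brac_apply]
    simp only [contract_vec, nabla, lieVec, mul_cst, parity_cst, map_sum, map_sub, map_add,
      ← Finset.sum_add_distrib]
    refine Finset.sum_congr rfl fun i _ => ?_
    rw [toList_mul, ListForm.contr_mul]
    simp only [toList_cst_mul, toList_lieDerivative, ListForm.contr_lie, ListForm.contr_smul,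
      contr_toList_vec, contr_differential_vec, map_zero, sub_zero, mul_zero, add_zero]
    rw [show ListForm.contr ξ (toList (parity (contract (B.θ i)
      (differential S (vec R L'' x))))) = _ from contr_dCoeff S B x i ξ, smul_one_mul_list,
      smul_sub]
    abel
  rw [compatibilityDefect, map_add, map_sub, map_add, map_sub, h1, brac_vec_vec,
    contr_differential_vec, brac_vec, lieVec]
  simp only [paritySign_one, neg_smul, one_smul, map_neg, toList_lieDerivative, ListForm.contr_lie,
    contr_differential_vec, vec_sub, vec_add, map_sub, map_add]
  rw [← toList_lieDerivative _ _ _ (S.conn'.act_smul x) (S.pre'.bracket_smul x), lieDerivative_vec]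
  abel

end PolyAlg

/-! ### Twilled algebras and differential Gerstenhaber algebras -/

namespace PolyAlg

variable {R A L' L'' : Type*} [CommRing R] [CommRing A] [Algebra R A]
  [AddCommGroup L'] [Module R L'] [Module A L'] [IsScalarTower R A L']
  [AddCommGroup L''] [Module R L''] [Module A L''] [IsScalarTower R A L'']

theorem vec_zero : (vec R L'' (0 : L') : PolyAlg R A L' L'') = 0 := by
  have := vec_sub (R := R) (A := A) (L'' := L'') (0 : L') 0
  rwa [sub_self, sub_self] at this

theorem contr_toList_scal {p : ℕ} (α : L'' [⋀^Fin (p + 1)]→ₗ[A] A) (ξ : L'') :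
    ListForm.contr ξ (toList (scal R L' α : PolyAlg R A L' L'')) =
      (-1 : ℤ) ^ (p + 1) • toList (scal R L' (α.curryLeft ξ) : PolyAlg R A L' L'') := by
  rw [toList_scal, contr_homToList_succ, toList_scal]
  rfl

theorem contr_toList_scal_zero (α : L'' [⋀^Fin 0]→ₗ[A] A) (ξ : L'') :
    ListForm.contr ξ (toList (scal R L' α : PolyAlg R A L' L'')) = 0 := by
  rw [toList_scal, contr_homToList_zero]

variable (S : AlmostTwilledPre R A L' L'') (B : DualBasisData A L')
  [Module.Finite A L'] [Module.Projective A L']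

theorem compatibilityDefect_eq_zero_of_compatible (h₁ : S.AnchorCompatible)
    (h₂ : S.BracketCompatible') (h₃ : S.BracketCompatible'') {a : ZMod 2}
    {x : PolyAlg R A L' L''} (hx : Deg a x) (y : PolyAlg R A L' L'') :
    compatibilityDefect S B a x y = 0 := by
  refine compatibilityDefect_eq_zero S B (fun x y => ?_) (fun x p α => ?_) hx y
  · apply toList_injective
    apply ListForm.ext_contr
    -- Because of its form degree one, the defect vanishes on the empty list and is determined by
    -- its contractions.
    · have hm : compatibilityDefect S B 1 (vec R L'' x) (vec R L'' y) ∈ hom R A L' L'' 1 1 := by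
        have e₁ := differential_mem S (brac_mem S B (r := 1) (vec_mem x) (vec_mem y) rfl)
        have e₂ := brac_mem S B (r := 1) (differential_mem S (vec_mem x)) (vec_mem y) rfl
        have e₃ := brac_mem S B (r := 1) (vec_mem x) (differential_mem S (vec_mem y)) rfl
        exact add_mem (sub_mem e₁ e₂) (zsmul_mem e₃ _)
      rw [(isForm_toList hm).1, map_zero, ListForm.zero_eval]
    · intro ξ
      rw [contr_compatibilityDefect_vec, h₂ ξ x y, sub_self, vec_zero, map_zero, map_zero]
  · apply toList_injective
    rw [toList_compatibilityDefect_scal, map_zero]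
    exact listDefect_eq_zero S B h₁ h₃ (isForm_toList (scal_mem α)) x

theorem differential_mul_of_mem {p q : ℕ} {x : PolyAlg R A L' L''} (y : PolyAlg R A L' L'')
    (hx : x ∈ hom R A L' L'' p q) : differential S (x * y) =
      differential S x * y + (-1 : ℤ) ^ (p + q) • (x * differential S y) := by
  rw [differential_mul, parity_of_mem hx, smul_mul_assoc]

theorem differential_brac (h₁ : S.AnchorCompatible) (h₂ : S.BracketCompatible')
    (h₃ : S.BracketCompatible'') {p q : ℕ} {x : PolyAlg R A L' L''} (y : PolyAlg R A L' L'')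
    (hx : x ∈ hom R A L' L'' p q) : differential S (brac S B x y) =
      brac S B (differential S x) y - (-1 : ℤ) ^ (p + q) • brac S B x (differential S y) := by
  have e := compatibilityDefect_eq_zero_of_compatible S B h₁ h₂ h₃ (deg_of_mem hx) y
  rw [compatibilityDefect, sub_add, sub_eq_zero] at e
  rw [e, ← paritySign_natCast]
  push_cast
  rfl

theorem isDifferentialGerstenhaber_brac (h : S.IsTwilled) :
    S.IsDifferentialGerstenhaber (brac S B) :=
  { isGerstenhaber_brac S B h.toIsAlmostTwilled with
    d_mem := fun hx => differential_mem S hx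
    d_d := fun x => differential_differential S h.isLieRinehart'' h.isFlat'' x
    d_mul := fun y hx => differential_mul_of_mem S y hx
    d_bracket := fun y hx => differential_brac S B
        (S.anchorCompatible_of_sum h.isLieRinehart_sum)
        (S.bracketCompatible'_of_sum h.isLieRinehart_sum)
        (S.bracketCompatible''_of_sum h.isLieRinehart_sum) y hx }

section Converse

variable (h : ∀ (x : L') (p : ℕ) (α : L'' [⋀^Fin p]→ₗ[A] A),
  compatibilityDefect S B 1 (vec R L'' x) (scal R L' α) = 0)
include h

/-- On functions nothing is left to be contracted, so the contracted defect is the curvature itself.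
-/
theorem listCurvature_scal_zero (x : L') (ξ : L'') (α : L'' [⋀^Fin 0]→ₗ[A] A) :
    listCurvature S B x ξ (toList (scal R L' α : PolyAlg R A L' L'')) = 0 := by
  have e := contr_listDefect S B (isForm_toList (scal_mem (R := R) (L' := L') α)) x ξ
  rw [← toList_compatibilityDefect_scal, h, map_zero, map_zero, contr_toList_scal_zero] at e
  rw [eq_comm, sub_eq_zero] at e
  rw [e]
  simp [listDefect]

theorem anchorCompatible_of_compatibilityDefect : S.AnchorCompatible := by
  intro x ξ r
  have e := listCurvature_scal_zero S B h x ξ (AlternatingMap.constOfIsEmpty A L'' (Fin 0) r)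
  have e' := listCurvature_nil S B x ξ (scal_zero_eval
    (R := R) (L' := L') (AlternatingMap.constOfIsEmpty A L'' (Fin 0) r))
  rw [e, ListForm.zero_eval, eq_comm, ← map_zero (algebraMap A (ExteriorAlgebra A L')),
    ExteriorAlgebra.algebraMap_inj, AlternatingMap.constOfIsEmpty_apply] at e'
  change S.pre''.anchor ξ (S.pre'.anchor x r) - S.pre'.anchor x (S.pre''.anchor ξ r) +
    S.pre''.anchor (S.conn'.act x ξ) r - S.pre'.anchor (S.conn''.act ξ x) r = 0 at e'
  linear_combination -e'

/-- The defect vanishes on a one-form `φ` and on its contractions, hence so does the curvature on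
`φ`. Contracting once more leaves `φ` evaluated on the failure of the condition, and property P
applies to all `φ` together. -/
theorem bracketCompatible''_of_compatibilityDefect (hP : PropertyP A L'') :
    S.BracketCompatible'' := by
  intro x ξ η
  refine sub_eq_zero.mp (hP _ fun φ => ?_)
  have hF : ∀ ζ, ListForm.contr ζ (toList (scal R L'
      (AlternatingMap.ofSubsingleton A L'' A (0 : Fin 1) φ) : PolyAlg R A L' L'')) =
      -toList (scal R L' (AlternatingMap.constOfIsEmpty A L'' (Fin 0) (φ ζ))) := by
    intro ζ
    rw [contr_toList_scal, zero_add, pow_one, neg_smul, one_smul]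
    rfl
  have hm := isForm_toList (scal_mem (R := R) (L' := L')
    (AlternatingMap.ofSubsingleton A L'' A (0 : Fin 1) φ))
  have hneg : ∀ (x : L') (F : PolyList A L' L''), listDefect S B x (-F) = -listDefect S B x F := by
    intro x F
    simp only [listDefect, map_neg, mul_neg, Finset.sum_neg_distrib]
    abel
  have hneg' : ∀ (x : L') (ξ : L'') (F : PolyList A L' L''),
      listCurvature S B x ξ (-F) = -listCurvature S B x ξ F := by
    intro x ξ F
    simp only [listCurvature, map_neg, mul_neg, Finset.sum_neg_distrib]
    abel
  have e : listCurvature S B x ξ (toList (scal R L'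
      (AlternatingMap.ofSubsingleton A L'' A (0 : Fin 1) φ) : PolyAlg R A L' L'')) = 0 := by
    have e := contr_listDefect S B hm x ξ
    rwa [hF, hneg, ← toList_compatibilityDefect_scal, ← toList_compatibilityDefect_scal, h, h,
      map_zero, map_zero, neg_zero, sub_zero, eq_comm] at e
  have e' := contr_listCurvature S B hm x ξ η
  rw [e, map_zero, hF, hF, hneg', listCurvature_scal_zero S B h, neg_zero, zero_add, eq_comm,
    neg_eq_zero] at e'
  have e'' := congrArg (fun F => F.eval []) e'
  simp only [scal_zero_eval, ListForm.zero_eval, AlternatingMap.constOfIsEmpty_apply] at e''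
  rw [← map_zero (algebraMap A (ExteriorAlgebra A L')), ExteriorAlgebra.algebraMap_inj] at e''
  rw [← e'']
  congr 1
  abel

end Converse

/-- The failure of this condition lies in `L'`, which embeds into the algebra of forms; linear forms
are not needed to detect it. -/
theorem bracketCompatible'_of_compatibilityDefect
    (h : ∀ x y : L', compatibilityDefect S B 1 (vec R L'' x) (vec R L'' y) = 0) :
    S.BracketCompatible' := by
  intro ξ x y
  refine sub_eq_zero.mp (vec_injective (R := R) (A := A) (L'' := L'') (toList_injective ?_))
  rw [← contr_compatibilityDefect_vec S B, h, map_zero, map_zero, vec_zero, map_zero]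

theorem isTwilled_of_isDifferentialGerstenhaber (hP : PropertyP A L'') (hS : S.IsAlmostTwilled)
    (h : S.IsDifferentialGerstenhaber (brac S B)) : S.IsTwilled := by
  have hd : ∀ (x : L') (y : PolyAlg R A L' L''),
      compatibilityDefect S B 1 (vec R L'' x) y = 0 := by
    intro x y
    have e : differential S (brac S B (vec R L'' x) y) =
        brac S B (differential S (vec R L'' x)) y -
          (-1 : ℤ) ^ (0 + 1) • brac S B (vec R L'' x) (differential S y) :=
      h.d_bracket y (vec_mem x)
    rw [compatibilityDefect, e]
    simp
  exact S.isTwilled_of_sum (S.isLieRinehart_sum_of_compatible hS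
    (anchorCompatible_of_compatibilityDefect S B fun x _ α => hd x _)
    (bracketCompatible'_of_compatibilityDefect S B fun x y => hd x _)
    (bracketCompatible''_of_compatibilityDefect S B (fun x _ α => hd x _) hP))

end PolyAlg

/-! ### Existence and uniqueness without reference to a dual basis -/

theorem DualBasisData.nonempty (A N : Type*) [CommRing A] [AddCommGroup N] [Module A N]
    [Module.Finite A N] [Module.Projective A N] : Nonempty (DualBasisData A N) := by
  obtain ⟨n, e, θ, h⟩ := exists_dualBasis A N
  exact ⟨⟨n, e, θ, h⟩⟩

namespace AlmostTwilledPre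

variable {R A L' L'' : Type*} [CommRing R] [CommRing A] [Algebra R A]
  [AddCommGroup L'] [Module R L'] [Module A L'] [IsScalarTower R A L']
  [AddCommGroup L''] [Module R L''] [Module A L''] [IsScalarTower R A L'']
  [Module.Finite A L'] [Module.Projective A L'] (S : AlmostTwilledPre R A L' L'')

theorem exists_isDifferentialGerstenhaber (h : S.IsTwilled) :
    ∃ br, S.IsCrossedProductBracket br ∧ S.IsDifferentialGerstenhaber br := by
  obtain ⟨B⟩ := DualBasisData.nonempty A L'
  exact ⟨_, PolyAlg.isCrossedProductBracket_brac S B, PolyAlg.isDifferentialGerstenhaber_brac S B h⟩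

theorem existsUnique_crossedProductBracket (h : S.IsAlmostTwilled) :
    ∃ br : PolyForms A L' L'' →ₗ[R] PolyForms A L' L'' →ₗ[R] PolyForms A L' L'',
        S.IsCrossedProductBracket br ∧
        (∀ br', S.IsCrossedProductBracket br' → br' = br) ∧
        S.IsGerstenhaber br ∧
        (S.IsTwilled → S.IsDifferentialGerstenhaber br) ∧
        (PropertyP A L'' → S.IsDifferentialGerstenhaber br → S.IsTwilled) := by
  obtain ⟨B⟩ := DualBasisData.nonempty A L'
  exact ⟨PolyAlg.brac S B, PolyAlg.isCrossedProductBracket_brac S B,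
    fun br' h' => PolyAlg.eq_brac S B h', PolyAlg.isGerstenhaber_brac S B h,
    fun hT => PolyAlg.isDifferentialGerstenhaber_brac S B hT,
    fun hP hD => PolyAlg.isTwilled_of_isDifferentialGerstenhaber S B hP h hD⟩

end AlmostTwilledPre

/-! ### Lie-Rinehart algebras decomposed into two subalgebras -/

section Decomposition

variable {R A L : Type*} [CommRing R] [CommRing A] [Algebra R A] [LieRing L] [LieAlgebra R L]
  [Module A L] [LieRingModule L A] [LieRinehartRing A L] [LieRinehartAlgebra R A L]
  {L' L'' : Submodule A L}

theorem coe_projectionOnto_add (h : IsCompl L' L'') (x : L) :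
    (L'.projectionOnto L'' h x : L) + L''.projectionOnto L' h.symm x = x := by
  rw [Submodule.coe_projectionOnto_apply, Submodule.coe_projectionOnto_apply]
  exact Submodule.projection_add_projection_eq_self h x

/-- The addition map `L' × L'' → L` is injective. As both summands are closed under the bracket, it
carries the bracket and the anchor of the sum to those of `L`, from which the axioms are inherited.
-/
theorem AlmostTwilledPre.isLieRinehart_sum_ofDecomposition (h : IsCompl L' L'')
    (h' : ∀ x ∈ L', ∀ y ∈ L', ⁅x, y⁆ ∈ L') (h'' : ∀ x ∈ L'', ∀ y ∈ L'', ⁅x, y⁆ ∈ L'') :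
    (AlmostTwilledPre.ofDecomposition (R := R) L' L'' h).sum.IsLieRinehart := by
  set S := AlmostTwilledPre.ofDecomposition (R := R) L' L'' h
  let g : L' × L'' → L := fun u => u.1 + u.2
  have hg : Function.Injective g := by
    rintro ⟨x, ξ⟩ ⟨y, η⟩ e
    have e₁ := congrArg (L'.projectionOnto L'' h) e
    have e₂ := congrArg (L''.projectionOnto L' h.symm) e
    simp only [g, map_add, Submodule.projectionOnto_apply_left, Submodule.projectionOnto_apply_right,
      add_zero, zero_add] at e₁ e₂
    rw [e₁, e₂]
  have hbr : ∀ u v, g (S.sum.bracket u v) = ⁅g u, g v⁆ := by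
    rintro ⟨x, ξ⟩ ⟨y, η⟩
    have e₁ : (L'.projectionOnto L'' h ⁅(x : L), (y : L)⁆ : L) = ⁅(x : L), (y : L)⁆ := by
      rw [Submodule.projectionOnto_apply_of_mem_left h (h' _ x.2 _ y.2)]
    have e₂ : (L''.projectionOnto L' h.symm ⁅(ξ : L), (η : L)⁆ : L) = ⁅(ξ : L), (η : L)⁆ := by
      rw [Submodule.projectionOnto_apply_of_mem_left h.symm (h'' _ ξ.2 _ η.2)]
    have e₃ := coe_projectionOnto_add h ⁅(x : L), (η : L)⁆
    have e₄ := coe_projectionOnto_add h ⁅(y : L), (ξ : L)⁆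
    change ((L'.projectionOnto L'' h ⁅(x : L), (y : L)⁆ +
      L'.projectionOnto L'' h ⁅(ξ : L), (y : L)⁆ - L'.projectionOnto L'' h ⁅(η : L), (x : L)⁆ : L') :
        L) + ((L''.projectionOnto L' h.symm ⁅(ξ : L), (η : L)⁆ +
      L''.projectionOnto L' h.symm ⁅(x : L), (η : L)⁆ -
        L''.projectionOnto L' h.symm ⁅(y : L), (ξ : L)⁆ : L'') : L) =
      ⁅(x : L) + (ξ : L), (y : L) + (η : L)⁆
    rw [← lie_skew (ξ : L) (y : L), ← lie_skew (η : L) (x : L)]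
    simp only [Submodule.coe_add, Submodule.coe_sub, Submodule.coe_neg, map_neg, e₁, e₂, lie_add,
      add_lie]
    rw [← lie_skew (ξ : L) (y : L)]
    linear_combination (norm := abel) e₃ - e₄
  refine ⟨fun u v w => hg ?_, fun u v => ?_⟩
  · have hadd : ∀ u v, g (u + v) = g u + g v := by
      intro u v
      simp only [g, Prod.fst_add, Prod.snd_add, Submodule.coe_add]
      abel
    rw [hadd, hbr, hbr, hbr, hbr, hbr, hbr, leibniz_lie]
  · have ha : ∀ u a, S.sum.anchor u a = ⁅g u, a⁆ := by
      rintro ⟨x, ξ⟩ a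
      rw [S.sum_anchor]
      exact (add_lie (x : L) (ξ : L) a).symm
    ext a
    rw [Derivation.commutator_apply, ha, ha, ha, ha, ha, hbr, lie_lie]

end Decomposition

namespace PolyAlg

variable {R A L' L'' : Type*} [CommRing R] [CommRing A] [Algebra R A]
  [AddCommGroup L'] [Module R L'] [Module A L'] [IsScalarTower R A L']
  [AddCommGroup L''] [Module R L''] [Module A L''] [IsScalarTower R A L'']
  (S : AlmostTwilledPre R A L' L'')

/-- Up to sign, the difference of the two sides is the square of the differential on the function
`a`, evaluated at `ξ` and `η`. -/
theorem anchor_bracket_of_differential_differential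
    (h : ∀ x : PolyAlg R A L' L'', differential S (differential S x) = 0) (ξ η : L'') (a : A) :
    S.pre''.anchor (S.pre''.bracket ξ η) a =
      S.pre''.anchor ξ (S.pre''.anchor η a) - S.pre''.anchor η (S.pre''.anchor ξ a) := by
  set α := AlternatingMap.constOfIsEmpty A L'' (Fin 0) a
  have e := congrArg (fun x => (toList x).eval [ξ, η]) (h (scal R L' α))
  have e₀ : (toList (scal R L' α : PolyAlg R A L' L'')).eval [] = algebraMap A _ a :=
    scal_zero_eval _
  have e₁ := contr_toList_scal_zero (R := R) (L' := L') α
  simp only [toList_differential, ListForm.eval_cons, ListForm.contr_ce, ListForm.contr_lie, e₁,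
    map_zero, map_sub, ListForm.sub_eval, ListForm.lie_nil, e₀, exteriorDerivationHom_algebraMap,
    ListForm.zero_eval, sub_zero] at e
  simp only [← map_sub] at e
  rw [← map_zero (algebraMap A (ExteriorAlgebra A L')), ExteriorAlgebra.algebraMap_inj] at e
  linear_combination -e

end PolyAlg

/-! ### Integrability of almost complex structures -/

section AlmostComplex

variable {E M : Type*} [NormedAddCommGroup E] [NormedSpace ℝ E]
  [TopologicalSpace M] [ChartedSpace E M]

theorem apply_ofRealFunction (D : ComplexVectorFields E M) (f : RealFunctions E M) :
    D (ofRealFunction f) =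
      ofRealFunction (reField D f) + Complex.I • ofRealFunction (imField D f) :=
  eq_ofRealFunction_add _

theorem reField_lie (D D' : ComplexVectorFields E M) :
    reField ⁅D, D'⁆ = ⁅reField D, reField D'⁆ - ⁅imField D, imField D'⁆ := by
  ext f m
  simp only [reField_apply, Derivation.commutator_apply, apply_ofRealFunction, map_add,
    Derivation.map_smul, Derivation.sub_apply]
  simp [ComplexFunctions.smul_apply, reField_apply, imField_apply]
  ring

theorem imField_lie (D D' : ComplexVectorFields E M) :
    imField ⁅D, D'⁆ = ⁅reField D, imField D'⁆ + ⁅imField D, reField D'⁆ := by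
  ext f m
  simp only [imField_apply, Derivation.commutator_apply, apply_ofRealFunction, map_add,
    Derivation.map_smul, Derivation.add_apply]
  simp [ComplexFunctions.smul_apply, reField_apply, imField_apply]
  ring

theorem reField_complex_smul (c : ℂ) (D : ComplexVectorFields E M) :
    reField (algebraMap ℂ (ComplexFunctions E M) c • D) = c.re • reField D - c.im • imField D := by
  ext f m
  change ((algebraMap ℂ (ComplexFunctions E M) c • D) (ofRealFunction f) m).re = _
  rw [Derivation.smul_apply, smul_eq_mul, ← Algebra.smul_def, ComplexFunctions.smul_apply]
  simp [reField_apply, imField_apply]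

theorem imField_complex_smul (c : ℂ) (D : ComplexVectorFields E M) :
    imField (algebraMap ℂ (ComplexFunctions E M) c • D) = c.re • imField D + c.im • reField D := by
  ext f m
  change ((algebraMap ℂ (ComplexFunctions E M) c • D) (ofRealFunction f) m).im = _
  rw [Derivation.smul_apply, smul_eq_mul, ← Algebra.smul_def, ComplexFunctions.smul_apply]
  simp [reField_apply, imField_apply]

namespace AlmostComplexStructure

variable (S : AlmostComplexStructure E M)

theorem reField_complexJ (D : ComplexVectorFields E M) :
    reField (S.complexJ D) = S.J (reField D) := reField_complexField _ _

theorem imField_complexJ (D : ComplexVectorFields E M) :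
    imField (S.complexJ D) = S.J (imField D) := imField_complexField _ _

/-- The real part of the eigenvalue equation says that `D = X - i J X`; its imaginary part follows
from `J² = -1`. -/
theorem mem_holomorphic_iff (D : ComplexVectorFields E M) :
    D ∈ S.holomorphic ↔ imField D = -S.J (reField D) := by
  rw [holomorphic, Module.End.mem_eigenspace_iff]
  constructor
  · intro h
    have := congrArg reField h
    rw [reField_complexJ, reField_complex_smul] at this
    rw [this]; simp
  · intro h
    apply complexVectorFields_ext
    · rw [reField_complexJ, reField_complex_smul, h]; simp
    · rw [imField_complexJ, imField_complex_smul, h]; simp [S.J_J]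

theorem mem_antiholomorphic_iff (D : ComplexVectorFields E M) :
    D ∈ S.antiholomorphic ↔ imField D = S.J (reField D) := by
  rw [antiholomorphic, Module.End.mem_eigenspace_iff, ← map_neg]
  constructor
  · intro h
    have := congrArg reField h
    rw [reField_complexJ, reField_complex_smul] at this
    rw [this]; simp; module
  · intro h
    apply complexVectorFields_ext
    · rw [reField_complexJ, reField_complex_smul, h]; simp; module
    · rw [imField_complexJ, imField_complex_smul, h]; simp [S.J_J]; module

variable {S}

/-- Obtained by applying `J` to the vanishing Nijenhuis tensor. In this form it relates the real and
imaginary parts of the bracket of two eigenfields. -/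
theorem IsIntegrable.apply_sub (h : S.IsIntegrable) (X Y : VectorFields E M) :
    S.J (⁅X, Y⁆ - ⁅S.J X, S.J Y⁆) = ⁅X, S.J Y⁆ + ⁅S.J X, Y⁆ := by
  have e : ⁅X, Y⁆ - ⁅S.J X, S.J Y⁆ = -S.J (⁅X, S.J Y⁆ + ⁅S.J X, Y⁆) := by
    rw [map_add]
    linear_combination (norm := abel) -h X Y
  rw [e, map_neg, S.J_J, neg_neg]

theorem IsIntegrable.lie_mem_antiholomorphic (h : S.IsIntegrable) (D : ComplexVectorFields E M)
    (hD : D ∈ S.antiholomorphic) (D' : ComplexVectorFields E M) (hD' : D' ∈ S.antiholomorphic) :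
    ⁅D, D'⁆ ∈ S.antiholomorphic := by
  rw [mem_antiholomorphic_iff] at *
  rw [imField_lie, reField_lie, hD, hD', h.apply_sub]

theorem IsIntegrable.lie_mem_holomorphic (h : S.IsIntegrable) (D : ComplexVectorFields E M)
    (hD : D ∈ S.holomorphic) (D' : ComplexVectorFields E M) (hD' : D' ∈ S.holomorphic) :
    ⁅D, D'⁆ ∈ S.holomorphic := by
  rw [mem_holomorphic_iff] at *
  have e₁ : ∀ X Y : VectorFields E M, ⁅-X, Y⁆ = -⁅X, Y⁆ := fun X Y => neg_lie X Y
  have e₂ : ∀ X Y : VectorFields E M, ⁅X, -Y⁆ = -⁅X, Y⁆ := fun X Y => lie_neg X Y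
  rw [imField_lie, reField_lie, hD, hD', e₁, e₂, e₂, e₁, neg_neg, h.apply_sub]
  abel

/-- The hypothesis is applied to `X + i J X` and `Y + i J Y`. That their bracket is again of this
form is, after applying `J`, the vanishing of the Nijenhuis tensor at `X` and `Y`. -/
theorem isIntegrable_of_lie_mem (h : ∀ D ∈ S.antiholomorphic, ∀ D' ∈ S.antiholomorphic,
    ⁅D, D'⁆ ∈ S.antiholomorphic) : S.IsIntegrable := by
  intro X Y
  have hX : ∀ X, complexField X (S.J X) ∈ S.antiholomorphic := by
    intro X
    rw [mem_antiholomorphic_iff, reField_complexField, imField_complexField]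
  have e := h _ (hX X) _ (hX Y)
  rw [mem_antiholomorphic_iff, imField_lie, reField_lie] at e
  simp only [reField_complexField, imField_complexField] at e
  have e' := congrArg S.J e
  rw [S.J_J, map_add] at e'
  linear_combination (norm := abel) -e'

theorem IsIntegrable.isTwilled (h : S.IsIntegrable) : S.almostTwilledPre.IsTwilled :=
  AlmostTwilledPre.isTwilled_of_sum _ (AlmostTwilledPre.isLieRinehart_sum_ofDecomposition S.isCompl
    h.lie_mem_holomorphic h.lie_mem_antiholomorphic)

/-- The antiholomorphic component of `[D, D']` acts on functions like `[D, D']`. Complex vector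
fields are by definition derivations of the functions, so the two are equal. -/
theorem isIntegrable_of_dBar_dBar
    (h : ∀ x, S.almostTwilledPre.dBar (S.almostTwilledPre.dBar x) = 0) : S.IsIntegrable := by
  refine isIntegrable_of_lie_mem fun D hD D' hD' => ?_
  have e : ⁅D, D'⁆ = (S.antiholomorphic.projectionOnto S.holomorphic S.isCompl.symm ⁅D, D'⁆ :
      ComplexVectorFields E M) := by
    apply Derivation.ext
    intro a
    exact (PolyAlg.anchor_bracket_of_differential_differential S.almostTwilledPre h
      ⟨D, hD⟩ ⟨D', hD'⟩ a).symm
  rw [e]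
  exact Subtype.prop _

end AlmostComplexStructure

end AlmostComplex

/-! ### Hadamard's lemma -/

section Hadamard

variable {E F : Type*} [NormedAddCommGroup E] [NormedSpace ℝ E] [NormedAddCommGroup F]
  [NormedSpace ℝ F]

/-- The integral is the value at `0` of the convolution of the indicator function of `(0, 1]` with a
compactly supported function, and such convolutions depend smoothly on parameters. -/
theorem ContDiff.parametric_intervalIntegral {n : ℕ∞} {H : E × ℝ → F} (hH : ContDiff ℝ n H) :
    ContDiff ℝ n fun p => ∫ t in (0 : ℝ)..1, H (p, t) := by
  -- The bump function provides compact support and equals one on `[-1, 1]`, so it does not affect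
  -- the integral. The convolution evaluates at `-t`, whence the sign in `g`.
  let β : ContDiffBump (0 : ℝ) := ⟨1, 2, one_pos, one_lt_two⟩
  let g : E → ℝ → F := fun p s => β s • H (p, -s)
  have hg : ContDiff ℝ n ↿g :=
    (β.contDiff.comp contDiff_snd).smul (hH.comp (contDiff_fst.prodMk contDiff_snd.neg))
  have h := MeasureTheory.contDiffOn_convolution_right_with_param_comp (μ := MeasureTheory.volume)
    (ContinuousLinearMap.lsmul ℝ ℝ : ℝ →L[ℝ] F →L[ℝ] F) (s := Set.univ) (v := fun _ : E => (0 : ℝ))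
    (f := (Set.Ioc (0 : ℝ) 1).indicator fun _ => (1 : ℝ)) (g := g) (k := Metric.closedBall 0 2)
    contDiffOn_const isOpen_univ (isCompact_closedBall _ _) (fun p s _ hs => by
      have : β s = 0 := β.zero_of_le_dist (by
        rw [Metric.mem_closedBall, not_le] at hs
        exact hs.le)
      simp only [g, this, zero_smul])
    ((MeasureTheory.integrable_indicator_iff measurableSet_Ioc).mpr
      (MeasureTheory.integrableOn_const (by simp))).locallyIntegrable
    hg.contDiffOn
  rw [contDiffOn_univ] at h
  convert h using 2 with p
  rw [MeasureTheory.convolution_def, intervalIntegral.integral_of_le zero_le_one,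
    ← MeasureTheory.integral_indicator measurableSet_Ioc]
  congr 1
  ext t
  by_cases ht : t ∈ Set.Ioc (0 : ℝ) 1
  · have hβ : β (-t) = 1 := β.one_of_mem_closedBall (by
      rw [Metric.mem_closedBall, dist_zero_right, norm_neg, Real.norm_of_nonneg ht.1.le]
      exact ht.2)
    simp [g, Set.indicator_of_mem ht, hβ]
  · simp [Set.indicator_of_notMem ht]

/-- Hadamard's lemma. -/
theorem ContDiff.exists_eq_add_apply_sub {f : E → ℝ} (hf : ContDiff ℝ ∞ f) (x : E) :
    ∃ G : E → E →L[ℝ] ℝ, ContDiff ℝ ∞ G ∧ G x = fderiv ℝ f x ∧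
      ∀ y, f y = f x + G y (y - x) := by
  have hd : ContDiff ℝ ∞ (fderiv ℝ f) := hf.fderiv_right (by simp)
  refine ⟨fun y => ∫ t in (0 : ℝ)..1, fderiv ℝ f (x + t • (y - x)), ?_, ?_, fun y => ?_⟩
  · exact ContDiff.parametric_intervalIntegral (n := ⊤)
      (H := fun p : E × ℝ => fderiv ℝ f (x + p.2 • (p.1 - x)))
      (hd.comp (contDiff_const.add (contDiff_snd.smul (contDiff_fst.sub contDiff_const))))
  · simp
  · have hc : Continuous fun t : ℝ => fderiv ℝ f (x + t • (y - x)) :=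
      hd.continuous.comp (by fun_prop)
    have h1 : ∀ t : ℝ, HasDerivAt (fun t : ℝ => f (x + t • (y - x)))
        (fderiv ℝ f (x + t • (y - x)) (y - x)) t := by
      intro t
      have h2 : HasDerivAt (fun t : ℝ => x + t • (y - x)) (y - x) t := by
        simpa using ((hasDerivAt_id t).smul_const (y - x)).const_add x
      exact ((hf.differentiable (by simp)) _).hasFDerivAt.comp_hasDerivAt t h2
    have h3 := intervalIntegral.integral_eq_sub_of_hasDerivAt (a := 0) (b := 1)
      (fun t _ => h1 t) ((hc.clm_apply continuous_const).intervalIntegrable _ _)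
    rw [ContinuousLinearMap.intervalIntegral_apply (hc.intervalIntegrable _ _), h3]
    simp

end Hadamard

/-! ### Linear projections that are injective on small cones -/

section Projection

variable {V : Type*} [NormedAddCommGroup V] [NormedSpace ℝ V] [FiniteDimensional ℝ V]

theorem exists_linearMap_ker_eq_span {V : Type*} [AddCommGroup V] [Module ℝ V]
    [FiniteDimensional ℝ V] {d : ℕ} (hd : Module.finrank ℝ V = d + 1) {w : V} (hw : w ≠ 0) :
    ∃ f : V →ₗ[ℝ] Fin d → ℝ, ∀ v, f v = 0 → ∃ c : ℝ, v = c • w := by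
  have h : Module.finrank ℝ (V ⧸ Submodule.span ℝ {w}) = Module.finrank ℝ (Fin d → ℝ) := by
    have := Submodule.finrank_quotient_add_finrank (Submodule.span ℝ {w})
    rw [finrank_span_singleton hw, hd] at this
    rw [Module.finrank_fin_fun]
    omega
  refine ⟨(LinearEquiv.ofFinrankEq _ _ h).toLinearMap ∘ₗ (Submodule.span ℝ {w}).mkQ,
    fun v hv => ?_⟩
  simp only [LinearMap.comp_apply, LinearEquiv.coe_coe, LinearEquiv.map_eq_zero_iff,
    Submodule.mkQ_apply, Submodule.Quotient.mk_eq_zero] at hv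
  obtain ⟨c, rfl⟩ := Submodule.mem_span_singleton.mp hv
  exact ⟨c, rfl⟩

/-- As long as the ambient dimension exceeds `N`, some `w` lies outside `T`; as `T` is closed under
scaling, the line through `w` meets it in `0` only. Dividing by this line annihilates no other
element of `T` and, being Lipschitz, does not increase the Hausdorff dimension. This is repeated
until dimension `N` is reached. -/
theorem exists_linearMap_eq_zero_of_dimH_le {N m : ℕ} {T : Set (Fin m → ℝ)} (hT : dimH T ≤ N)
    (h0 : 0 ∈ T) (hsmul : ∀ (c : ℝ), ∀ u ∈ T, c • u ∈ T) :
    ∃ f : (Fin m → ℝ) →ₗ[ℝ] Fin N → ℝ, ∀ u ∈ T, f u = 0 → u = 0 := by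
  induction m with
  | zero => exact ⟨0, fun u _ _ => Subsingleton.elim _ _⟩
  | succ m ih =>
    by_cases hm : m + 1 ≤ N
    · obtain ⟨f, hf⟩ : ∃ f : (Fin (m + 1) → ℝ) →ₗ[ℝ] Fin N → ℝ, Function.Injective f :=
        ⟨Function.ExtendByZero.linearMap ℝ (Fin.castLE hm), fun u v h => funext fun i => by
          have := congrFun h (Fin.castLE hm i)
          simpa [Function.ExtendByZero.linearMap_apply,
            (Fin.castLE_injective hm).extend_apply] using this⟩
      exact ⟨f, fun u _ hu => hf (by rw [hu, map_zero])⟩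
    · have hlt : dimH T < Module.finrank ℝ (Fin (m + 1) → ℝ) := by
        refine hT.trans_lt ?_
        rw [Module.finrank_fin_fun]
        exact_mod_cast not_le.mp hm
      obtain ⟨w, hw⟩ := (dense_compl_of_dimH_lt_finrank hlt).nonempty
      have hw0 : w ≠ 0 := by rintro rfl; exact hw h0
      obtain ⟨g, hg⟩ := exists_linearMap_ker_eq_span (Module.finrank_fin_fun ℝ) hw0
      obtain ⟨f, hf⟩ := ih (T := g '' T)
        ((g.toContinuousLinearMap.lipschitz.dimH_image_le T).trans hT) ⟨0, h0, map_zero g⟩ (by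
          rintro c _ ⟨u, hu, rfl⟩
          exact ⟨c • u, hsmul c u hu, map_smul g c u⟩)
      refine ⟨f ∘ₗ g, fun u hu hfu => ?_⟩
      obtain ⟨c, rfl⟩ := hg u (hf _ ⟨u, hu, rfl⟩ hfu)
      by_cases hc : c = 0
      · rw [hc, zero_smul]
      · refine absurd ?_ hw
        have := hsmul c⁻¹ _ hu
        rwa [inv_smul_smul₀ hc] at this

end Projection

/-! ### Derivations of the smooth functions as tangent vectors -/

section TangentVector

open Filter Topology

variable {E M : Type*} [NormedAddCommGroup E] [NormedSpace ℝ E] [FiniteDimensional ℝ E]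
  [TopologicalSpace M] [T2Space M] [ChartedSpace E M] [IsManifold 𝓘(ℝ, E) ∞ M]

/-- The evaluation at a point. -/
def RealFunctions.evalHom (q : M) : RealFunctions E M →+* ℝ where
  toFun f := f q
  map_one' := rfl
  map_mul' _ _ := rfl
  map_zero' := rfl
  map_add' _ _ := rfl

/-- A bump function, as a smooth function. -/
def SmoothBumpFunction.toFunction {q : M} (β : SmoothBumpFunction 𝓘(ℝ, E) q) :
    RealFunctions E M :=
  ⟨β, β.contMDiff⟩

/-- The extension by zero of a smooth function of the coordinates. -/
def SmoothBumpFunction.extension {q : M} (β : SmoothBumpFunction 𝓘(ℝ, E) q) (h : E → ℝ)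
    (hh : ContDiff ℝ ∞ h) : RealFunctions E M :=
  ⟨fun y => β y • h (extChartAt 𝓘(ℝ, E) q y), β.contMDiff_smul
    (hh.contMDiff.comp_contMDiffOn contMDiffOn_extChartAt)⟩

/-- A bump function `β` at `q` supported where `f` vanishes satisfies `β f = 0`. The product rule at
`q`, where `β = 1` and `f = 0`, gives the claim. -/
theorem Derivation.apply_eq_zero_of_eventuallyEq (X : VectorFields E M) {f : RealFunctions E M}
    {q : M} (h : ∀ᶠ y in 𝓝 q, f y = 0) : X f q = 0 := by
  obtain ⟨β, -, hβ⟩ := (SmoothBumpFunction.nhds_basis_tsupport (I := 𝓘(ℝ, E)) q).mem_iff.mp h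
  have e : β.toFunction * f = 0 := by
    ext y
    change β y * f y = 0
    by_cases hy : y ∈ tsupport β
    · rw [show f y = 0 from hβ hy, mul_zero]
    · rw [image_eq_zero_of_notMem_tsupport hy, zero_mul]
  have e' := congrArg (fun g : RealFunctions E M => g q) (X.leibniz β.toFunction f)
  rw [e, map_zero] at e'
  change 0 = β q * X f q + f q * X β.toFunction q at e'
  rw [β.eq_one, h.self_of_nhds] at e'
  linarith

theorem Derivation.apply_eq_of_eventuallyEq (X : VectorFields E M) {f g : RealFunctions E M}
    {q : M} (h : ∀ᶠ y in 𝓝 q, f y = g y) : X f q = X g q := by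
  have := X.apply_eq_zero_of_eventuallyEq (f := f - g) (q := q)
    (h.mono fun y hy => sub_eq_zero.mpr hy)
  rw [map_sub] at this
  exact sub_eq_zero.mp this

section ChartDeriv

variable {V : Type*} [NormedAddCommGroup V] [NormedSpace ℝ V] {F : M → V} {p q : M}

variable (E) in
/-- The derivative of a function at a point, in the coordinates of the preferred chart. -/
def chartDeriv (F : M → V) (q : M) : E →L[ℝ] V :=
  fderiv ℝ (F ∘ (extChartAt 𝓘(ℝ, E) q).symm) (extChartAt 𝓘(ℝ, E) q q)

theorem ContMDiffAt.contDiffAt_comp_symm (hF : ContMDiffAt 𝓘(ℝ, E) 𝓘(ℝ, V) ∞ F q)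
    (hq : q ∈ (extChartAt 𝓘(ℝ, E) p).source) :
    ContDiffAt ℝ ∞ (F ∘ (extChartAt 𝓘(ℝ, E) p).symm) (extChartAt 𝓘(ℝ, E) p q) := by
  refine contMDiffAt_iff_contDiffAt.mp (ContMDiffAt.comp (I' := 𝓘(ℝ, E)) _ ?_
    ((contMDiffOn_extChartAt_symm p).contMDiffAt
      ((isOpen_extChartAt_target p).mem_nhds ((extChartAt 𝓘(ℝ, E) p).map_source hq))))
  rwa [(extChartAt 𝓘(ℝ, E) p).left_inv hq]

/-- The chain rule for the change from the preferred chart at `q` to the chart at `p`. It allows all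
points near `p` to be treated in one chart. -/
theorem chartDeriv_eq_comp (hF : ContMDiffAt 𝓘(ℝ, E) 𝓘(ℝ, V) ∞ F q)
    (hq : q ∈ (extChartAt 𝓘(ℝ, E) p).source) :
    chartDeriv E F q =
      (fderiv ℝ (F ∘ (extChartAt 𝓘(ℝ, E) p).symm) (extChartAt 𝓘(ℝ, E) p q)).comp
        (chartDeriv E (extChartAt 𝓘(ℝ, E) p) q) := by
  have hq' := mem_extChartAt_source (I := 𝓘(ℝ, E)) q
  have h₁ : DifferentiableAt ℝ (F ∘ (extChartAt 𝓘(ℝ, E) p).symm)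
      ((extChartAt 𝓘(ℝ, E) p ∘ (extChartAt 𝓘(ℝ, E) q).symm) (extChartAt 𝓘(ℝ, E) q q)) := by
    rw [Function.comp_apply, (extChartAt 𝓘(ℝ, E) q).left_inv hq']
    exact (hF.contDiffAt_comp_symm hq).differentiableAt (by simp)
  have h₂ : DifferentiableAt ℝ (extChartAt 𝓘(ℝ, E) p ∘ (extChartAt 𝓘(ℝ, E) q).symm)
      (extChartAt 𝓘(ℝ, E) q q) := by
    refine (ContMDiffAt.contDiffAt_comp_symm (contMDiffAt_extChartAt' ?_) hq').differentiableAt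
      (by simp)
    rwa [extChartAt_source] at hq
  have h₃ := fderiv_comp _ h₁ h₂
  rw [Function.comp_apply, (extChartAt 𝓘(ℝ, E) q).left_inv hq'] at h₃
  rw [chartDeriv, chartDeriv, ← h₃]
  apply Filter.EventuallyEq.fderiv_eq
  have h₄ : ∀ᶠ y in 𝓝 (extChartAt 𝓘(ℝ, E) q q),
      (extChartAt 𝓘(ℝ, E) q).symm y ∈ (extChartAt 𝓘(ℝ, E) p).source := by
    refine (continuousAt_extChartAt_symm q).eventually_mem ?_
    rw [(extChartAt 𝓘(ℝ, E) q).left_inv hq']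
    exact (isOpen_extChartAt_source p).mem_nhds hq
  filter_upwards [h₄] with y hy
  simp only [Function.comp_apply, (extChartAt 𝓘(ℝ, E) p).left_inv hy]

theorem chartDeriv_extChartAt_self (q : M) :
    chartDeriv E (extChartAt 𝓘(ℝ, E) q) q = ContinuousLinearMap.id ℝ E := by
  rw [chartDeriv, ← fderiv_id (𝕜 := ℝ) (x := extChartAt 𝓘(ℝ, E) q q)]
  apply Filter.EventuallyEq.fderiv_eq
  filter_upwards [extChartAt_target_mem_nhds q] with y hy
  rw [Function.comp_apply, (extChartAt 𝓘(ℝ, E) q).right_inv hy, id]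

/-- The chain rule, applied to the chart at `q`, exhibits a left inverse. -/
theorem chartDeriv_extChartAt_injective (hq : q ∈ (extChartAt 𝓘(ℝ, E) p).source) :
    Function.Injective (chartDeriv E (extChartAt 𝓘(ℝ, E) p) q) := by
  have h := chartDeriv_eq_comp (contMDiffAt_extChartAt (I := 𝓘(ℝ, E)) (n := ∞) (x := q)) hq
  rw [chartDeriv_extChartAt_self] at h
  intro u v huv
  have e := fun w => congrArg (fun T : E →L[ℝ] E => T w) h
  simp only [ContinuousLinearMap.comp_apply, ContinuousLinearMap.id_apply] at e
  rw [e u, e v, huv]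

theorem chartDeriv_congr {G : M → V} (h : F =ᶠ[𝓝 q] G) : chartDeriv E F q = chartDeriv E G q := by
  apply Filter.EventuallyEq.fderiv_eq
  have h' := mem_extChartAt_source (I := 𝓘(ℝ, E)) q
  refine Filter.Tendsto.eventually (p := fun y => F y = G y) ?_ h
  have := (continuousAt_extChartAt_symm (I := 𝓘(ℝ, E)) q).tendsto
  rwa [(extChartAt 𝓘(ℝ, E) q).left_inv h'] at this

end ChartDeriv

/-- The bump function vanishes outside a closed ball contained in the chart target, so the product
is locally zero wherever the chart gives no information. Hadamard's lemma needs a function on all of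
`E`. -/
theorem contDiff_bump_mul {q : M} (β : SmoothBumpFunction 𝓘(ℝ, E) q) (f : RealFunctions E M) :
    ContDiff ℝ ∞ fun y => β.toContDiffBump y * f ((extChartAt 𝓘(ℝ, E) q).symm y) := by
  rw [contDiff_iff_contDiffAt]
  intro y
  by_cases hy : y ∈ (extChartAt 𝓘(ℝ, E) q).target
  · refine β.toContDiffBump.contDiffAt.mul ?_
    have h : ContMDiffOn 𝓘(ℝ, E) 𝓘(ℝ, ℝ) ∞ (f ∘ (extChartAt 𝓘(ℝ, E) q).symm)
        (extChartAt 𝓘(ℝ, E) q).target :=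
      f.contMDiff.comp_contMDiffOn (contMDiffOn_extChartAt_symm q)
    exact (contMDiffOn_iff_contDiffOn.mp h).contDiffAt
      ((isOpen_extChartAt_target q).mem_nhds hy)
  · have hy' : y ∉ Metric.closedBall (extChartAt 𝓘(ℝ, E) q q) β.rOut := fun h =>
      hy (β.closedBall_subset ⟨h, by simp⟩)
    refine (contDiffAt_const (c := (0 : ℝ))).congr_of_eventuallyEq ?_
    filter_upwards [Metric.isClosed_closedBall.isOpen_compl.mem_nhds hy'] with z hz
    rw [β.toContDiffBump.zero_of_le_dist, zero_mul]
    rw [Set.mem_compl_iff, Metric.mem_closedBall, not_le] at hz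
    exact hz.le

/-- A derivation of the smooth functions is given at each point by a tangent vector. -/
theorem Derivation.exists_tangentVector (X : VectorFields E M) (q : M) :
    ∃ v : E, ∀ f : RealFunctions E M, X f q = chartDeriv E f q v := by
  obtain ⟨β⟩ : Nonempty (SmoothBumpFunction 𝓘(ℝ, E) q) := inferInstance
  set φ := extChartAt 𝓘(ℝ, E) q
  set b := Module.finBasis ℝ E
  let a : Fin (Module.finrank ℝ E) → RealFunctions E M := fun k =>
    β.extension (fun y => b.coord k (y - φ q)) (by
      exact (LinearMap.toContinuousLinearMap (b.coord k)).contDiff.comp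
        (contDiff_id.sub contDiff_const))
  -- The components of the tangent vector are the values of `X` on the coordinate functions, cut off
  -- by `β`.
  refine ⟨∑ k, X (a k) q • b k, fun f => ?_⟩
  obtain ⟨G, hG, hG₀, hf⟩ := (contDiff_bump_mul β f).exists_eq_add_apply_sub (φ q)
  have h₁ : ∀ᶠ y in 𝓝 q, β y = 1 := β.eventuallyEq_one
  have h₂ : ∀ᶠ y in 𝓝 q, y ∈ φ.source := extChartAt_source_mem_nhds q
  let c : Fin (Module.finrank ℝ E) → RealFunctions E M := fun k =>
    β.extension (fun y => G y (b k)) (hG.clm_apply contDiff_const)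
  have ha : ∀ k, a k q = 0 := by
    intro k
    change β q • b.coord k (φ q - φ q) = 0
    rw [sub_self, map_zero, smul_zero]
  have hc : ∀ k, c k q = G (φ q) (b k) := by
    intro k
    change β q • G (φ q) (b k) = _
    rw [β.eq_one, one_smul]
  have h₃ : ∀ y ∈ φ.source, β y = 1 → β.toContDiffBump (φ y) = 1 := by
    intro y hy h
    rw [extChartAt_source] at hy
    rwa [β.eqOn_source hy] at h
  -- Hadamard's expansion in coordinates, with all functions cut off so as to be defined on `M`; it
  -- holds where the bump function is one. As `a k` vanishes at `q`, the product rule leaves only `X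
  -- (a k)`.
  have e : ∀ᶠ y in 𝓝 q, f y = (algebraMap ℝ (RealFunctions E M) (f q) + ∑ k, a k * c k) y := by
    filter_upwards [h₁, h₂] with y hy hy'
    have e₁ := hf (φ y)
    rw [h₃ y hy' hy, h₃ q (mem_extChartAt_source q) β.eq_one, φ.left_inv hy',
      φ.left_inv (mem_extChartAt_source q), one_mul, one_mul] at e₁
    rw [e₁]
    have hk : ∀ k, (a k * c k) y = b.coord k (φ y - φ q) * G (φ y) (b k) := by
      intro k
      change (β y • b.coord k (φ y - φ q)) * (β y • G (φ y) (b k)) = _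
      rw [hy, one_smul, one_smul]
    have hsum : (∑ k, a k * c k) y = ∑ k, (a k * c k) y := by
      change RealFunctions.evalHom y (∑ k, a k * c k) = _
      rw [map_sum]
      rfl
    change _ = f q + (∑ k, a k * c k) y
    rw [hsum]
    conv_lhs => rw [← b.sum_repr (φ y - φ q)]
    simp only [hk, map_sum]
    exact congrArg _ (Finset.sum_congr rfl fun k _ => (G (φ y)).map_smul _ _)
  have hder : fderiv ℝ (fun y => β.toContDiffBump y * f (φ.symm y)) (φ q) =
      fderiv ℝ (f ∘ φ.symm) (φ q) := by
    apply Filter.EventuallyEq.fderiv_eq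
    filter_upwards [β.toContDiffBump.eventuallyEq_one] with y hy
    rw [hy, Pi.one_apply, one_mul, Function.comp_apply]
  have h₄ : X (∑ k, a k * c k) q = ∑ k, X (a k) q * c k q := by
    change RealFunctions.evalHom q (X (∑ k, a k * c k)) = _
    rw [map_sum, map_sum]
    refine Finset.sum_congr rfl fun k _ => ?_
    rw [X.leibniz]
    change a k q * X (c k) q + c k q * X (a k) q = _
    rw [ha, zero_mul, zero_add, mul_comm]
  rw [X.apply_eq_of_eventuallyEq e, map_add, Derivation.map_algebraMap, zero_add, h₄, chartDeriv,
    ← hder, ← hG₀, map_sum]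
  simp only [hc]
  exact Finset.sum_congr rfl fun k _ => ((G (φ q)).map_smul _ _).symm

end TangentVector

/-! ### Fields dual to an immersion, near a point -/

section LocalFrame

open Filter Topology

variable {E M : Type*} [NormedAddCommGroup E] [NormedSpace ℝ E] [FiniteDimensional ℝ E]
  [TopologicalSpace M] [T2Space M] [ChartedSpace E M] [IsManifold 𝓘(ℝ, E) ∞ M]

theorem RealFunctions.differentiableAt_comp_symm (f : RealFunctions E M) {p q : M}
    (hq : q ∈ (extChartAt 𝓘(ℝ, E) p).source) :
    DifferentiableAt ℝ (f ∘ (extChartAt 𝓘(ℝ, E) p).symm) (extChartAt 𝓘(ℝ, E) p q) :=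
  (f.contMDiff.contMDiffAt.contDiffAt_comp_symm hq).differentiableAt (by simp)

theorem SmoothBumpFunction.mem_source_of_ne_zero {p q : M} (β : SmoothBumpFunction 𝓘(ℝ, E) p)
    (h : β q ≠ 0) : q ∈ (extChartAt 𝓘(ℝ, E) p).source := by
  rw [extChartAt_source]
  exact β.support_subset_source h

/-- The vector field that is given in the coordinates near `p` by `w`, cut off by a bump
function. -/
def SmoothBumpFunction.field {p : M} (β : SmoothBumpFunction 𝓘(ℝ, E) p) (w : E → E)
    (hw : ∀ y ∈ tsupport β, ContDiffAt ℝ ∞ w (extChartAt 𝓘(ℝ, E) p y)) : VectorFields E M :=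
  Derivation.mk'
    { toFun := fun f => ⟨fun q => β q * fderiv ℝ (f ∘ (extChartAt 𝓘(ℝ, E) p).symm)
          (extChartAt 𝓘(ℝ, E) p q) (w (extChartAt 𝓘(ℝ, E) p q)), by
        intro y
        by_cases hy : y ∈ tsupport β
        · have hs := β.tsupport_subset_extChartAt_source hy
          have h₁ : ContDiffAt ℝ ∞ (fderiv ℝ (f ∘ (extChartAt 𝓘(ℝ, E) p).symm))
              (extChartAt 𝓘(ℝ, E) p y) :=
            (f.contMDiff.contMDiffAt.contDiffAt_comp_symm hs).fderiv_right (by simp)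
          have h₂ := (h₁.clm_apply (hw y hy)).contMDiffAt
          rw [extChartAt_source] at hs
          exact β.contMDiffAt.mul (h₂.comp y (contMDiffAt_extChartAt' hs))
        · refine (contMDiffAt_const (c := (0 : ℝ))).congr_of_eventuallyEq ?_
          filter_upwards [(isClosed_tsupport β).isOpen_compl.mem_nhds hy] with z hz
          rw [image_eq_zero_of_notMem_tsupport hz, zero_mul]⟩
      map_add' := fun f g => by
        ext q
        change β q * fderiv ℝ (f ∘ (extChartAt 𝓘(ℝ, E) p).symm +
          g ∘ (extChartAt 𝓘(ℝ, E) p).symm) _ _ = β q * _ + β q * _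
        by_cases h : β q = 0
        · simp [h]
        · have hq := β.mem_source_of_ne_zero h
          rw [fderiv_add (f.differentiableAt_comp_symm hq) (g.differentiableAt_comp_symm hq),
            add_apply, mul_add]
      map_smul' := fun r f => by
        ext q
        change β q * fderiv ℝ (r • (f ∘ (extChartAt 𝓘(ℝ, E) p).symm)) _ _ = r • (β q * _)
        rw [fderiv_const_smul_field, Pi.smul_apply, smul_apply, mul_smul_comm] }
    (fun f g => by
      ext q
      change β q * fderiv ℝ ((f ∘ (extChartAt 𝓘(ℝ, E) p).symm) *
          (g ∘ (extChartAt 𝓘(ℝ, E) p).symm)) _ _ = f q * (β q * _) + g q * (β q * _)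
      by_cases h : β q = 0
      · simp [h]
      · have hq := β.mem_source_of_ne_zero h
        rw [fderiv_mul (f.differentiableAt_comp_symm hq) (g.differentiableAt_comp_symm hq)]
        simp only [add_apply, smul_apply, smul_eq_mul,
          Function.comp_apply, (extChartAt 𝓘(ℝ, E) p).left_inv hq]
        ring)

theorem SmoothBumpFunction.field_apply {p : M} (β : SmoothBumpFunction 𝓘(ℝ, E) p) (w : E → E)
    (hw : ∀ y ∈ tsupport β, ContDiffAt ℝ ∞ w (extChartAt 𝓘(ℝ, E) p y)) (f : RealFunctions E M)
    (q : M) : β.field w hw f q = β q * fderiv ℝ (f ∘ (extChartAt 𝓘(ℝ, E) p).symm)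
          (extChartAt 𝓘(ℝ, E) p q) (w (extChartAt 𝓘(ℝ, E) p q)) := rfl

/-- The map into Euclidean space with the given components. -/
def componentMap {N : ℕ} (F : Fin N → RealFunctions E M) (q : M) : Fin N → ℝ := fun i => F i q

theorem contMDiff_componentMap {N : ℕ} (F : Fin N → RealFunctions E M) :
    ContMDiff 𝓘(ℝ, E) 𝓘(ℝ, Fin N → ℝ) ∞ (componentMap F) :=
  contMDiff_pi_space.mpr fun i => (F i).contMDiff

/-- Let `L` be a left inverse of the differential of `F` at `p`. Then `B = L ∘ dF` is the identity
at `p`, hence invertible nearby, and `t = B⁻¹ L (dF t)` for every tangent vector `t`. The components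
of `dF t` are the `X (F i)`, so `D i` is the field `B⁻¹ L` applied to the `i`-th unit vector. -/
theorem exists_dualFields_nhds {N : ℕ} (F : Fin N → RealFunctions E M) (p : M)
    (hF : Function.Injective (chartDeriv E (componentMap F) p)) :
    ∃ U : Set M, IsOpen U ∧ p ∈ U ∧ ∃ D : Fin N → VectorFields E M, ∀ q ∈ U,
      ∀ (X : VectorFields E M) (f : RealFunctions E M), X f q = ∑ i, X (F i) q * D i f q := by
  have : CompleteSpace E := FiniteDimensional.complete ℝ E
  set φ := extChartAt 𝓘(ℝ, E) p with hφ
  have hp : p ∈ φ.source := mem_extChartAt_source p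
  have hsm : ∀ q ∈ φ.source, ContDiffAt ℝ ∞ (componentMap F ∘ φ.symm) (φ q) := fun q hq =>
    (contMDiff_componentMap F).contMDiffAt.contDiffAt_comp_symm hq
  obtain ⟨L₀, hL₀⟩ := LinearMap.exists_leftInverse_of_injective
    (chartDeriv E (componentMap F) p).toLinearMap (LinearMap.ker_eq_bot.mpr hF)
  let L : (Fin N → ℝ) →L[ℝ] E := LinearMap.toContinuousLinearMap L₀
  let B : E → E →L[ℝ] E := fun x => L.comp (fderiv ℝ (componentMap F ∘ φ.symm) x)
  have hB : ∀ q ∈ φ.source, ContDiffAt ℝ ∞ B (φ q) := fun q hq =>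
    contDiffAt_const.clm_comp ((hsm q hq).fderiv_right (by simp))
  have hBp : B (φ p) = (ContinuousLinearEquiv.refl ℝ E : E →L[ℝ] E) := by
    ext v
    exact LinearMap.congr_fun hL₀ v
  have hev : ∀ᶠ y in 𝓝 p, y ∈ φ.source ∧ ∃ e : E ≃L[ℝ] E, (e : E →L[ℝ] E) = B (φ y) := by
    refine Filter.Eventually.and (extChartAt_source_mem_nhds p) ?_
    have h₁ : ContinuousAt (fun y => B (φ y)) p :=
      ContinuousAt.comp (hB p hp).continuousAt (continuousAt_extChartAt p)
    have h₂ := ContinuousLinearEquiv.nhds (ContinuousLinearEquiv.refl ℝ E)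
    rw [← hBp] at h₂
    exact h₁ h₂
  -- The cut-off is supported where `B` is invertible, so that the inverse is smooth on its support.
  obtain ⟨β, -, hβ⟩ := (SmoothBumpFunction.nhds_basis_tsupport (I := 𝓘(ℝ, E)) p).mem_iff.mp hev
  have hinv : ∀ y ∈ tsupport β, ContDiffAt ℝ ∞ (fun x => (B x).inverse) (φ y) := by
    intro y hy
    obtain ⟨hy₁, e, he⟩ := hβ hy
    refine ContDiffAt.comp (g := ContinuousLinearMap.inverse) (φ y) ?_ (hB y hy₁)
    rw [← he]
    exact contDiffAt_map_inverse e
  let D : Fin N → VectorFields E M := fun i =>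
    β.field (fun x => (B x).inverse (L (Pi.single i 1)))
      fun y hy => (hinv y hy).clm_apply contDiffAt_const
  obtain ⟨U, hU₁, hU, hpU⟩ := mem_nhds_iff.mp
    (Filter.eventually_iff.mp (β.eventuallyEq_one))
  refine ⟨U, hU, hpU, D, fun q hq X f => ?_⟩
  have hβq : β q = 1 := hU₁ hq
  have hqt : q ∈ tsupport β := subset_tsupport _ (by
    rw [Function.mem_support, hβq]
    exact one_ne_zero)
  obtain ⟨hqs, e, he⟩ := hβ hqt
  obtain ⟨u, hu⟩ := X.exists_tangentVector q
  set t := chartDeriv E φ q u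
  have hX : ∀ g : RealFunctions E M, X g q = fderiv ℝ (g ∘ φ.symm) (φ q) t := by
    intro g
    rw [hu, chartDeriv_eq_comp g.contMDiff.contMDiffAt hqs]
    rfl
  have hXF : (fun i => X (F i) q) = fderiv ℝ (componentMap F ∘ φ.symm) (φ q) t := by
    funext i
    rw [hX]
    have h := (hasFDerivAt_pi'.mp ((hsm q hqs).differentiableAt (by simp)).hasFDerivAt i).fderiv
    change fderiv ℝ (F i ∘ φ.symm) (φ q) = _ at h
    rw [h]
    rfl
  have hsum : ∑ i, X (F i) q • (Pi.single i 1 : Fin N → ℝ) = fun i => X (F i) q := by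
    funext j
    simp [Finset.sum_apply, Pi.single_apply]
  have hD : ∑ i, X (F i) q * D i f q = fderiv ℝ (f ∘ φ.symm) (φ q)
      ((B (φ q)).inverse (L (∑ i, X (F i) q • (Pi.single i 1 : Fin N → ℝ)))) := by
    rw [map_sum, map_sum, map_sum]
    refine Finset.sum_congr rfl fun i _ => ?_
    rw [map_smul, map_smul, map_smul]
    simp only [D, SmoothBumpFunction.field_apply, hβq, one_mul, smul_eq_mul]
    rfl
  rw [hD, hsum, hXF, hX, ← he, ContinuousLinearMap.inverse_equiv]
  congr 1
  rw [ContinuousLinearEquiv.coe_coe, ContinuousLinearEquiv.eq_symm_apply]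
  exact congrArg (fun T : E →L[ℝ] E => T t) he

end LocalFrame

/-! ### Gluing functions and fields by a partition of unity -/

section Glue

variable {E M : Type*} [NormedAddCommGroup E] [NormedSpace ℝ E] [FiniteDimensional ℝ E]
  [TopologicalSpace M] [ChartedSpace E M] {ι : Type*} {s : Set M}
  (ρ : SmoothPartitionOfUnity ι 𝓘(ℝ, E) M s)

namespace SmoothPartitionOfUnity

theorem finite_support_mul (g : ι → ℝ) (q : M) : (Function.support fun i => ρ i q * g i).Finite :=
  (ρ.locallyFinite.point_finite q).subset fun _ hi => left_ne_zero_of_mul hi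

/-- The combination of a family of smooth functions by means of a partition of unity. -/
def glue (g : ι → RealFunctions E M) : RealFunctions E M :=
  ⟨fun q => ∑ᶠ i, ρ i q * g i q,
    ρ.contMDiff_finsum_smul fun _ _ _ => (g _).contMDiff.contMDiffAt⟩

theorem glue_apply (g : ι → RealFunctions E M) (q : M) : ρ.glue g q = ∑ᶠ i, ρ i q * g i q := rfl

theorem glue_add (g h : ι → RealFunctions E M) :
    ρ.glue (fun i => g i + h i) = ρ.glue g + ρ.glue h := by
  ext q
  change ∑ᶠ i, ρ i q * (g i q + h i q) = ρ.glue g q + ρ.glue h q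
  simp only [mul_add, glue_apply]
  exact finsum_add_distrib (ρ.finite_support_mul _ q) (ρ.finite_support_mul _ q)

theorem glue_mul (f : RealFunctions E M) (g : ι → RealFunctions E M) :
    ρ.glue (fun i => f * g i) = f * ρ.glue g := by
  ext q
  change ∑ᶠ i, ρ i q * (f q * g i q) = f q * ρ.glue g q
  simp only [mul_left_comm _ (f q), glue_apply]
  exact (mul_finsum _ _).symm

/-- The combination of a family of vector fields by means of a partition of unity. -/
def glueField (D : ι → VectorFields E M) : VectorFields E M :=
  Derivation.mk'
    { toFun := fun f => ρ.glue fun i => D i f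
      map_add' := fun f g => by simp only [map_add, glue_add]
      map_smul' := fun r f => by
        simp only [Derivation.map_smul, RingHom.id_apply]
        simp only [Algebra.smul_def, glue_mul] }
    (fun f g => by
      change ρ.glue (fun i => D i (f * g)) = _
      simp only [Derivation.leibniz, smul_eq_mul, glue_add, glue_mul]
      rfl)

theorem glueField_apply (D : ι → VectorFields E M) (f : RealFunctions E M) :
    ρ.glueField D f = ρ.glue fun i => D i f := rfl

end SmoothPartitionOfUnity

/-- For fixed `F` the identity is affine in the fields `D`, so it survives averaging local solutions
with a partition of unity. -/
theorem exists_dualFields_of_isClosed [T2Space M] [SigmaCompactSpace M]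
    [IsManifold 𝓘(ℝ, E) ∞ M] {C : Set M} (hC : IsClosed C) {N : ℕ}
    (F : Fin N → RealFunctions E M)
    (hF : ∀ p ∈ C, Function.Injective (chartDeriv E (componentMap F) p)) :
    ∃ D : Fin N → VectorFields E M, ∀ q ∈ C, ∀ (X : VectorFields E M) (f : RealFunctions E M),
      X f q = ∑ i, X (F i) q * D i f q := by
  choose U hU hpU D hD using fun p : C => exists_dualFields_nhds F p (hF p p.2)
  obtain ⟨ρ, hρ⟩ := SmoothPartitionOfUnity.exists_isSubordinate 𝓘(ℝ, E) hC U hU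
    fun p hp => Set.mem_iUnion_of_mem ⟨p, hp⟩ (hpU _)
  refine ⟨fun i => ρ.glueField fun p => D p i, fun q hq X f => ?_⟩
  simp only [SmoothPartitionOfUnity.glueField_apply, SmoothPartitionOfUnity.glue_apply]
  have h₁ : ∀ p, ∑ i, X (F i) q * (ρ p q * D p i f q) = ρ p q * X f q := by
    intro p
    by_cases h : ρ p q = 0
    · simp [h]
    · rw [hD p q (hρ p (subset_tsupport _ h)) X f, Finset.mul_sum]
      exact Finset.sum_congr rfl fun i _ => by ring
  simp only [mul_finsum]
  rw [← finsum_sum_comm]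
  · simp only [h₁]
    rw [← finsum_mul, ρ.sum_eq_one hq, one_mul]
  · intro i _
    refine (ρ.finite_support_mul (fun p => D p i f q) q).subset fun p hp => ?_
    exact right_ne_zero_of_mul hp

end Glue

/-! ### Immersions near compact sets, with a bounded number of components -/

section Immersion

open Filter Topology

variable {E M : Type*} [NormedAddCommGroup E] [NormedSpace ℝ E] [FiniteDimensional ℝ E]
  [TopologicalSpace M] [T2Space M] [ChartedSpace E M] [IsManifold 𝓘(ℝ, E) ∞ M]

theorem chartDeriv_clm_comp {V W : Type*} [NormedAddCommGroup V] [NormedSpace ℝ V]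
    [NormedAddCommGroup W] [NormedSpace ℝ W] (L : V →L[ℝ] W) {G : M → V} {q : M}
    (hG : ContMDiffAt 𝓘(ℝ, E) 𝓘(ℝ, V) ∞ G q) (u : E) :
    chartDeriv E (fun y => L (G y)) q u = L (chartDeriv E G q u) := by
  have h := (hG.contDiffAt_comp_symm (mem_extChartAt_source q)).differentiableAt (by simp)
  have h' := (L.hasFDerivAt.comp _ h.hasFDerivAt).fderiv
  exact congrArg (fun T : E →L[ℝ] W => T u) h'

theorem chartDeriv_componentMap {m : ℕ} (F : Fin m → RealFunctions E M) (q : M) (u : E)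
    (i : Fin m) : chartDeriv E (componentMap F) q u i = chartDeriv E (F i) q u :=
  (chartDeriv_clm_comp (ContinuousLinearMap.proj i) ((contMDiff_componentMap F).contMDiffAt)
    u).symm

/-- Finitely many bump functions suffice for each point of `C` to have a neighbourhood where one of
them is one. There the cut-off coordinates agree with chart coordinates, whose differential is
injective. -/
theorem exists_immersion_of_isCompact {C : Set M} (hC : IsCompact C) :
    ∃ (m : ℕ) (F : Fin m → RealFunctions E M),
      ∀ q ∈ C, Function.Injective (chartDeriv E (componentMap F) q) := by
  classical
  let b := Module.finBasis ℝ E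
  let β : ∀ p : M, SmoothBumpFunction 𝓘(ℝ, E) p := fun p => Classical.arbitrary _
  obtain ⟨t, ht⟩ := hC.elim_nhds_subcover (fun p => {y | ∀ᶠ z in 𝓝 y, β p z = 1})
    fun p _ => (β p).eventuallyEq_one.eventually_nhds
  let e := Fintype.equivFin (t × Fin (Module.finrank ℝ E))
  let L : Fin (Module.finrank ℝ E) → E →L[ℝ] ℝ := fun k =>
    LinearMap.toContinuousLinearMap (b.coord k)
  let F : t × Fin (Module.finrank ℝ E) → RealFunctions E M := fun j =>
    (β j.1).extension (L j.2) (L j.2).contDiff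
  refine ⟨_, fun i => F (e.symm i), fun q hq => ?_⟩
  obtain ⟨p, hp, hqp⟩ := Set.mem_iUnion₂.mp (ht.2 hq)
  have hqs : q ∈ (extChartAt 𝓘(ℝ, E) p).source :=
    (β p).mem_source_of_ne_zero (by rw [hqp.self_of_nhds]; exact one_ne_zero)
  rw [injective_iff_map_eq_zero]
  intro u hu
  refine (injective_iff_map_eq_zero _).mp (chartDeriv_extChartAt_injective hqs) u ?_
  refine b.ext_elem fun k => ?_
  have h₁ := congrFun hu (e (⟨p, hp⟩, k))
  rw [chartDeriv_componentMap, Equiv.symm_apply_apply] at h₁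
  have h₂ : F (⟨p, hp⟩, k) =ᶠ[𝓝 q] fun y => L k (extChartAt 𝓘(ℝ, E) p y) := by
    filter_upwards [hqp] with y hy
    change β p y • L k (extChartAt 𝓘(ℝ, E) p y) = _
    rw [hy, one_smul]
  rw [chartDeriv_congr h₂, chartDeriv_clm_comp] at h₁
  · rw [map_zero]
    exact h₁
  · rw [extChartAt_source] at hqs
    exact contMDiffAt_extChartAt' hqs

/-- In a chart the tangent vectors are pairs `(x, v)` in `E × E`, and the set is covered by finitely
many images of such pairs under continuously differentiable maps, which do not raise the dimension.
-/
theorem dimH_range_chartDeriv_le {C : Set M} (hC : IsCompact C) {m : ℕ}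
    (F : Fin m → RealFunctions E M) :
    dimH {w | ∃ q ∈ C, ∃ u, chartDeriv E (componentMap F) q u = w} ≤
      (2 * Module.finrank ℝ E : ℕ) := by
  -- Balls inside the chart targets are used because the dimension estimate for differentiable
  -- images requires a convex domain.
  have hr : ∀ p : M, ∃ r > 0,
      Metric.ball (extChartAt 𝓘(ℝ, E) p p) r ⊆ (extChartAt 𝓘(ℝ, E) p).target := fun p =>
    Metric.mem_nhds_iff.mp (extChartAt_target_mem_nhds p)
  choose r hr₀ hr using hr
  obtain ⟨t, -, ht⟩ := hC.elim_nhds_subcover (fun p => (extChartAt 𝓘(ℝ, E) p).source ∩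
    extChartAt 𝓘(ℝ, E) p ⁻¹' Metric.ball (extChartAt 𝓘(ℝ, E) p p) (r p)) fun p _ =>
    Filter.inter_mem (extChartAt_source_mem_nhds p)
      ((continuousAt_extChartAt p).preimage_mem_nhds (Metric.ball_mem_nhds _ (hr₀ p)))
  let g : M → E × E → Fin m → ℝ := fun p z =>
    fderiv ℝ (componentMap F ∘ (extChartAt 𝓘(ℝ, E) p).symm) z.1 z.2
  let s : M → Set (E × E) := fun p => Metric.ball (extChartAt 𝓘(ℝ, E) p p) (r p) ×ˢ Set.univ
  have hsub : {w | ∃ q ∈ C, ∃ u, chartDeriv E (componentMap F) q u = w} ⊆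
      ⋃ p ∈ (t : Set M), g p '' s p := by
    rintro _ ⟨q, hq, u, rfl⟩
    obtain ⟨p, hp, hqp⟩ := Set.mem_iUnion₂.mp (ht hq)
    refine Set.mem_iUnion₂.mpr ⟨p, hp, (extChartAt 𝓘(ℝ, E) p q,
      chartDeriv E (extChartAt 𝓘(ℝ, E) p) q u), ⟨hqp.2, Set.mem_univ _⟩, ?_⟩
    rw [chartDeriv_eq_comp (contMDiff_componentMap F).contMDiffAt hqp.1]
    rfl
  refine (dimH_mono hsub).trans ?_
  rw [dimH_bUnion t.countable_toSet]
  refine iSup₂_le fun p _ => ?_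
  have hg : ContDiffOn ℝ 1 (g p) (s p) := by
    rintro ⟨x, v⟩ ⟨hx, -⟩
    have hx' := hr p hx
    have h₁ := (contMDiff_componentMap F).contMDiffAt.contDiffAt_comp_symm
      ((extChartAt 𝓘(ℝ, E) p).map_target hx')
    rw [(extChartAt 𝓘(ℝ, E) p).right_inv hx'] at h₁
    have h₂ : ContDiffAt ℝ 1 (fderiv ℝ (componentMap F ∘ (extChartAt 𝓘(ℝ, E) p).symm)) x :=
      h₁.fderiv_right (by norm_cast)
    exact ((ContDiffAt.comp (x, v) h₂ contDiffAt_fst).clm_apply contDiffAt_snd).contDiffWithinAt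
  calc dimH (g p '' s p) ≤ dimH (s p) :=
        hg.dimH_image_le ((convex_ball _ _).prod convex_univ) subset_rfl
    _ ≤ dimH (Set.univ : Set (E × E)) := dimH_mono (Set.subset_univ _)
    _ = (2 * Module.finrank ℝ E : ℕ) := by
        rw [Real.dimH_univ_eq_finrank, Module.finrank_prod, two_mul]

/-- Near a compact set there is an immersion whose number of components depends only on the
dimension. -/
theorem exists_immersion_of_isCompact_of_dimension {C : Set M} (hC : IsCompact C) :
    ∃ F : Fin (2 * Module.finrank ℝ E) → RealFunctions E M,
      ∀ q ∈ C, Function.Injective (chartDeriv E (componentMap F) q) := by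
  rcases C.eq_empty_or_nonempty with rfl | ⟨p, hp⟩
  · exact ⟨0, fun q hq => hq.elim⟩
  obtain ⟨m, F, hF⟩ := exists_immersion_of_isCompact (E := E) hC
  -- Composing with a linear map that annihilates no nonzero tangent direction keeps the
  -- differential injective. The set of these directions is a cone because differentials are linear.
  obtain ⟨f, hf⟩ := exists_linearMap_eq_zero_of_dimH_le (dimH_range_chartDeriv_le hC F)
    ⟨p, hp, 0, map_zero _⟩ (by
      rintro c _ ⟨q, hq, u, rfl⟩
      exact ⟨q, hq, c • u, map_smul _ _ _⟩)
  let L : (Fin m → ℝ) →L[ℝ] Fin (2 * Module.finrank ℝ E) → ℝ := LinearMap.toContinuousLinearMap f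
  refine ⟨fun i => ⟨fun q => L (componentMap F q) i, contMDiff_pi_space.mp
    (L.contDiff.contMDiff.comp (contMDiff_componentMap F)) i⟩, fun q hq => ?_⟩
  rw [injective_iff_map_eq_zero]
  intro u hu
  have h := chartDeriv_clm_comp L (contMDiff_componentMap F).contMDiffAt (q := q) u
  refine (injective_iff_map_eq_zero _).mp (hF q hq) u (hf _ ⟨q, hq, u, rfl⟩ ?_)
  exact h.symm.trans hu

end Immersion

/-! ### Annuli of a compact exhaustion -/

namespace CompactExhaustion

variable {M : Type*} [TopologicalSpace M] (K : CompactExhaustion M)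

/-- The open annuli of a compact exhaustion. -/
def annulus : ℕ → Set M
  | 0 => interior (K 1)
  | j + 1 => interior (K (j + 2)) \ K j

theorem annulus_subset (j : ℕ) : K.annulus j ⊆ K (j + 1) := by
  cases j with
  | zero => exact interior_subset
  | succ j => exact Set.sdiff_subset.trans interior_subset

theorem isOpen_annulus [T2Space M] (j : ℕ) : IsOpen (K.annulus j) := by
  cases j with
  | zero => exact isOpen_interior
  | succ j => exact isOpen_interior.sdiff (K.isCompact j).isClosed

theorem exists_mem_annulus (x : M) : ∃ j, x ∈ K.annulus j := by
  refine ⟨K.find x, ?_⟩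
  have h := K.mem_find x
  generalize hj : K.find x = j at h ⊢
  cases j with
  | zero => exact K.subset_interior_succ 0 h
  | succ j =>
    refine ⟨K.subset_interior_succ (j + 1) h, fun h' => ?_⟩
    have := K.mem_iff_find_le.mp h'
    omega

/-- Used in both directions: annuli whose indices differ by two or more are disjoint, in particular
distinct ones with indices of equal parity. -/
theorem le_add_one_of_mem_annulus {x : M} {i j : ℕ} (hi : x ∈ K.annulus i)
    (hj : x ∈ K.annulus j) : j ≤ i + 1 := by
  cases j with
  | zero => exact Nat.zero_le _
  | succ j =>
    by_contra h
    exact hj.2 (K.subset (by omega) (K.annulus_subset i hi))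

end CompactExhaustion

/-! ### A finite dual basis of the real vector fields -/

section Smooth

variable {E M : Type*} [NormedAddCommGroup E] [NormedSpace ℝ E] [FiniteDimensional ℝ E]
  [TopologicalSpace M] [ChartedSpace E M]

theorem RealFunctions.sum_apply {ι : Type*} (s : Finset ι) (f : ι → RealFunctions E M) (q : M) :
    (∑ i ∈ s, f i) q = ∑ i ∈ s, f i q := map_sum (RealFunctions.evalHom q) f s

/-- The members of a family whose index has a given parity. -/
def parityPart {A : Type*} [Zero A] (c : Fin 2) (g : ℕ → A) (j : ℕ) : A :=
  if j % 2 = c then g j else 0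

variable [T2Space M] [SigmaCompactSpace M] [IsManifold 𝓘(ℝ, E) ∞ M]
  {K : CompactExhaustion M} {ρ : SmoothPartitionOfUnity ℕ 𝓘(ℝ, E) M Set.univ}

/-- At most one annulus of a given parity contains `q`. The index does not depend on the family, so
the product of two glued families has no mixed terms. -/
theorem exists_glue_parityPart_eq (hρ : ρ.IsSubordinate K.annulus) (c : Fin 2) (q : M) :
    ∃ j₀ : ℕ, ∀ g : ℕ → RealFunctions E M,
      ρ.glue (parityPart c g) q = if j₀ % 2 = c then ρ j₀ q * g j₀ q else 0 := by
  obtain ⟨j₀, h₀⟩ : ∃ j₀ : ℕ, ∀ j, j ≠ j₀ → j % 2 = c → ρ j q = 0 := by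
    by_cases h : ∃ j₀ : ℕ, j₀ % 2 = c ∧ ρ j₀ q ≠ 0
    · obtain ⟨j₀, hc, h₀⟩ := h
      refine ⟨j₀, fun j hj hjc => ?_⟩
      by_contra h'
      have e₁ := hρ j₀ (subset_tsupport _ h₀)
      have e₂ := hρ j (subset_tsupport _ h')
      have := K.le_add_one_of_mem_annulus e₁ e₂
      have := K.le_add_one_of_mem_annulus e₂ e₁
      omega
    · push Not at h
      exact ⟨0, fun j _ hj => h j hj⟩
  refine ⟨j₀, fun g => ?_⟩
  rw [SmoothPartitionOfUnity.glue_apply, finsum_eq_single _ j₀]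
  · by_cases hc : j₀ % 2 = c
    · simp only [parityPart, if_pos hc]
    · simp only [parityPart, if_neg hc]
      exact mul_zero _
  · intro j hj
    by_cases hc : j % 2 = c
    · rw [h₀ j hj hc, zero_mul]
    · simp only [parityPart, if_neg hc]
      exact mul_zero _

/-- The vector fields form a finitely generated projective module. -/
theorem exists_dualBasis_vectorFields (E M : Type*) [NormedAddCommGroup E] [NormedSpace ℝ E]
    [FiniteDimensional ℝ E] [TopologicalSpace M] [ChartedSpace E M] [T2Space M]
    [SigmaCompactSpace M] [IsManifold 𝓘(ℝ, E) ∞ M] :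
    ∃ (ι : Type) (_ : Fintype ι) (e : ι → VectorFields E M)
      (θ : ι → VectorFields E M →ₗ[RealFunctions E M] RealFunctions E M),
      ∀ X, ∑ i, θ i X • e i = X := by
  have : LocallyCompactSpace M := ChartedSpace.locallyCompactSpace E M
  let K : CompactExhaustion M := default
  -- The number of components is the same for all `j`; otherwise the families could not be glued
  -- component by component.
  choose F hF using fun j : ℕ => exists_immersion_of_isCompact_of_dimension (E := E)
    (K.isCompact (j + 1))
  choose D hD using fun j : ℕ => exists_dualFields_of_isClosed (K.isCompact (j + 1)).isClosed
    (F j) (hF j)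
  obtain ⟨ρ, hρ⟩ := SmoothPartitionOfUnity.exists_isSubordinate 𝓘(ℝ, E) isClosed_univ K.annulus
    K.isOpen_annulus fun x _ => Set.mem_iUnion.mpr (K.exists_mem_annulus x)
  let ρ' : ℕ → RealFunctions E M := fun j => ⟨ρ j, (ρ j).contMDiff⟩
  -- This is `∑ ρⱼ²`. Forms and fields both carry a factor `ρⱼ`, so their products have to be
  -- normalised by `1 / s`.
  let s : RealFunctions E M := ∑ c, ρ.glue (parityPart c ρ')
  have hs : ∀ q, s q ≠ 0 := by
    intro q
    refine ne_of_gt ?_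
    change 0 < (∑ c, ρ.glue (parityPart c ρ')) q
    rw [RealFunctions.sum_apply]
    have hnn : ∀ c j, 0 ≤ ρ j q * parityPart c ρ' j q := by
      intro c j
      refine mul_nonneg (ρ.nonneg j q) ?_
      by_cases hc : j % 2 = c
      · simp only [parityPart, if_pos hc]
        exact ρ.nonneg j q
      · simp only [parityPart, if_neg hc]
        exact le_rfl
    obtain ⟨j, hj⟩ := ρ.exists_pos_of_mem (Set.mem_univ q)
    refine Finset.sum_pos' (fun c _ => finsum_nonneg (hnn c))
      ⟨⟨j % 2, Nat.mod_lt _ two_pos⟩, Finset.mem_univ _, ?_⟩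
    refine finsum_pos (hnn _) ⟨j, ?_⟩ (ρ.finite_support_mul _ q)
    simp only [parityPart, if_true]
    exact mul_pos hj hj
  let u : RealFunctions E M := ⟨fun q => (s q)⁻¹, s.contMDiff.inv₀ hs⟩
  let e : Fin 2 × Fin (2 * Module.finrank ℝ E) → VectorFields E M := fun i =>
    ρ.glueField (parityPart i.1 fun j => D j i.2)
  let θ : Fin 2 × Fin (2 * Module.finrank ℝ E) →
      VectorFields E M →ₗ[RealFunctions E M] RealFunctions E M := fun i =>
    { toFun := fun X => u * ρ.glue (parityPart i.1 fun j => X (F j i.2))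
      map_add' := fun X Y => by
        rw [← mul_add, ← ρ.glue_add]
        congr 2
        funext j
        by_cases hc : j % 2 = i.1
        · simp only [parityPart, if_pos hc, Derivation.add_apply]
        · simp only [parityPart, if_neg hc, add_zero]
      map_smul' := fun g X => by
        rw [RingHom.id_apply, smul_eq_mul, mul_left_comm g, ← ρ.glue_mul g]
        congr 2
        funext j
        by_cases hc : j % 2 = i.1
        · simp only [parityPart, if_pos hc, Derivation.smul_apply, smul_eq_mul]
        · simp only [parityPart, if_neg hc, mul_zero] }
  refine ⟨_, inferInstance, e, θ, fun X => ?_⟩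
  ext f q
  change RealFunctions.evalHom q (Derivation.coeFnAddMonoidHom (∑ i, θ i X • e i) f) = _
  rw [map_sum, Finset.sum_apply, map_sum, Fintype.sum_prod_type]
  -- For each parity a single index `j₀` contributes at `q`, and the identity of the dual fields on
  -- its annulus gives `ρ j₀ q ^ 2` times `X f q`.
  have h₁ : ∀ c, ∑ i, ρ.glue (parityPart c fun j => X (F j i)) q *
      ρ.glue (parityPart c fun j => D j i f) q = ρ.glue (parityPart c ρ') q * X f q := by
    intro c
    obtain ⟨j₀, h₀⟩ := exists_glue_parityPart_eq hρ c q
    simp only [h₀]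
    by_cases hc : j₀ % 2 = c
    · simp only [if_pos hc]
      by_cases h : ρ j₀ q = 0
      · simp [h]
      · rw [hD j₀ q (K.annulus_subset j₀ (hρ j₀ (subset_tsupport _ h))) X f, Finset.mul_sum]
        refine Finset.sum_congr rfl fun i _ => ?_
        change _ = ρ j₀ q * ρ j₀ q * _
        ring
    · simp only [if_neg hc, zero_mul, Finset.sum_const_zero]
  have h₂ : ∀ c i, RealFunctions.evalHom q
      (Derivation.coeFnAddMonoidHom (θ (c, i) X • e (c, i)) f) = (s q)⁻¹ *
      (ρ.glue (parityPart c fun j => X (F j i)) q *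
        ρ.glue (parityPart c fun j => D j i f) q) := by
    intro c i
    have : (fun j => parityPart c (fun j => D j i) j f) = parityPart c fun j => D j i f := by
      funext j
      by_cases hc : j % 2 = c
      · simp only [parityPart, if_pos hc]
      · simp only [parityPart, if_neg hc, Derivation.zero_apply]
    rw [← this]
    exact mul_assoc _ _ _
  simp only [h₂, ← Finset.mul_sum, h₁]
  rw [← Finset.sum_mul, ← mul_assoc]
  have h₃ : s q = ∑ c, ρ.glue (parityPart c ρ') q := RealFunctions.sum_apply _ _ _
  rw [← h₃, inv_mul_cancel₀ (hs q), one_mul]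

end Smooth

/-! ### Complexification and the integrability criterion -/

section Complexification

variable {E M : Type*} [NormedAddCommGroup E] [NormedSpace ℝ E]
  [TopologicalSpace M] [ChartedSpace E M]


/-- The complex linear extension of a linear form on the vector fields. -/
def complexForm (θ : VectorFields E M →ₗ[RealFunctions E M] RealFunctions E M) :
    ComplexVectorFields E M →ₗ[ComplexFunctions E M] ComplexFunctions E M where
  toFun D := ofRealFunction (θ (reField D)) + Complex.I • ofRealFunction (θ (imField D))
  map_add' D D' := by
    simp only [reField_add, imField_add, map_add, ofRealFunction_add, smul_add]
    abel
  map_smul' g D := by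
    rw [reField_smul, imField_smul]
    simp only [map_add, map_sub, map_smul, RingHom.id_apply]
    ext m
    apply Complex.ext <;> simp [ComplexFunctions.smul_apply]

theorem reFunction_complexForm (θ : VectorFields E M →ₗ[RealFunctions E M] RealFunctions E M)
    (D : ComplexVectorFields E M) : reFunction (complexForm θ D) = θ (reField D) := by
  ext m
  simp [complexForm, ComplexFunctions.smul_apply]

theorem imFunction_complexForm (θ : VectorFields E M →ₗ[RealFunctions E M] RealFunctions E M)
    (D : ComplexVectorFields E M) : imFunction (complexForm θ D) = θ (imField D) := by
  ext m
  simp [complexForm, ComplexFunctions.smul_apply]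

/-- The real and imaginary parts of the sum are the real expansions of the real and imaginary parts
of `D`. -/
theorem sum_complexForm_smul {ι : Type*} [Fintype ι] {e : ι → VectorFields E M}
    {θ : ι → VectorFields E M →ₗ[RealFunctions E M] RealFunctions E M}
    (h : ∀ X, ∑ i, θ i X • e i = X) (D : ComplexVectorFields E M) :
    ∑ i, complexForm (θ i) D • complexField (e i) 0 = D := by
  have hr : ∀ s : Finset ι, reField (∑ i ∈ s, complexForm (θ i) D • complexField (e i) 0) =
      ∑ i ∈ s, θ i (reField D) • e i := by
    intro s
    refine (map_sum (⟨⟨reField, ?_⟩, reField_add⟩ :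
      ComplexVectorFields E M →+ VectorFields E M) _ s).trans (Finset.sum_congr rfl fun i _ => ?_)
    · ext f m; simp [reField_apply]
    · change reField _ = _
      rw [reField_smul, reField_complexField, imField_complexField, reFunction_complexForm,
        smul_zero, sub_zero]
  have hi : ∀ s : Finset ι, imField (∑ i ∈ s, complexForm (θ i) D • complexField (e i) 0) =
      ∑ i ∈ s, θ i (imField D) • e i := by
    intro s
    refine (map_sum (⟨⟨imField, ?_⟩, imField_add⟩ :
      ComplexVectorFields E M →+ VectorFields E M) _ s).trans (Finset.sum_congr rfl fun i _ => ?_)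
    · ext f m; simp [imField_apply]
    · change imField _ = _
      rw [imField_smul, reField_complexField, imField_complexField, imFunction_complexForm,
        smul_zero, zero_add]
  apply complexVectorFields_ext
  · rw [hr, h]
  · rw [hi, h]

variable [FiniteDimensional ℝ E] [T2Space M] [SigmaCompactSpace M] [IsManifold 𝓘(ℝ, E) ∞ M]

instance finite_complexVectorFields :
    Module.Finite (ComplexFunctions E M) (ComplexVectorFields E M) := by
  obtain ⟨ι, _, e, θ, h⟩ := exists_dualBasis_vectorFields E M
  exact (projective_of_dualBasis _ _ (sum_complexForm_smul h)).1

instance projective_complexVectorFields :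
    Module.Projective (ComplexFunctions E M) (ComplexVectorFields E M) := by
  obtain ⟨ι, _, e, θ, h⟩ := exists_dualBasis_vectorFields E M
  exact (projective_of_dualBasis _ _ (sum_complexForm_smul h)).2

theorem Submodule.finite_of_isCompl {A N : Type*} [CommRing A] [AddCommGroup N] [Module A N]
    [Module.Finite A N] {K K' : Submodule A N} (h : IsCompl K K') : Module.Finite A K :=
  Module.Finite.of_surjective (K.projectionOnto K' h) (K.projectionOnto_surjective h)

theorem Submodule.projective_of_isCompl {A N : Type*} [CommRing A] [AddCommGroup N] [Module A N]
    [Module.Projective A N] {K K' : Submodule A N} (h : IsCompl K K') : Module.Projective A K :=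
  Module.Projective.of_split K.subtype (K.projectionOnto K' h)
    (Submodule.projectionOnto_comp_subtype h)

/-- The direct implication constructs the bracket and needs the finite dual basis of the holomorphic
fields. The converse relies only on the vanishing of the square of `d''`. -/
theorem AlmostComplexStructure.isIntegrable_iff (S : AlmostComplexStructure E M) :
    S.IsIntegrable ↔ ∃ br, S.almostTwilledPre.IsCrossedProductBracket br ∧
      S.almostTwilledPre.IsDifferentialGerstenhaber br := by
  constructor
  · intro h
    have := Submodule.finite_of_isCompl S.isCompl
    have := Submodule.projective_of_isCompl S.isCompl
    exact S.almostTwilledPre.exists_isDifferentialGerstenhaber h.isTwilled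
  · rintro ⟨br, -, h⟩
    exact isIntegrable_of_dBar_dBar h.d_d

end Complexification

end

theorem theorem4p4 :
    (∀ {R : Type u₁} {A : Type u₂} {L' : Type u₃} {L'' : Type u₄}
      [CommRing R] [CommRing A] [Algebra R A]
      [AddCommGroup L'] [Module R L'] [Module A L'] [IsScalarTower R A L']
      [AddCommGroup L''] [Module R L''] [Module A L''] [IsScalarTower R A L'']
      [Module.Finite A L'] [Module.Projective A L'],
      IsUnit (2 : R) → IsUnit (3 : R) →
      ∀ S : AlmostTwilledPre R A L' L'', S.IsAlmostTwilled →
      ∃ br : PolyForms A L' L'' →ₗ[R] PolyForms A L' L'' →ₗ[R] PolyForms A L' L'',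
        S.IsCrossedProductBracket br ∧
        (∀ br', S.IsCrossedProductBracket br' → br' = br) ∧
        S.IsGerstenhaber br ∧
        (S.IsTwilled → S.IsDifferentialGerstenhaber br) ∧
        (PropertyP A L'' → S.IsDifferentialGerstenhaber br → S.IsTwilled)) ∧
    (∀ {E : Type u₅} {M : Type u₆} [NormedAddCommGroup E] [NormedSpace ℝ E]
      [FiniteDimensional ℝ E] [TopologicalSpace M] [T2Space M] [SigmaCompactSpace M]
      [ChartedSpace E M] [IsManifold (modelWithCornersSelf ℝ E) ∞ M]
      (J : AlmostComplexStructure E M),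
      J.IsIntegrable ↔
        ∃ br, J.almostTwilledPre.IsCrossedProductBracket br ∧
          J.almostTwilledPre.IsDifferentialGerstenhaber br) := by
  refine ⟨fun _ _ S hS => S.existsUnique_crossedProductBracket hS, fun J => J.isIntegrable_iff⟩
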